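/- **Setting.** Let $\mathcal G$ be a locally compact Hausdorff groupoid with locally compact Hausdorff unit space $X$, range and source maps $r,s$ and a left Haar system $\lambda=(\lambda^x)_{x\in X}$. Write $\mathcal G^x=r^{-1}(x)$, $\mathcal G_x=s^{-1}(x)$. A semi-norm $\|\cdot\|$ on $C_c(Y)$, $Y$ locally compact Hausdorff, is *monotone* if $|\varphi|\le|\psi|$ pointwise implies $\|\varphi\|\le\|\psi\|$; one puts $\|\varphi\|=\inf\{\|\psi\|:\psi\in C_c(Y),\ \varphi\le|\psi|\}$ for bounded $\varphi\ge 0$ with compact support. An *unconditional* semi-norm $\|\cdot\|_{\mathcal A}$ on $C_c(\mathcal G)$ is a monotone semi-norm that is submultiplicative for the convolution; its Hausdorff completion $\mathcal A(\mathcal G)$ is an unconditional completion. It is *regular* if there are monotone semi-norms $\|\cdot\|_<$, $\|\cdot\|_>$ on $C_c(\mathcal G)$ such that - (H1) $\left|\int_{\mathcal G^x}\varphi(\gamma)\,\psi(\gamma^{-1})\,d\lambda^x(\gamma)\right|\le\|\varphi\|_<\|\psi\|_>$ for all $\varphi,\psi\in C_c(\mathcal G)$, $x\in X$; - (H2) $\|\xi*\chi\|_<\le\|\xi\|_<\|\chi\|_{\mathcal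 A}$ and $\|\chi*\xi\|_>\le\|\chi\|_{\mathcal A}\|\xi\|_>$ for all $\xi,\chi\in C_c(\mathcal G)$; - (H3) for $\chi_1,\chi_2\in C_0(X)$ with $\chi_i\ge 0$, $\chi_1+\chi_2\le 1$ one has $\|(\chi_1\circ r)\xi_1+(\chi_2\circ r)\xi_2\|_<\le\max\{\|\xi_1\|_<,\|\xi_2\|_<\}$ for all $\xi_1,\xi_2 \in C_c(\mathcal G)$, and likewise for $\|\cdot\|_>$ with $s$ in place of $r$; - (H4) for every $\gamma\in\mathcal G$ the translations $C_c(\mathcal G^{s(\gamma)})\to C_c(\mathcal G^{r(\gamma)})$, $(\gamma\chi)(\gamma')=\chi(\gamma^{-1}\gamma')$, and $C_c(\mathcal G_{s(\gamma)})\to C_c(\mathcal G_{r(\gamma)})$, $(\gamma\chi)(\gamma')=\chi(\gamma'\gamma)$, are isometric for the quotient semi-norms which $\|\cdot\|_<$ and $\|\cdot\|_>$, respectively, induce by restriction of functions to the fibres. A *$\mathcal G$-Banach algebra* $B$ is an upper semi-continuous field of complex Banach algebras $(B_x)_{x\in X}$ with a continuous action of $\mathcal G$ by isometric isomorphisms $B_{s(\gamma)}\to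 B_{r(\gamma)}$. It is *non-degenerate* if for every $x$ the span of $B_xB_x$ is dense in $B_x$. It is *proper* if there are a locally compact Hausdorff $\mathcal G$-space $Z$ with anchor map $\rho$ such that the groupoid $\mathcal G\ltimes Z$ is proper, and a $\mathcal G\ltimes Z$-Banach algebra $\hat B$, such that $B$ is isomorphic to $\rho_*\hat B$; here $(\rho_*\hat B)_x=\Gamma_0(\rho^{-1}(x),\hat B)$, $\Gamma_0(X,\rho_*\hat B)=\{x\mapsto\xi|_{\rho^{-1}(x)}:\xi\in\Gamma_0(Z,\hat B)\}$, and $(\gamma\zeta)(z)=(\gamma,z)\,\zeta(\gamma^{-1}z)$. A groupoid is *proper* if preimages of compact sets under $(r,s)$ are compact. The space $\Gamma_c(\mathcal G,r^*B)$ of continuous compactly supported sections is an algebra under $(\sigma*\tau)(\gamma)=\int_{\mathcal G^{r(\gamma)}}\sigma(\gamma')\,\gamma'\tau(\gamma'^{-1}\gamma)\,d\lambda^{r(\gamma)}(\gamma')$; $\mathcal A(\mathcal G,B)$ is its Hausdorff completion for the semi-norm $\|\sigma\|_{\mathcal A}=\big\|\gamma\mapsto\|\sigma(\gamma)\|\big\|_{\mathcal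 A}$, and $\iota$ is the canonical map into it. $K_n(D)=K_0(C_0(\mathbb R^n,D))$ for a Banach algebra $D$ and $n\ge 0$. **Proposition.** Let $B$ be a non-degenerate $\mathcal G$-Banach algebra and let $\|\cdot\|_{\mathcal A}$, $\|\cdot\|_{\mathcal A'}$ be regular unconditional semi-norms on $C_c(\mathcal G)$. 1. Assume that $B$ is proper, or that $\mathcal G$ is proper. For every unconditional semi-norm $\|\cdot\|_{\mathcal C}$ on $C_c(\mathcal G)$ that dominates $\|\cdot\|_{\mathcal A}$ and $\|\cdot\|_{\mathcal A'}$, let $\psi_{\mathcal C}:\mathcal C(\mathcal G,B)\to\mathcal A(\mathcal G,B)$ and $\psi'_{\mathcal C}:\mathcal C(\mathcal G,B)\to\mathcal A'(\mathcal G,B)$ be the canonical homomorphisms. Then $(\psi_{\mathcal C})_*$ and $(\psi'_{\mathcal C})_*$ are isomorphisms on $K_n$ for all $n\ge 0$. Moreover, for every $n\geq 0$ there is exactly one isomorphism $\Phi:K_n(\mathcal A(\mathcal G,B))\to K_n(\mathcal A'(\mathcal G,B))$ such that $\Phi\circ(\psi_{\mathcal C})_*=(\psi'_{\mathcal C})_*$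 for all such $\mathcal C$. 2. If $\mathcal G$ is proper, then $\iota(\Gamma_c(\mathcal G,r^*B))$ is a hereditary subalgebra of $\mathcal A(\mathcal G,B)$, i.e. $\iota(\sigma)\,a\,\iota(\tau)\in\iota(\Gamma_c(\mathcal G,r^*B))$ for all $\sigma,\tau\in\Gamma_c(\mathcal G,r^*B)$ and $a\in\mathcal A(\mathcal G,B)$, and the kernel $N$ of $\iota$ satisfies $\Gamma_c(\mathcal G,r^*B)\,N\,\Gamma_c(\mathcal G,r^*B)=0$; in particular $N^3=0$. -/

import Mathlib

open MeasureTheory Topology Filter Set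
open scoped CompactlySupported ZeroAtInfty ENNReal

universe uX uG uB uZ uB'

set_option linter.unusedSectionVars false

noncomputable section

namespace ProperBanach

/-! ### Topological groupoids, Haar systems, groupoid spaces -/

/-- A topological groupoid with unit space `X` and space of arrows `G`; `mul γ η` is the product
of the composable pair `s γ = r η` (its values at other pairs play no role). -/
structure TopGroupoid (X G : Type*) [TopologicalSpace X] [TopologicalSpace G] where
  r : G → X
  s : G → X
  unit : X → G
  inv : G → G
  mul : G → G → G
  continuous_r : Continuous r
  continuous_s : Continuous s
  continuous_unit : Continuous unit
  continuous_inv : Continuous inv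
  continuousOn_mul : ContinuousOn (fun p : G × G => mul p.1 p.2) {p | s p.1 = r p.2}
  r_unit : ∀ x, r (unit x) = x
  s_unit : ∀ x, s (unit x) = x
  r_inv : ∀ γ, r (inv γ) = s γ
  s_inv : ∀ γ, s (inv γ) = r γ
  r_mul : ∀ γ η, s γ = r η → r (mul γ η) = r γ
  s_mul : ∀ γ η, s γ = r η → s (mul γ η) = s η
  mul_assoc : ∀ γ η ζ, s γ = r η → s η = r ζ → mul (mul γ η) ζ = mul γ (mul η ζ)
  unit_mul : ∀ γ, mul (unit (r γ)) γ = γ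
  mul_unit : ∀ γ, mul γ (unit (s γ)) = γ
  inv_mul : ∀ γ, mul (inv γ) γ = unit (s γ)
  mul_inv : ∀ γ, mul γ (inv γ) = unit (r γ)

namespace TopGroupoid

variable {X G : Type*} [TopologicalSpace X] [TopologicalSpace G] (𝒢 : TopGroupoid X G)

theorem r_inv_mul {γ η : G} (h : 𝒢.r γ = 𝒢.r η) : 𝒢.r (𝒢.mul (𝒢.inv γ) η) = 𝒢.s γ := by
  rw [𝒢.r_mul _ _ (by rw [𝒢.s_inv, h]), 𝒢.r_inv]

theorem s_inv_mul {γ η : G} (h : 𝒢.r γ = 𝒢.r η) : 𝒢.s (𝒢.mul (𝒢.inv γ) η) = 𝒢.s η :=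
  𝒢.s_mul _ _ (by rw [𝒢.s_inv, h])

theorem mul_inv_mul {γ η : G} (h : 𝒢.r γ = 𝒢.r η) : 𝒢.mul γ (𝒢.mul (𝒢.inv γ) η) = η := by
  rw [← 𝒢.mul_assoc _ _ _ (𝒢.r_inv γ).symm (by rw [𝒢.s_inv, h]), 𝒢.mul_inv, h, 𝒢.unit_mul]

theorem inv_mul_mul {γ η : G} (h : 𝒢.s γ = 𝒢.r η) : 𝒢.mul (𝒢.inv γ) (𝒢.mul γ η) = η := by
  rw [← 𝒢.mul_assoc _ _ _ (𝒢.s_inv γ) h, 𝒢.inv_mul, h, 𝒢.unit_mul]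

theorem eq_of_inv_mul {γ η ζ : G} (h : 𝒢.s γ = 𝒢.r η) (hz : 𝒢.mul γ η = ζ) :
    η = 𝒢.mul (𝒢.inv γ) ζ := by rw [← hz, 𝒢.inv_mul_mul h]

theorem eq_inv_of_mul {γ η : G} (h : 𝒢.s γ = 𝒢.r η) (hu : 𝒢.mul γ η = 𝒢.unit (𝒢.r γ)) :
    η = 𝒢.inv γ := by
  have h1 := 𝒢.eq_of_inv_mul h hu
  rw [h1]
  have h2 := 𝒢.mul_unit (𝒢.inv γ)
  rwa [𝒢.s_inv] at h2

theorem inv_mul_rev {γ η : G} (h : 𝒢.s γ = 𝒢.r η) :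
    𝒢.inv (𝒢.mul γ η) = 𝒢.mul (𝒢.inv η) (𝒢.inv γ) := by
  have h1 : 𝒢.s (𝒢.inv η) = 𝒢.r (𝒢.inv γ) := by rw [𝒢.s_inv, 𝒢.r_inv, h]
  symm
  apply 𝒢.eq_inv_of_mul
  · rw [𝒢.s_mul _ _ h, 𝒢.r_mul _ _ h1, 𝒢.r_inv]
  · rw [𝒢.mul_assoc _ _ _ h (by rw [𝒢.r_mul _ _ h1, 𝒢.r_inv]),
      ← 𝒢.mul_assoc η _ _ (𝒢.r_inv η).symm h1, 𝒢.mul_inv, ← h, ← 𝒢.r_inv γ, 𝒢.unit_mul,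
      𝒢.mul_inv, 𝒢.r_mul _ _ h]

/-- A groupoid is proper if `(r, s) : G → X × X` is proper: inverse images of compact sets are
compact. -/
def IsProper : Prop :=
  ∀ K : Set (X × X), IsCompact K → IsCompact ((fun γ => (𝒢.r γ, 𝒢.s γ)) ⁻¹' K)

/-- Left translation `G^{s(γ)} → G^{r(γ)}`, `η ↦ γη`, where `G^x = r⁻¹(x)`. -/
def leftMul (γ : G) (η : {η : G // 𝒢.r η = 𝒢.s γ}) : {η : G // 𝒢.r η = 𝒢.r γ} :=
  ⟨𝒢.mul γ η, 𝒢.r_mul _ _ η.2.symm⟩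

/-- The map `G^{r(γ)} → G^{s(γ)}`, `η ↦ γ⁻¹η`. -/
def leftDiv (γ : G) (η : {η : G // 𝒢.r η = 𝒢.r γ}) : {η : G // 𝒢.r η = 𝒢.s γ} :=
  ⟨𝒢.mul (𝒢.inv γ) η, 𝒢.r_inv_mul η.2.symm⟩

/-- Right translation `G_{r(γ)} → G_{s(γ)}`, `η ↦ ηγ`, where `G_x = s⁻¹(x)`. -/
def rightMul (γ : G) (η : {η : G // 𝒢.s η = 𝒢.r γ}) : {η : G // 𝒢.s η = 𝒢.s γ} :=
  ⟨𝒢.mul η γ, 𝒢.s_mul _ _ η.2⟩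

/-- A (left) Haar system: a family of Radon measures `μ x` with full support on the fibres
`G^x = r⁻¹(x)`, continuous in `x` and invariant under left translation. -/
structure HaarSystem [MeasurableSpace G] where
  μ : ∀ x : X, Measure {γ : G // 𝒢.r γ = x}
  regular : ∀ x, (μ x).Regular
  fullSupport : ∀ x, (μ x).IsOpenPosMeasure
  continuous_integral : ∀ f : C_c(G, ℂ), Continuous fun x => ∫ γ, f γ ∂(μ x)
  leftInvariant : ∀ γ : G, (μ (𝒢.s γ)).map (𝒢.leftMul γ) = μ (𝒢.r γ)

/-- A left `G`-space `Z` with anchor map `ρ`; `smul γ z` is defined for `s γ = ρ z` (its values at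
other pairs play no role). -/
structure Space (Z : Type*) [TopologicalSpace Z] where
  ρ : Z → X
  smul : G → Z → Z
  continuous_ρ : Continuous ρ
  continuousOn_smul : ContinuousOn (fun p : G × Z => smul p.1 p.2) {p | 𝒢.s p.1 = ρ p.2}
  ρ_smul : ∀ γ z, 𝒢.s γ = ρ z → ρ (smul γ z) = 𝒢.r γ
  unit_smul : ∀ z, smul (𝒢.unit (ρ z)) z = z
  mul_smul : ∀ γ η z, 𝒢.s γ = 𝒢.r η → 𝒢.s η = ρ z → smul (𝒢.mul γ η) z = smul γ (smul η z)

variable {𝒢}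

namespace Space

variable {Z : Type*} [TopologicalSpace Z] (S : 𝒢.Space Z)

/-- The arrows `(γ, z)`, `r γ = ρ z`, of the transformation groupoid `G ⋉ Z`. -/
abbrev Arrow : Type _ := {p : G × Z // 𝒢.r p.1 = S.ρ p.2}

theorem ρ_inv_smul {γ : G} {z : Z} (h : 𝒢.r γ = S.ρ z) :
    S.ρ (S.smul (𝒢.inv γ) z) = 𝒢.s γ := by
  rw [S.ρ_smul _ _ (by rw [𝒢.s_inv, h]), 𝒢.r_inv]

open Classical in
/-- The transformation groupoid `G ⋉ Z` with unit space `Z`: the arrow `(γ, z)` has range `z` and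
source `γ⁻¹z`, and `(γ, z)(η, γ⁻¹z) = (γη, z)`. -/
def transformationGroupoid : TopGroupoid Z S.Arrow where
  r p := p.1.2
  s p := S.smul (𝒢.inv p.1.1) p.1.2
  unit z := ⟨(𝒢.unit (S.ρ z), z), 𝒢.r_unit _⟩
  inv p := ⟨(𝒢.inv p.1.1, S.smul (𝒢.inv p.1.1) p.1.2), by
    rw [𝒢.r_inv, S.ρ_inv_smul p.2]⟩
  mul p q := if h : 𝒢.s p.1.1 = 𝒢.r q.1.1 then
      ⟨(𝒢.mul p.1.1 q.1.1, p.1.2), by rw [𝒢.r_mul _ _ h, p.2]⟩ else p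
  continuous_r := continuous_snd.comp continuous_subtype_val
  continuous_s := by
    refine S.continuousOn_smul.comp_continuous
      (f := fun p : S.Arrow => (𝒢.inv p.1.1, p.1.2)) ?_ ?_
    · exact (𝒢.continuous_inv.comp (continuous_fst.comp continuous_subtype_val)).prodMk
        (continuous_snd.comp continuous_subtype_val)
    · intro p
      change 𝒢.s (𝒢.inv p.1.1) = S.ρ p.1.2
      rw [𝒢.s_inv, p.2]
  continuous_unit := by
    refine Continuous.subtype_mk ?_ _
    exact (𝒢.continuous_unit.comp S.continuous_ρ).prodMk continuous_id
  continuous_inv := by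
    refine Continuous.subtype_mk ?_ _
    refine (𝒢.continuous_inv.comp (continuous_fst.comp continuous_subtype_val)).prodMk ?_
    refine S.continuousOn_smul.comp_continuous
      (f := fun p : S.Arrow => (𝒢.inv p.1.1, p.1.2)) ?_ ?_
    · exact (𝒢.continuous_inv.comp (continuous_fst.comp continuous_subtype_val)).prodMk
        (continuous_snd.comp continuous_subtype_val)
    · intro p
      change 𝒢.s (𝒢.inv p.1.1) = S.ρ p.1.2
      rw [𝒢.s_inv, p.2]
  continuousOn_mul := by
    have hc : ∀ p : S.Arrow × S.Arrow,
        S.smul (𝒢.inv p.1.1.1) p.1.1.2 = p.2.1.2 → 𝒢.s p.1.1.1 = 𝒢.r p.2.1.1 := by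
      intro p hp
      rw [p.2.2, ← hp, S.ρ_inv_smul p.1.2]
    rw [continuousOn_iff_continuous_domRestrict]
    have : Continuous fun p : {p : S.Arrow × S.Arrow //
        S.smul (𝒢.inv p.1.1.1) p.1.1.2 = p.2.1.2} =>
        (⟨(𝒢.mul p.1.1.1.1 p.1.2.1.1, p.1.1.1.2), by
          rw [𝒢.r_mul _ _ (hc p.1 p.2), p.1.1.2]⟩ : S.Arrow) := by
      refine Continuous.subtype_mk ?_ _
      refine Continuous.prodMk ?_ ?_
      · refine 𝒢.continuousOn_mul.comp_continuous
          (f := fun p : {p : S.Arrow × S.Arrow //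
            S.smul (𝒢.inv p.1.1.1) p.1.1.2 = p.2.1.2} => (p.1.1.1.1, p.1.2.1.1)) ?_ ?_
        · exact (continuous_fst.comp (continuous_subtype_val.comp
            (continuous_fst.comp continuous_subtype_val))).prodMk
            (continuous_fst.comp (continuous_subtype_val.comp
            (continuous_snd.comp continuous_subtype_val)))
        · intro p
          exact hc p.1 p.2
      · exact continuous_snd.comp (continuous_subtype_val.comp
            (continuous_fst.comp continuous_subtype_val))
    refine this.congr fun p => ?_
    simp only [domRestrict_apply]
    rw [dif_pos (hc p.1 p.2)]
  r_unit z := rfl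
  s_unit z := by
    change S.smul (𝒢.inv (𝒢.unit (S.ρ z))) z = z
    have h : 𝒢.inv (𝒢.unit (S.ρ z)) = 𝒢.unit (S.ρ z) := by
      symm
      apply 𝒢.eq_inv_of_mul (by rw [𝒢.s_unit, 𝒢.r_unit])
      have := 𝒢.mul_unit (𝒢.unit (S.ρ z))
      rw [𝒢.s_unit] at this
      rw [this, 𝒢.r_unit]
    rw [h, S.unit_smul]
  r_inv _ := rfl
  s_inv p := by
    change S.smul (𝒢.inv (𝒢.inv p.1.1)) (S.smul (𝒢.inv p.1.1) p.1.2) = p.1.2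
    rw [← S.mul_smul _ _ _ (by rw [𝒢.s_inv]) (by rw [𝒢.s_inv, p.2]), 𝒢.inv_mul, 𝒢.s_inv, p.2,
      S.unit_smul]
  r_mul p q h := by
    have hc : 𝒢.s p.1.1 = 𝒢.r q.1.1 := by rw [q.2, ← h, S.ρ_inv_smul p.2]
    simp only [dif_pos hc]
  s_mul p q h := by
    have hc : 𝒢.s p.1.1 = 𝒢.r q.1.1 := by rw [q.2, ← h, S.ρ_inv_smul p.2]
    simp only [dif_pos hc]
    rw [𝒢.inv_mul_rev hc, S.mul_smul _ _ _ (by rw [𝒢.s_inv, 𝒢.r_inv, hc])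
      (by rw [𝒢.s_inv, p.2]), h]
  mul_assoc p q t h h' := by
    have hc : 𝒢.s p.1.1 = 𝒢.r q.1.1 := by rw [q.2, ← h, S.ρ_inv_smul p.2]
    have hc' : 𝒢.s q.1.1 = 𝒢.r t.1.1 := by rw [t.2, ← h', S.ρ_inv_smul q.2]
    have h1 : 𝒢.s (𝒢.mul p.1.1 q.1.1) = 𝒢.r t.1.1 := by rw [𝒢.s_mul _ _ hc, hc']
    have h2 : 𝒢.s p.1.1 = 𝒢.r (𝒢.mul q.1.1 t.1.1) := by rw [𝒢.r_mul _ _ hc', hc]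
    simp only [dif_pos hc, dif_pos hc', dif_pos h1, dif_pos h2]
    exact Subtype.ext (Prod.ext (𝒢.mul_assoc _ _ _ hc hc') rfl)
  unit_mul p := by
    have hc : 𝒢.s (𝒢.unit (S.ρ p.1.2)) = 𝒢.r p.1.1 := by rw [𝒢.s_unit, p.2]
    simp only [dif_pos hc]
    apply Subtype.ext
    change (𝒢.mul (𝒢.unit (S.ρ p.1.2)) p.1.1, p.1.2) = p.1
    rw [← p.2, 𝒢.unit_mul]
  mul_unit p := by
    have hu : S.ρ (S.smul (𝒢.inv p.1.1) p.1.2) = 𝒢.s p.1.1 := S.ρ_inv_smul p.2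
    have hc : 𝒢.s p.1.1 = 𝒢.r (𝒢.unit (S.ρ (S.smul (𝒢.inv p.1.1) p.1.2))) := by
      rw [𝒢.r_unit, hu]
    simp only [dif_pos hc]
    apply Subtype.ext
    change (𝒢.mul p.1.1 (𝒢.unit (S.ρ (S.smul (𝒢.inv p.1.1) p.1.2))), p.1.2) = p.1
    rw [hu, 𝒢.mul_unit]
  inv_mul p := by
    have hc : 𝒢.s (𝒢.inv p.1.1) = 𝒢.r p.1.1 := 𝒢.s_inv _
    simp only [dif_pos hc]
    apply Subtype.ext
    refine Prod.ext ?_ rfl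
    change 𝒢.mul (𝒢.inv p.1.1) p.1.1 = 𝒢.unit (S.ρ (S.smul (𝒢.inv p.1.1) p.1.2))
    rw [𝒢.inv_mul, S.ρ_inv_smul p.2]
  mul_inv p := by
    have hc : 𝒢.s p.1.1 = 𝒢.r (𝒢.inv p.1.1) := (𝒢.r_inv _).symm
    simp only [dif_pos hc]
    apply Subtype.ext
    change (𝒢.mul p.1.1 (𝒢.inv p.1.1), p.1.2) = _
    rw [𝒢.mul_inv, p.2]

/-- A `G`-space `Z` is proper if the groupoid `G ⋉ Z` is proper. -/
def IsProper : Prop := S.transformationGroupoid.IsProper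

end Space

end TopGroupoid

/-! ### Upper semi-continuous fields of Banach spaces -/

section Transport

variable {X : Type*} {E : X → Type*}

/-- Identification of the fibres over equal points. -/
def transport {x y : X} (h : x = y) (e : E x) : E y := h ▸ e

theorem transport_rfl {x : X} (h : x = x) (e : E x) : transport h e = e := rfl

theorem norm_transport [∀ x, Norm (E x)] {x y : X} (h : x = y) (e : E x) :
    ‖transport h e‖ = ‖e‖ := by subst h; rfl

theorem transport_zero [∀ x, Zero (E x)] {x y : X} (h : x = y) :
    transport h (0 : E x) = 0 := by subst h; rfl

theorem transport_add [∀ x, Add (E x)] {x y : X} (h : x = y) (e f : E x) :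
    transport h (e + f) = transport h e + transport h f := by subst h; rfl

theorem transport_sub [∀ x, Sub (E x)] {x y : X} (h : x = y) (e f : E x) :
    transport h (e - f) = transport h e - transport h f := by subst h; rfl

theorem transport_smul [∀ x, SMul ℂ (E x)] {x y : X} (h : x = y) (c : ℂ) (e : E x) :
    transport h (c • e) = c • transport h e := by subst h; rfl

theorem transport_mul [∀ x, Mul (E x)] {x y : X} (h : x = y) (e f : E x) :
    transport h (e * f) = transport h e * transport h f := by subst h; rfl

theorem transport_section (b : ∀ x, E x) {x y : X} (h : x = y) : transport h (b x) = b y := by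
  subst h; rfl

end Transport

/-- An upper semi-continuous field of Banach spaces over `X` with fibres `E x`, given by its space
`sections` of (continuous) sections. -/
structure BanachField {X : Type*} [TopologicalSpace X] (E : X → Type*)
    [∀ x, NormedAddCommGroup (E x)] [∀ x, NormedSpace ℂ (E x)] where
  sections : Submodule ℂ (∀ x, E x)
  dense : ∀ x, Dense ((fun ξ : ∀ x, E x => ξ x) '' (sections : Set (∀ x, E x)))
  usc : ∀ ξ ∈ sections, UpperSemicontinuous fun x => ‖ξ x‖
  locallyClosed : ∀ ξ : ∀ x, E x,
    (∀ x, ∀ ε > 0, ∃ η ∈ sections, ∀ᶠ y in 𝓝 x, ‖ξ y - η y‖ ≤ ε) → ξ ∈ sections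

namespace BanachField

variable {X : Type*} [TopologicalSpace X] {E : X → Type*}
  [∀ x, NormedAddCommGroup (E x)] [∀ x, NormedSpace ℂ (E x)] (F : BanachField E)
  {Y : Type*} [TopologicalSpace Y]

/-- Continuity at `y` of a selection `σ` of the pullback field `p^*E`: `σ` can be approximated near
`y` by pullbacks of sections of `E`. -/
def IsSectionAt (p : Y → X) (σ : ∀ y, E (p y)) (y : Y) : Prop :=
  ∀ ε > 0, ∃ b ∈ F.sections, ∀ᶠ y' in 𝓝 y, ‖σ y' - b (p y')‖ ≤ ε

/-- The (continuous) sections of the pullback field `p^*E`. -/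
def IsSection (p : Y → X) (σ : ∀ y, E (p y)) : Prop := ∀ y, F.IsSectionAt p σ y

/-- The sections of `p^*E` vanishing at infinity. -/
def IsC0Section (p : Y → X) (σ : ∀ y, E (p y)) : Prop :=
  F.IsSection p σ ∧ ∀ ε > 0, ∃ K : Set Y, IsCompact K ∧ ∀ y ∉ K, ‖σ y‖ ≤ ε

variable {F} {p : Y → X} {σ τ : ∀ y, E (p y)} {y : Y}

theorem isSectionAt_of_mem {b : ∀ x, E x} (hb : b ∈ F.sections) (p : Y → X) (y : Y) :
    F.IsSectionAt p (fun y => b (p y)) y :=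
  fun ε hε => ⟨b, hb, Eventually.of_forall fun y' => by simpa using hε.le⟩

theorem IsSectionAt.approx
    (h : ∀ ε > 0, ∃ τ, F.IsSectionAt p τ y ∧ ∀ᶠ y' in 𝓝 y, ‖σ y' - τ y'‖ ≤ ε) :
    F.IsSectionAt p σ y := by
  intro ε hε
  obtain ⟨τ, hτ, h1⟩ := h (ε / 2) (by positivity)
  obtain ⟨b, hb, h2⟩ := hτ (ε / 2) (by positivity)
  refine ⟨b, hb, ?_⟩
  filter_upwards [h1, h2] with y' h1 h2
  calc ‖σ y' - b (p y')‖ = ‖(σ y' - τ y') + (τ y' - b (p y'))‖ := by congr 1; abel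
    _ ≤ ε / 2 + ε / 2 := (norm_add_le _ _).trans (add_le_add h1 h2)
    _ = ε := by ring

theorem IsSectionAt.zero : F.IsSectionAt p (fun _ => 0) y :=
  isSectionAt_of_mem (b := 0) F.sections.zero_mem p y

theorem IsSectionAt.add (h : F.IsSectionAt p σ y) (h' : F.IsSectionAt p τ y) :
    F.IsSectionAt p (fun y => σ y + τ y) y := by
  intro ε hε
  obtain ⟨b, hb, h1⟩ := h (ε / 2) (by positivity)
  obtain ⟨c, hc, h2⟩ := h' (ε / 2) (by positivity)
  refine ⟨b + c, F.sections.add_mem hb hc, ?_⟩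
  filter_upwards [h1, h2] with y' h1 h2
  calc ‖σ y' + τ y' - (b (p y') + c (p y'))‖
      = ‖(σ y' - b (p y')) + (τ y' - c (p y'))‖ := by congr 1; abel
    _ ≤ ε / 2 + ε / 2 := (norm_add_le _ _).trans (add_le_add h1 h2)
    _ = ε := by ring

theorem IsSectionAt.lt (hp : ContinuousAt p y) (h : F.IsSectionAt p σ y) {c : ℝ}
    (hc : ‖σ y‖ < c) : ∀ᶠ y' in 𝓝 y, ‖σ y'‖ < c := by
  obtain ⟨b, hb, h1⟩ := h ((c - ‖σ y‖) / 3) (by linarith)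
  have h2 : ‖b (p y)‖ < c - (c - ‖σ y‖) / 3 := by
    have := h1.self_of_nhds
    have h3 : ‖b (p y)‖ ≤ ‖σ y‖ + ‖σ y - b (p y)‖ := by
      calc ‖b (p y)‖ = ‖σ y - (σ y - b (p y))‖ := by congr 1; abel
        _ ≤ _ := norm_sub_le _ _
    linarith
  have h3 := hp.eventually (F.usc b hb (p y) _ h2)
  filter_upwards [h1, h3] with y' h1 h3
  have : ‖σ y'‖ ≤ ‖σ y' - b (p y')‖ + ‖b (p y')‖ := by
    calc ‖σ y'‖ = ‖(σ y' - b (p y')) + b (p y')‖ := by congr 1; abel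
      _ ≤ _ := norm_add_le _ _
  linarith

theorem IsSectionAt.smul (hp : ContinuousAt p y) {g : Y → ℂ} (hg : ContinuousAt g y)
    (h : F.IsSectionAt p σ y) : F.IsSectionAt p (fun y => g y • σ y) y := by
  refine IsSectionAt.approx fun ε hε => ?_
  refine ⟨fun y' => g y • σ y', ?_, ?_⟩
  · intro δ hδ
    obtain ⟨b, hb, h1⟩ := h (δ / (‖g y‖ + 1)) (by positivity)
    refine ⟨g y • b, F.sections.smul_mem _ hb, ?_⟩
    filter_upwards [h1] with y' h1
    rw [Pi.smul_apply, ← smul_sub, norm_smul]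
    rw [le_div_iff₀ (by positivity)] at h1
    nlinarith [norm_nonneg (σ y' - b (p y')), norm_nonneg (g y)]
  · have h1 := h.lt hp (lt_add_one ‖σ y‖)
    have h2 : ∀ᶠ y' in 𝓝 y, ‖g y' - g y‖ < ε / (‖σ y‖ + 1) := by
      have := Metric.tendsto_nhds.1 hg (ε / (‖σ y‖ + 1)) (by positivity)
      simpa [dist_eq_norm] using this
    filter_upwards [h1, h2] with y' h1 h2
    rw [← sub_smul, norm_smul]
    rw [lt_div_iff₀ (by positivity)] at h2
    nlinarith [norm_nonneg (g y' - g y), norm_nonneg (σ y')]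

theorem IsSectionAt.sum {ι : Type*} (s : Finset ι) (τ : ι → ∀ y, E (p y))
    (h : ∀ i ∈ s, F.IsSectionAt p (τ i) y) : F.IsSectionAt p (fun y => ∑ i ∈ s, τ i y) y := by
  classical
  induction s using Finset.induction_on with
  | empty => simpa using IsSectionAt.zero
  | insert a s ha ih =>
    simp only [Finset.sum_insert ha]
    exact (h a (Finset.mem_insert_self _ _)).add
      (ih fun i hi => h i (Finset.mem_insert_of_mem hi))

theorem IsSectionAt.comp {Z : Type*} [TopologicalSpace Z] {g : Z → Y} {z : Z}
    (h : F.IsSectionAt p σ (g z)) (hg : ContinuousAt g z) :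
    F.IsSectionAt (fun z => p (g z)) (fun z => σ (g z)) z := by
  intro ε hε
  obtain ⟨b, hb, h1⟩ := h ε hε
  exact ⟨b, hb, hg.eventually h1⟩

/-- Sections of a field pulled back along a constant map are continuous functions. -/
theorem IsSection.continuous_transport {x : X} (hpx : ∀ y, p y = x) (h : F.IsSection p σ) :
    Continuous fun y => (transport (hpx y) (σ y) : E x) := by
  rw [continuous_iff_continuousAt]
  intro y
  rw [ContinuousAt, Metric.tendsto_nhds]
  intro ε hε
  obtain ⟨b, hb, h1⟩ := h y (ε / 3) (by positivity)
  have h2 := h1.self_of_nhds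
  filter_upwards [h1] with y' h1
  have e1 : ‖(transport (hpx y') (σ y') : E x) - b x‖ ≤ ε / 3 := by
    rw [← transport_section b (hpx y'), ← transport_sub, norm_transport]; exact h1
  have e2 : ‖(transport (hpx y) (σ y) : E x) - b x‖ ≤ ε / 3 := by
    rw [← transport_section b (hpx y), ← transport_sub, norm_transport]; exact h2
  rw [dist_eq_norm]
  calc ‖(transport (hpx y') (σ y') : E x) - transport (hpx y) (σ y)‖
      = ‖((transport (hpx y') (σ y') : E x) - b x) - (transport (hpx y) (σ y) - b x)‖ := by
        congr 1; abel
    _ ≤ ε / 3 + ε / 3 := (norm_sub_le _ _).trans (add_le_add e1 e2)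
    _ < ε := by linarith

theorem IsSection.exists_bound (hp : Continuous p) (h : F.IsSection p σ) {K : Set Y}
    (hK : IsCompact K) : ∃ M : ℝ, 0 ≤ M ∧ ∀ y ∈ K, ‖σ y‖ ≤ M := by
  refine hK.induction_on (p := fun s => ∃ M : ℝ, 0 ≤ M ∧ ∀ y ∈ s, ‖σ y‖ ≤ M) ?_ ?_ ?_ ?_
  · exact ⟨0, le_rfl, by simp⟩
  · rintro s t hst ⟨M, hM, h⟩
    exact ⟨M, hM, fun y hy => h y (hst hy)⟩
  · rintro s t ⟨M, hM, h⟩ ⟨N, -, h'⟩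
    refine ⟨max M N, le_max_of_le_left hM, ?_⟩
    rintro y (hy | hy)
    · exact (h y hy).trans (le_max_left _ _)
    · exact (h' y hy).trans (le_max_right _ _)
  · intro y _
    exact ⟨_, mem_nhdsWithin_of_mem_nhds ((h y).lt hp.continuousAt (lt_add_one _)),
      ‖σ y‖ + 1, by positivity, fun y' hy' => le_of_lt hy'⟩

/-- The constant field with fibre `ℂ`. -/
def trivialField (X : Type*) [TopologicalSpace X] : BanachField (fun _ : X => ℂ) where
  sections :=
    { carrier := {f | Continuous f}
      add_mem' := fun hf hg => Continuous.add hf hg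
      zero_mem' := continuous_const
      smul_mem' := fun c _ hf => Continuous.const_smul hf c }
  dense x := by
    have : (fun ξ : X → ℂ => ξ x) '' {f | Continuous f} = univ :=
      eq_univ_of_forall fun z => ⟨fun _ => z, continuous_const, rfl⟩
    change Dense ((fun ξ : X → ℂ => ξ x) '' {f | Continuous f})
    rw [this]
    exact dense_univ
  usc ξ hξ := (Continuous.norm hξ).upperSemicontinuous
  locallyClosed ξ h := by
    change Continuous ξ
    rw [continuous_iff_continuousAt]
    intro x
    rw [ContinuousAt, Metric.tendsto_nhds]
    intro ε hε
    obtain ⟨η, hη, h1⟩ := h x (ε / 4) (by positivity)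
    have h2 := h1.self_of_nhds
    have h3 := Metric.tendsto_nhds.1 (Continuous.continuousAt (x := x) hη) (ε / 4) (by positivity)
    filter_upwards [h1, h3] with y h1 h3
    rw [dist_eq_norm] at h3 ⊢
    calc ‖ξ y - ξ x‖ = ‖(ξ y - η y) + (η y - η x) - (ξ x - η x)‖ := by congr 1; ring
      _ ≤ ‖ξ y - η y‖ + ‖η y - η x‖ + ‖ξ x - η x‖ :=
        (norm_sub_le _ _).trans (add_le_add (norm_add_le _ _) le_rfl)
      _ < ε := by linarith

theorem trivialField_isSection {f : Y → ℂ} (p : Y → X) (hf : Continuous f) :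
    (trivialField X).IsSection p f := by
  intro y ε hε
  refine ⟨fun _ => f y, continuous_const, ?_⟩
  have := Metric.tendsto_nhds.1 (hf.continuousAt (x := y)) ε hε
  filter_upwards [this] with y' h
  rw [dist_eq_norm] at h
  exact h.le

theorem continuous_of_trivialField_isSection {f : Y → ℂ} {p : Y → X}
    (hf : (trivialField X).IsSection p f) (hp : Continuous p) : Continuous f := by
  rw [continuous_iff_continuousAt]
  intro y
  rw [ContinuousAt, Metric.tendsto_nhds]
  intro ε hε
  obtain ⟨η, hη, h1⟩ := hf y (ε / 4) (by positivity)
  have h2 := h1.self_of_nhds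
  have h3 := Metric.tendsto_nhds.1
    ((Continuous.comp hη hp).continuousAt (x := y)) (ε / 4) (by positivity)
  filter_upwards [h1, h3] with y' h1 h3
  rw [dist_eq_norm] at h3 ⊢
  simp only [Function.comp] at h3
  calc ‖f y' - f y‖ = ‖(f y' - η (p y')) + (η (p y') - η (p y)) - (f y - η (p y))‖ := by
        congr 1; ring
    _ ≤ ‖f y' - η (p y')‖ + ‖η (p y') - η (p y)‖ + ‖f y - η (p y)‖ :=
      (norm_sub_le _ _).trans (add_le_add (norm_add_le _ _) le_rfl)
    _ < ε := by linarith

end BanachField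

/-! ### Integration of sections along the fibres of the range map -/

namespace TopGroupoid

variable {X G : Type*} [TopologicalSpace X] [TopologicalSpace G] (𝒢 : TopGroupoid X G)

/-- Pairs of arrows with the same range. -/
abbrev Pairs : Type _ := {q : G × G // 𝒢.r q.1 = 𝒢.r q.2}

variable {𝒢}

theorem isCompact_fibre [T2Space X] {K : Set G} (hK : IsCompact K) (x : X) :
    IsCompact ((Subtype.val : {γ : G // 𝒢.r γ = x} → G) ⁻¹' K) :=
  ((isClosed_singleton (x := x)).preimage 𝒢.continuous_r).isClosedEmbedding_subtypeVal.isCompact_preimage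
    hK

theorem isCompact_pairs [T2Space X] {K L : Set G} (hK : IsCompact K) (hL : IsCompact L) :
    IsCompact {q : 𝒢.Pairs | q.1.1 ∈ K ∧ q.1.2 ∈ L} := by
  have h : IsClosed {q : G × G | 𝒢.r q.1 = 𝒢.r q.2} :=
    isClosed_eq (𝒢.continuous_r.comp continuous_fst) (𝒢.continuous_r.comp continuous_snd)
  exact h.isClosedEmbedding_subtypeVal.isCompact_preimage (hK.prod hL)

namespace HaarSystem

variable [MeasurableSpace G] [BorelSpace G] (μ : 𝒢.HaarSystem)

instance (x : X) : (μ.μ x).Regular := μ.regular x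

instance (x : X) : (μ.μ x).IsOpenPosMeasure := μ.fullSupport x

theorem integrable_fibre [T2Space X] [T2Space G] {V : Type*} [NormedAddCommGroup V] {x : X}
    {f : {γ : G // 𝒢.r γ = x} → V} (hf : Continuous f) {K : Set G} (hK : IsCompact K)
    (h : ∀ γ, γ.1 ∉ K → f γ = 0) : Integrable f (μ.μ x) :=
  hf.integrable_of_hasCompactSupport (HasCompactSupport.intro (isCompact_fibre hK x) h)

theorem continuous_integral_real {f : G → ℝ} (hf : Continuous f) (hc : HasCompactSupport f) :
    Continuous fun x => ∫ γ : {γ : G // 𝒢.r γ = x}, f γ ∂(μ.μ x) := by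
  have h := μ.continuous_integral ⟨⟨fun γ => (f γ : ℂ), by fun_prop⟩,
    hc.comp_left (g := fun t : ℝ => (t : ℂ)) Complex.ofReal_zero⟩
  have h' := Complex.continuous_re.comp h
  refine h'.congr fun x => ?_
  simp only [Function.comp]
  change (∫ γ : {γ : G // 𝒢.r γ = x}, ((f γ : ℝ) : ℂ) ∂(μ.μ x)).re = _
  rw [integral_complex_ofReal, Complex.ofReal_re]

/-- The integral of a compactly supported section over the fibres of the range map is again a
section. -/
theorem isSection_integral [T2Space X] [T2Space G] [LocallyCompactSpace G] {E : X → Type*}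
    [∀ x, NormedAddCommGroup (E x)] [∀ x, NormedSpace ℂ (E x)] [∀ x, CompleteSpace (E x)]
    {F : BanachField E} {Φ : ∀ q : 𝒢.Pairs, E (𝒢.r q.1.2)}
    (hΦ : F.IsSection (fun q : 𝒢.Pairs => 𝒢.r q.1.2) Φ) {K L : Set G} (hK : IsCompact K)
    (hL : IsCompact L) (h0 : ∀ q : 𝒢.Pairs, ¬(q.1.1 ∈ K ∧ q.1.2 ∈ L) → Φ q = 0) :
    F.IsSection 𝒢.r fun γ =>
      ∫ γ' : {γ' : G // 𝒢.r γ' = 𝒢.r γ}, Φ ⟨(γ'.1, γ), γ'.2⟩ ∂(μ.μ (𝒢.r γ)) := by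
  have hpc : Continuous fun q : 𝒢.Pairs => 𝒢.r q.1.2 :=
    𝒢.continuous_r.comp (continuous_snd.comp continuous_subtype_val)
  intro γ₀
  refine BanachField.IsSectionAt.approx fun ε hε => ?_
  obtain ⟨M, hM0, hM⟩ := hΦ.exists_bound hpc (isCompact_pairs hK hL)
  have hM' : ∀ q, ‖Φ q‖ ≤ M := fun q => by
    by_cases h : q.1.1 ∈ K ∧ q.1.2 ∈ L
    · exact hM q h
    · rw [h0 q h, norm_zero]; exact hM0
  obtain ⟨N, hN, hKN⟩ := exists_compact_superset hK
  obtain ⟨h, h1, -, hcs, h01⟩ := exists_continuous_one_zero_of_isCompact hN isClosed_empty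
    (disjoint_empty _)
  have hIcont := μ.continuous_integral_real h.continuous hcs
  set I : X → ℝ := fun x => ∫ γ : {γ : G // 𝒢.r γ = x}, h γ ∂(μ.μ x) with hI
  have hI0 : ∀ x, 0 ≤ I x := fun x => integral_nonneg fun γ => (h01 γ).1
  set δ : ℝ := ε / (2 * (I (𝒢.r γ₀) + 1)) with hδdef
  have hδ : 0 < δ := div_pos hε (by have := hI0 (𝒢.r γ₀); positivity)
  -- local approximations
  let K₀ : Set G := K ∩ 𝒢.r ⁻¹' {𝒢.r γ₀}
  have hK₀ : IsCompact K₀ := hK.inter_right (isClosed_singleton.preimage 𝒢.continuous_r)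
  have hloc : ∀ γ' : K₀, ∃ b ∈ F.sections, ∃ U : Set G, IsOpen U ∧ γ'.1 ∈ U ∧ U ⊆ interior N ∧
      ∃ V : Set G, V ∈ 𝓝 γ₀ ∧ ∀ q : 𝒢.Pairs, q.1.1 ∈ U → q.1.2 ∈ V →
        ‖Φ q - b (𝒢.r q.1.2)‖ ≤ δ := by
    intro γ'
    have hp : 𝒢.r γ'.1 = 𝒢.r γ₀ := γ'.2.2
    obtain ⟨b, hb, hev⟩ := hΦ ⟨(γ'.1, γ₀), hp⟩ δ hδ
    rw [nhds_subtype_eq_comap, eventually_comap] at hev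
    obtain ⟨U, hU, V, hV, hUV⟩ := mem_nhds_prod_iff.1 hev
    refine ⟨b, hb, interior U ∩ interior N, isOpen_interior.inter isOpen_interior,
      ⟨mem_interior_iff_mem_nhds.2 hU, hKN γ'.2.1⟩, inter_subset_right, V, hV, ?_⟩
    intro q hqU hqV
    exact hUV (show q.1 ∈ U ×ˢ V from ⟨interior_subset hqU.1, hqV⟩) q rfl
  choose b hb U hUo hUm hUN V hV hbd using hloc
  obtain ⟨t, ht⟩ := hK₀.elim_finite_subcover U hUo
    (fun γ' hγ' => mem_iUnion.2 ⟨⟨γ', hγ'⟩, hUm _⟩)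
  obtain ⟨f, hfs, hfc⟩ := PartitionOfUnity.exists_isSubordinate_of_locallyFinite_t2space hK₀
    (fun i : t => U i.1) (fun i => hUo i.1) (locallyFinite_of_finite _)
    (by intro γ hγ; obtain ⟨i, hi, hγi⟩ := mem_iUnion₂.1 (ht hγ)
        exact mem_iUnion.2 ⟨⟨i, hi⟩, hγi⟩)
  let S : G → ℝ := fun γ => ∑ i : t, f i γ
  have hSc : Continuous S := continuous_finsetSum _ fun i _ => (f i).continuous
  have hS1 : ∀ γ, S γ ≤ 1 := fun γ => by
    have := f.sum_le_one γ
    rwa [finsum_eq_sum_of_fintype] at this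
  have hS : ∀ γ ∈ K₀, S γ = 1 := fun γ hγ => by
    have := f.sum_eq_one hγ
    rwa [finsum_eq_sum_of_fintype] at this
  -- the bad set
  let Kb : Set G := K ∩ {γ | δ / (M + 1) ≤ 1 - S γ}
  have hKb : IsCompact Kb :=
    hK.inter_right (isClosed_le continuous_const (continuous_const.sub hSc))
  have hbad : ∀ᶠ γ in 𝓝 γ₀, 𝒢.r γ ∉ 𝒢.r '' Kb := by
    have hc : IsClosed (𝒢.r '' Kb) := (hKb.image 𝒢.continuous_r).isClosed
    refine 𝒢.continuous_r.continuousAt.eventually (hc.isOpen_compl.mem_nhds ?_)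
    rintro ⟨γ', hγ', he⟩
    have := hS γ' ⟨hγ'.1, he⟩
    have h2 : δ / (M + 1) ≤ 1 - S γ' := hγ'.2
    rw [this] at h2
    have : 0 < δ / (M + 1) := by positivity
    linarith
  have hIev : ∀ᶠ γ in 𝓝 γ₀, I (𝒢.r γ) < I (𝒢.r γ₀) + 1 :=
    (hIcont.comp 𝒢.continuous_r).continuousAt.eventually (gt_mem_nhds (lt_add_one _))
  have hVev : ∀ᶠ γ in 𝓝 γ₀, ∀ i : t, γ ∈ V i.1 := by
    rw [eventually_all]
    exact fun i => hV i.1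
  have hfi : ∀ i : t, Continuous fun x => ∫ γ : {γ : G // 𝒢.r γ = x}, f i γ ∂(μ.μ x) :=
    fun i => μ.continuous_integral_real (f i).continuous (hfc i)
  refine ⟨fun γ => ∑ i : t,
    (((∫ γ' : {γ' : G // 𝒢.r γ' = 𝒢.r γ}, f i γ' ∂(μ.μ (𝒢.r γ)) : ℝ) : ℂ)) • b i.1 (𝒢.r γ),
    ?_, ?_⟩
  · refine BanachField.IsSectionAt.sum _ _ fun i _ => ?_
    refine BanachField.IsSectionAt.smul 𝒢.continuous_r.continuousAt ?_
      (BanachField.isSectionAt_of_mem (hb i.1) _ _)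
    exact (Complex.continuous_ofReal.comp ((hfi i).comp 𝒢.continuous_r)).continuousAt
  · filter_upwards [hbad, hIev, hVev] with γ hbad hIev hVev
    -- pointwise estimate
    have hpt : ∀ γ' : {γ' : G // 𝒢.r γ' = 𝒢.r γ},
        ‖Φ ⟨(γ'.1, γ), γ'.2⟩ - ∑ i : t, f i γ' • b i.1 (𝒢.r γ)‖ ≤ 2 * δ * h γ' := by
      intro γ'
      by_cases hN' : γ'.1 ∈ N
      · rw [h1 hN', Pi.one_apply, mul_one]
        have e : Φ ⟨(γ'.1, γ), γ'.2⟩ - ∑ i : t, f i γ' • b i.1 (𝒢.r γ)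
            = (1 - S γ') • Φ ⟨(γ'.1, γ), γ'.2⟩
              + ∑ i : t, f i γ' • (Φ ⟨(γ'.1, γ), γ'.2⟩ - b i.1 (𝒢.r γ)) := by
          simp only [smul_sub, Finset.sum_sub_distrib, ← Finset.sum_smul, sub_smul, one_smul, S]
          abel
        rw [e]
        have e1 : ‖(1 - S γ') • Φ ⟨(γ'.1, γ), γ'.2⟩‖ ≤ δ := by
          rw [norm_smul, Real.norm_of_nonneg (by linarith [hS1 γ'])]
          by_cases hK' : γ'.1 ∈ K
          · have h3 : 1 - S γ' < δ / (M + 1) := by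
              by_contra hcon
              exact hbad ⟨γ'.1, ⟨hK', not_lt.1 hcon⟩, γ'.2⟩
            rw [lt_div_iff₀ (by positivity)] at h3
            have := hM' ⟨(γ'.1, γ), γ'.2⟩
            nlinarith [hS1 γ']
          · rw [h0 _ (fun hc => hK' hc.1), norm_zero, mul_zero]
            exact hδ.le
        have e2 : ‖∑ i : t, f i γ' • (Φ ⟨(γ'.1, γ), γ'.2⟩ - b i.1 (𝒢.r γ))‖ ≤ δ := by
          calc _ ≤ ∑ i : t, ‖f i γ' • (Φ ⟨(γ'.1, γ), γ'.2⟩ - b i.1 (𝒢.r γ))‖ :=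
                norm_sum_le _ _
            _ ≤ ∑ i : t, f i γ' * δ := by
                refine Finset.sum_le_sum fun i _ => ?_
                rw [norm_smul, Real.norm_of_nonneg (f.nonneg i γ')]
                by_cases hz : f i γ' = 0
                · rw [hz, zero_mul, zero_mul]
                · refine mul_le_mul_of_nonneg_left ?_ (f.nonneg i γ')
                  exact hbd i.1 ⟨(γ'.1, γ), γ'.2⟩
                    (hfs i (subset_tsupport _ (Function.mem_support.2 hz))) (hVev i)
            _ = S γ' * δ := by rw [← Finset.sum_mul]
            _ ≤ δ := by nlinarith [hS1 γ']
        calc _ ≤ δ + δ := (norm_add_le _ _).trans (add_le_add e1 e2)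
          _ = 2 * δ := by ring
      · have z1 : Φ ⟨(γ'.1, γ), γ'.2⟩ = 0 :=
          h0 _ fun hc => hN' (interior_subset (hKN hc.1))
        have z2 : ∀ i : t, f i γ' = 0 := fun i => by
          by_contra hz
          exact hN' (interior_subset (hUN i.1
            (hfs i (subset_tsupport _ (Function.mem_support.2 hz)))))
        simp only [z1, z2, zero_smul, Finset.sum_const_zero, sub_zero, norm_zero]
        have := (h01 γ'.1).1
        positivity
    -- integrability
    have hint1 : Integrable (ε := E (𝒢.r γ))
        (fun γ' : {γ' : G // 𝒢.r γ' = 𝒢.r γ} => Φ ⟨(γ'.1, γ), γ'.2⟩)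
        (μ.μ (𝒢.r γ)) := by
      refine μ.integrable_fibre ?_ hK fun γ' hγ' => h0 _ fun hc => hγ' hc.1
      have hg : Continuous fun γ' : {γ' : G // 𝒢.r γ' = 𝒢.r γ} =>
          (⟨(γ'.1, γ), γ'.2⟩ : 𝒢.Pairs) :=
        Continuous.subtype_mk (continuous_subtype_val.prodMk continuous_const) _
      have hsec : F.IsSection (fun _ : {γ' : G // 𝒢.r γ' = 𝒢.r γ} => 𝒢.r γ)
          (fun γ' => Φ ⟨(γ'.1, γ), γ'.2⟩) :=
        fun γ' => (hΦ ⟨(γ'.1, γ), γ'.2⟩).comp hg.continuousAt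
      have := hsec.continuous_transport (fun _ => rfl)
      exact this
    have hint2 : ∀ i : t, Integrable (fun γ' : {γ' : G // 𝒢.r γ' = 𝒢.r γ} => f i γ')
        (μ.μ (𝒢.r γ)) := fun i =>
      μ.integrable_fibre ((f i).continuous.comp continuous_subtype_val) (hfc i)
        fun γ' hγ' => image_eq_zero_of_notMem_tsupport hγ'
    have hint3 : Integrable (fun γ' : {γ' : G // 𝒢.r γ' = 𝒢.r γ} => 2 * δ * h γ')
        (μ.μ (𝒢.r γ)) :=
      (μ.integrable_fibre (h.continuous.comp continuous_subtype_val) hcs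
        fun γ' hγ' => image_eq_zero_of_notMem_tsupport (f := ⇑h) hγ').const_mul _
    have e3 : ∑ i : t,
        (((∫ γ' : {γ' : G // 𝒢.r γ' = 𝒢.r γ}, f i γ' ∂(μ.μ (𝒢.r γ)) : ℝ) : ℂ)) • b i.1 (𝒢.r γ)
        = ∫ γ' : {γ' : G // 𝒢.r γ' = 𝒢.r γ}, ∑ i : t, f i γ' • b i.1 (𝒢.r γ)
          ∂(μ.μ (𝒢.r γ)) := by
      rw [integral_finsetSum _ fun i _ => (hint2 i).smul_const _]
      refine Finset.sum_congr rfl fun i _ => ?_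
      rw [integral_smul_const, Complex.coe_smul]
    rw [e3, ← integral_sub hint1 (integrable_finsetSum _ fun i _ => (hint2 i).smul_const _)]
    calc _ ≤ ∫ γ' : {γ' : G // 𝒢.r γ' = 𝒢.r γ}, 2 * δ * h γ' ∂(μ.μ (𝒢.r γ)) :=
          norm_integral_le_of_norm_le hint3 (Eventually.of_forall hpt)
      _ = 2 * δ * I (𝒢.r γ) := integral_const_mul _ _
      _ ≤ 2 * δ * (I (𝒢.r γ₀) + 1) := by gcongr
      _ = ε := by
          rw [hδdef]
          have := hI0 (𝒢.r γ₀)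
          field_simp

end HaarSystem

end TopGroupoid

/-! ### Banach algebras over a groupoid and convolution -/

/-- A `G`-Banach algebra with fibres `B x`: an upper semi-continuous field of Banach algebras over
the unit space together with a continuous action of `G` by isometric isomorphisms
`act γ : B (s γ) → B (r γ)`. -/
structure GBanachAlgebra {X G : Type*} [TopologicalSpace X] [TopologicalSpace G]
    (𝒢 : TopGroupoid X G) (B : X → Type*) [∀ x, NonUnitalNormedRing (B x)]
    [∀ x, NormedSpace ℂ (B x)] extends BanachField B where
  mul_mem : ∀ ξ ∈ sections, ∀ η ∈ sections, (fun x => ξ x * η x) ∈ sections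
  act : ∀ (γ : G) {x y : X}, 𝒢.s γ = x → 𝒢.r γ = y → B x →ₗᵢ[ℂ] B y
  act_mul : ∀ (γ : G) {x y : X} (hs : 𝒢.s γ = x) (hr : 𝒢.r γ = y) (a b : B x),
    act γ hs hr (a * b) = act γ hs hr a * act γ hs hr b
  act_unit : ∀ (x : X) (hs : 𝒢.s (𝒢.unit x) = x) (hr : 𝒢.r (𝒢.unit x) = x) (b : B x),
    act (𝒢.unit x) hs hr b = b
  act_comp : ∀ (γ η : G) {x y z : X} (hs : 𝒢.s η = x) (hr : 𝒢.r η = y) (hs' : 𝒢.s γ = y)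
    (hr' : 𝒢.r γ = z) (hs'' : 𝒢.s (𝒢.mul γ η) = x) (hr'' : 𝒢.r (𝒢.mul γ η) = z) (b : B x),
    act (𝒢.mul γ η) hs'' hr'' b = act γ hs' hr' (act η hs hr b)
  continuous_act : ∀ ξ ∈ sections,
    toBanachField.IsSection 𝒢.r fun γ => act γ rfl rfl (ξ (𝒢.s γ))

theorem BanachField.IsSection.continuous_const {X : Type*} [TopologicalSpace X] {E : X → Type*}
    [∀ x, NormedAddCommGroup (E x)] [∀ x, NormedSpace ℂ (E x)] {F : BanachField E}
    {Y : Type*} [TopologicalSpace Y] {x : X} {f : Y → E x}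
    (h : F.IsSection (fun _ : Y => x) f) : Continuous f :=
  h.continuous_transport fun _ => rfl

theorem BanachField.IsSectionAt.transport {X : Type*} [TopologicalSpace X] {E : X → Type*}
    [∀ x, NormedAddCommGroup (E x)] [∀ x, NormedSpace ℂ (E x)] {F : BanachField E}
    {Y : Type*} [TopologicalSpace Y] {p q : Y → X} (hpq : ∀ y, p y = q y) {σ : ∀ y, E (p y)}
    {y : Y} (h : F.IsSectionAt p σ y) :
    F.IsSectionAt q (fun y => ProperBanach.transport (hpq y) (σ y)) y := by
  obtain rfl : p = q := funext hpq
  exact h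

namespace GBanachAlgebra

section Basic

variable {X G : Type*} [TopologicalSpace X] [TopologicalSpace G] {𝒢 : TopGroupoid X G}
  {B : X → Type*} [∀ x, NonUnitalNormedRing (B x)] [∀ x, NormedSpace ℂ (B x)]
  (𝓑 : GBanachAlgebra 𝒢 B) {Y : Type*} [TopologicalSpace Y]

/-- `B` is non-degenerate if, in each fibre, the span of all products is dense. -/
def Nondegenerate (_𝓑 : GBanachAlgebra 𝒢 B) : Prop :=
  ∀ x, Dense (Submodule.span ℂ {c : B x | ∃ a b, c = a * b} : Set (B x))

variable {𝓑}

theorem isSectionAt_mul {p : Y → X} {y : Y} (hp : ContinuousAt p y) {σ τ : ∀ y, B (p y)}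
    (hσ : 𝓑.IsSectionAt p σ y) (hτ : 𝓑.IsSectionAt p τ y) :
    𝓑.IsSectionAt p (fun y => σ y * τ y) y := by
  intro ε hε
  have hσ1 := hσ.lt hp (lt_add_one ‖σ y‖)
  obtain ⟨c, hc, h1⟩ := hτ (ε / (2 * (‖σ y‖ + 1))) (by positivity)
  have hc1 := (BanachField.isSectionAt_of_mem hc p y).lt hp (lt_add_one ‖c (p y)‖)
  obtain ⟨b, hb, h2⟩ := hσ (ε / (2 * (‖c (p y)‖ + 1))) (by positivity)
  refine ⟨_, 𝓑.mul_mem b hb c hc, ?_⟩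
  filter_upwards [hσ1, h1, hc1, h2] with y' hσ1 h1 hc1 h2
  have e : σ y' * τ y' - b (p y') * c (p y')
      = σ y' * (τ y' - c (p y')) + (σ y' - b (p y')) * c (p y') := by
    rw [mul_sub, sub_mul]; abel
  rw [e]
  rw [le_div_iff₀ (by positivity)] at h1 h2
  have a1 := norm_mul_le (σ y') (τ y' - c (p y'))
  have a2 := norm_mul_le (σ y' - b (p y')) (c (p y'))
  have a3 := norm_add_le (σ y' * (τ y' - c (p y'))) ((σ y' - b (p y')) * c (p y'))
  have a4 : ‖σ y'‖ * ‖τ y' - c (p y')‖ ≤ (‖σ y‖ + 1) * ‖τ y' - c (p y')‖ := by gcongr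
  have a5 : ‖σ y' - b (p y')‖ * ‖c (p y')‖ ≤ ‖σ y' - b (p y')‖ * (‖c (p y)‖ + 1) := by gcongr
  linarith

theorem isSectionAt_act {p q : Y → X} {g : Y → G} {y : Y} (hg : ContinuousAt g y)
    (hs : ∀ y, 𝒢.s (g y) = p y) (hr : ∀ y, 𝒢.r (g y) = q y) {σ : ∀ y, B (p y)}
    (hσ : 𝓑.IsSectionAt p σ y) :
    𝓑.IsSectionAt q (fun y => 𝓑.act (g y) (hs y) (hr y) (σ y)) y := by
  obtain rfl : (fun y => 𝒢.s (g y)) = p := funext hs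
  obtain rfl : (fun y => 𝒢.r (g y)) = q := funext hr
  refine BanachField.IsSectionAt.approx fun ε hε => ?_
  obtain ⟨b, hb, h⟩ := hσ ε hε
  refine ⟨fun y => 𝓑.act (g y) rfl rfl (b (𝒢.s (g y))), ?_, ?_⟩
  · exact (𝓑.continuous_act b hb (g y)).comp (g := g) hg
  · filter_upwards [h] with y' h
    rw [← map_sub, LinearIsometry.norm_map]
    exact h

variable (𝓑)

/-- The value `γ' · τ(γ'⁻¹γ)` in the fibre over `y = r γ'`. -/
def translate (τ : ∀ γ, B (𝒢.r γ)) (γ' γ : G) (h : 𝒢.r γ' = 𝒢.r γ) {y : X}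
    (hy : 𝒢.r γ' = y) : B y :=
  𝓑.act γ' (𝒢.r_inv_mul h).symm hy (τ (𝒢.mul (𝒢.inv γ') γ))

/-- The integrand `σ(γ') · γ'τ(γ'⁻¹γ)` of the convolution. -/
def integrand (σ τ : ∀ γ, B (𝒢.r γ)) {y : X} (γ' γ : G) (hy' : 𝒢.r γ' = y)
    (hy : 𝒢.r γ = y) : B y :=
  transport hy' (σ γ') * 𝓑.translate τ γ' γ (hy'.trans hy.symm) hy'

variable {𝓑}

theorem continuous_div : Continuous fun q : 𝒢.Pairs => 𝒢.mul (𝒢.inv q.1.1) q.1.2 := by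
  refine 𝒢.continuousOn_mul.comp_continuous
    (f := fun q : 𝒢.Pairs => (𝒢.inv q.1.1, q.1.2)) ?_ ?_
  · exact (𝒢.continuous_inv.comp (continuous_fst.comp continuous_subtype_val)).prodMk
      (continuous_snd.comp continuous_subtype_val)
  · intro q
    change 𝒢.s (𝒢.inv q.1.1) = 𝒢.r q.1.2
    rw [𝒢.s_inv, q.2]

theorem isSection_translate {τ : ∀ γ, B (𝒢.r γ)} (hτ : 𝓑.IsSection 𝒢.r τ) :
    𝓑.IsSection (fun q : 𝒢.Pairs => 𝒢.r q.1.2)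
      fun q => 𝓑.translate τ q.1.1 q.1.2 q.2 q.2 := by
  intro q
  exact isSectionAt_act (p := fun q : 𝒢.Pairs => 𝒢.r (𝒢.mul (𝒢.inv q.1.1) q.1.2))
    (g := fun q : 𝒢.Pairs => q.1.1)
    (continuous_fst.comp continuous_subtype_val).continuousAt
    (fun q => (𝒢.r_inv_mul q.2).symm) (fun q => q.2)
    ((hτ _).comp (g := fun q : 𝒢.Pairs => 𝒢.mul (𝒢.inv q.1.1) q.1.2)
      continuous_div.continuousAt)

theorem isSection_integrand {σ τ : ∀ γ, B (𝒢.r γ)} (hσ : 𝓑.IsSection 𝒢.r σ)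
    (hτ : 𝓑.IsSection 𝒢.r τ) :
    𝓑.IsSection (fun q : 𝒢.Pairs => 𝒢.r q.1.2)
      fun q => 𝓑.integrand σ τ q.1.1 q.1.2 q.2 rfl := by
  intro q
  refine isSectionAt_mul
    (𝒢.continuous_r.comp (continuous_snd.comp continuous_subtype_val)).continuousAt ?_
    (isSection_translate hτ q)
  exact BanachField.IsSectionAt.transport (p := fun q : 𝒢.Pairs => 𝒢.r q.1.1) (fun q => q.2)
    ((hσ _).comp (g := fun q : 𝒢.Pairs => q.1.1)
      (continuous_fst.comp continuous_subtype_val).continuousAt)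

theorem translate_eq_zero {τ : ∀ γ, B (𝒢.r γ)} {γ' γ : G} {h : 𝒢.r γ' = 𝒢.r γ} {y : X}
    {hy : 𝒢.r γ' = y} (h0 : τ (𝒢.mul (𝒢.inv γ') γ) = 0) : 𝓑.translate τ γ' γ h hy = 0 := by
  rw [translate, h0, map_zero]

end Basic

end GBanachAlgebra

namespace TopGroupoid

variable {X G : Type*} [TopologicalSpace X] [TopologicalSpace G] (𝒢 : TopGroupoid X G)

/-- The set of all products of composable elements of `K` and `L`. -/
def mulSet (K L : Set G) : Set G :=
  (fun p : G × G => 𝒢.mul p.1 p.2) '' (K ×ˢ L ∩ {p | 𝒢.s p.1 = 𝒢.r p.2})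

variable {𝒢}

theorem isCompact_mulSet [T2Space X] {K L : Set G} (hK : IsCompact K) (hL : IsCompact L) :
    IsCompact (𝒢.mulSet K L) :=
  ((hK.prod hL).inter_right (isClosed_eq (𝒢.continuous_s.comp continuous_fst)
    (𝒢.continuous_r.comp continuous_snd))).image_of_continuousOn
    (𝒢.continuousOn_mul.mono inter_subset_right)

theorem mem_mulSet {K L : Set G} {γ' γ : G} (h : 𝒢.r γ' = 𝒢.r γ) (hK : γ' ∈ K)
    (hL : 𝒢.mul (𝒢.inv γ') γ ∈ L) : γ ∈ 𝒢.mulSet K L :=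
  ⟨(γ', 𝒢.mul (𝒢.inv γ') γ), ⟨⟨hK, hL⟩, (𝒢.r_inv_mul h).symm⟩, 𝒢.mul_inv_mul h⟩

end TopGroupoid

namespace GBanachAlgebra

section Convolution

variable {X G : Type*} [TopologicalSpace X] [TopologicalSpace G] {𝒢 : TopGroupoid X G}
  [MeasurableSpace G] (μ : 𝒢.HaarSystem)
  {B : X → Type*} [∀ x, NonUnitalNormedRing (B x)] [∀ x, NormedSpace ℂ (B x)]
  (𝓑 : GBanachAlgebra 𝒢 B)

/-- The convolution of sections of `r^*B`:
`(σ * τ)(γ) = ∫ σ(γ') · γ'τ(γ'⁻¹γ) dμ^{r(γ)}(γ')`. -/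
def conv (σ τ : ∀ γ, B (𝒢.r γ)) (γ : G) : B (𝒢.r γ) :=
  ∫ γ' : {γ' : G // 𝒢.r γ' = 𝒢.r γ}, 𝓑.integrand σ τ γ' γ γ'.2 rfl ∂(μ.μ (𝒢.r γ))

theorem transport_conv (σ τ : ∀ γ, B (𝒢.r γ)) (γ : G) {y : X} (h : 𝒢.r γ = y) :
    transport h (𝓑.conv μ σ τ γ) =
      ∫ γ' : {γ' : G // 𝒢.r γ' = y}, 𝓑.integrand σ τ γ' γ γ'.2 h ∂(μ.μ y) := by
  subst h
  rfl

variable [BorelSpace G] [T2Space X] [T2Space G]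
  {μ 𝓑}

theorem isSection_slice {Φ : ∀ q : 𝒢.Pairs, B (𝒢.r q.1.2)}
    (hΦ : 𝓑.IsSection (fun q : 𝒢.Pairs => 𝒢.r q.1.2) Φ) (γ : G) :
    Continuous (Y := B (𝒢.r γ))
      (fun γ' : {γ' : G // 𝒢.r γ' = 𝒢.r γ} => Φ ⟨(γ'.1, γ), γ'.2⟩) := by
  have hg : Continuous fun γ' : {γ' : G // 𝒢.r γ' = 𝒢.r γ} =>
      (⟨(γ'.1, γ), γ'.2⟩ : 𝒢.Pairs) :=
    Continuous.subtype_mk (continuous_subtype_val.prodMk continuous_const) _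
  have hsec : 𝓑.IsSection (fun _ : {γ' : G // 𝒢.r γ' = 𝒢.r γ} => 𝒢.r γ)
      (fun γ' => Φ ⟨(γ'.1, γ), γ'.2⟩) :=
    fun γ' => (hΦ ⟨(γ'.1, γ), γ'.2⟩).comp hg.continuousAt
  exact hsec.continuous_const

theorem integrable_integrand {σ τ : ∀ γ, B (𝒢.r γ)} (hσ : 𝓑.IsSection 𝒢.r σ)
    (hτ : 𝓑.IsSection 𝒢.r τ) {K : Set G} (hK : IsCompact K) (h0 : ∀ γ ∉ K, σ γ = 0) {y : X}
    (γ : G) (hy : 𝒢.r γ = y) :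
    Integrable (fun γ' : {γ' : G // 𝒢.r γ' = y} => 𝓑.integrand σ τ γ' γ γ'.2 hy) (μ.μ y) := by
  subst hy
  refine μ.integrable_fibre (isSection_slice (isSection_integrand hσ hτ) γ) hK fun γ' hγ' => ?_
  rw [integrand, h0 _ hγ', transport_zero, zero_mul]

theorem isSection_conv [LocallyCompactSpace G] [∀ x, CompleteSpace (B x)]
    {σ τ : ∀ γ, B (𝒢.r γ)} (hσ : 𝓑.IsSection 𝒢.r σ)
    (hτ : 𝓑.IsSection 𝒢.r τ) {K L : Set G} (hK : IsCompact K) (hL : IsCompact L)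
    (hσ0 : ∀ γ ∉ K, σ γ = 0) (hτ0 : ∀ γ ∉ L, τ γ = 0) :
    𝓑.IsSection 𝒢.r (𝓑.conv μ σ τ) := by
  refine μ.isSection_integral (isSection_integrand hσ hτ) hK
    (TopGroupoid.isCompact_mulSet (𝒢 := 𝒢) hK hL) ?_
  intro q hq
  by_cases h : q.1.1 ∈ K
  · by_cases h' : 𝒢.mul (𝒢.inv q.1.1) q.1.2 ∈ L
    · exact absurd ⟨h, TopGroupoid.mem_mulSet q.2 h h'⟩ hq
    · rw [integrand, translate_eq_zero (hτ0 _ h'), mul_zero]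
  · rw [integrand, hσ0 _ h, transport_zero, zero_mul]

theorem conv_eq_zero {σ τ : ∀ γ, B (𝒢.r γ)} {K L : Set G}
    (hσ0 : ∀ γ ∉ K, σ γ = 0) (hτ0 : ∀ γ ∉ L, τ γ = 0) (γ : G) (hγ : γ ∉ 𝒢.mulSet K L) :
    𝓑.conv μ σ τ γ = 0 := by
  rw [conv]
  refine integral_eq_zero_of_ae (Eventually.of_forall fun γ' => ?_)
  change 𝓑.integrand σ τ γ'.1 γ γ'.2 rfl = 0
  by_cases h : γ'.1 ∈ K
  · by_cases h' : 𝒢.mul (𝒢.inv γ'.1) γ ∈ L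
    · exact absurd (TopGroupoid.mem_mulSet γ'.2 h h') hγ
    · rw [integrand, translate_eq_zero (hτ0 _ h'), mul_zero]
  · rw [integrand, hσ0 _ h, transport_zero, zero_mul]


section Bilinear

variable [∀ x, IsScalarTower ℂ (B x) (B x)] [∀ x, SMulCommClass ℂ (B x) (B x)]
  {σ σ' τ τ' : ∀ γ, B (𝒢.r γ)}

theorem conv_add_left (hσ : 𝓑.IsSection 𝒢.r σ) (hσ' : 𝓑.IsSection 𝒢.r σ')
    (hτ : 𝓑.IsSection 𝒢.r τ) {K K' : Set G} (hK : IsCompact K) (hK' : IsCompact K')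
    (h0 : ∀ γ ∉ K, σ γ = 0) (h0' : ∀ γ ∉ K', σ' γ = 0) :
    𝓑.conv μ (σ + σ') τ = 𝓑.conv μ σ τ + 𝓑.conv μ σ' τ := by
  funext γ
  rw [Pi.add_apply, conv, conv, conv, ← integral_add (integrable_integrand hσ hτ hK h0 γ rfl)
    (integrable_integrand hσ' hτ hK' h0' γ rfl)]
  refine integral_congr_ae (Eventually.of_forall fun γ' => ?_)
  change 𝓑.integrand (σ + σ') τ γ'.1 γ γ'.2 rfl = 𝓑.integrand σ τ γ'.1 γ γ'.2 rfl +
    𝓑.integrand σ' τ γ'.1 γ γ'.2 rfl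
  rw [integrand, Pi.add_apply, transport_add, add_mul, integrand, integrand]

theorem conv_add_right (hσ : 𝓑.IsSection 𝒢.r σ) (hτ : 𝓑.IsSection 𝒢.r τ)
    (hτ' : 𝓑.IsSection 𝒢.r τ') {K : Set G} (hK : IsCompact K) (h0 : ∀ γ ∉ K, σ γ = 0) :
    𝓑.conv μ σ (τ + τ') = 𝓑.conv μ σ τ + 𝓑.conv μ σ τ' := by
  funext γ
  rw [Pi.add_apply, conv, conv, conv, ← integral_add (integrable_integrand hσ hτ hK h0 γ rfl)
    (integrable_integrand hσ hτ' hK h0 γ rfl)]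
  refine integral_congr_ae (Eventually.of_forall fun γ' => ?_)
  change 𝓑.integrand σ (τ + τ') γ'.1 γ γ'.2 rfl = 𝓑.integrand σ τ γ'.1 γ γ'.2 rfl +
    𝓑.integrand σ τ' γ'.1 γ γ'.2 rfl
  simp only [integrand, translate, Pi.add_apply, map_add, mul_add]

theorem conv_smul_left (c : ℂ) : 𝓑.conv μ (c • σ) τ = c • 𝓑.conv μ σ τ := by
  funext γ
  rw [Pi.smul_apply, conv, conv, ← integral_smul]
  refine integral_congr_ae (Eventually.of_forall fun γ' => ?_)
  change 𝓑.integrand (c • σ) τ γ'.1 γ γ'.2 rfl = c • 𝓑.integrand σ τ γ'.1 γ γ'.2 rfl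
  rw [integrand, Pi.smul_apply, transport_smul, smul_mul_assoc, integrand]

theorem conv_smul_right (c : ℂ) : 𝓑.conv μ σ (c • τ) = c • 𝓑.conv μ σ τ := by
  funext γ
  rw [Pi.smul_apply, conv, conv, ← integral_smul]
  refine integral_congr_ae (Eventually.of_forall fun γ' => ?_)
  change 𝓑.integrand σ (c • τ) γ'.1 γ γ'.2 rfl = c • 𝓑.integrand σ τ γ'.1 γ γ'.2 rfl
  simp only [integrand, translate, Pi.smul_apply, map_smul, mul_smul_comm]

end Bilinear

section Assoc

/-- Left translation as a homeomorphism. -/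
def leftHomeo (𝒢 : TopGroupoid X G) (γ : G) :
    {η : G // 𝒢.r η = 𝒢.s γ} ≃ₜ {η : G // 𝒢.r η = 𝒢.r γ} where
  toFun := 𝒢.leftMul γ
  invFun := 𝒢.leftDiv γ
  left_inv η := Subtype.ext (𝒢.inv_mul_mul η.2.symm)
  right_inv η := Subtype.ext (𝒢.mul_inv_mul η.2.symm)
  continuous_toFun := by
    refine Continuous.subtype_mk ?_ _
    refine 𝒢.continuousOn_mul.comp_continuous
      (f := fun η : {η : G // 𝒢.r η = 𝒢.s γ} => (γ, η.1)) ?_ fun η => η.2.symm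
    exact continuous_const.prodMk continuous_subtype_val
  continuous_invFun := by
    refine Continuous.subtype_mk ?_ _
    refine 𝒢.continuousOn_mul.comp_continuous
      (f := fun η : {η : G // 𝒢.r η = 𝒢.r γ} => (𝒢.inv γ, η.1)) ?_ fun η => ?_
    · exact continuous_const.prodMk continuous_subtype_val
    · change 𝒢.s (𝒢.inv γ) = 𝒢.r η.1
      rw [𝒢.s_inv, η.2]

theorem integral_leftMul {V : Type*} [NormedAddCommGroup V] [NormedSpace ℝ V] {γ : G} {x y : X}
    (hx : 𝒢.s γ = x) (hy : 𝒢.r γ = y) (f : {η : G // 𝒢.r η = y} → V) :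
    ∫ η, f η ∂(μ.μ y) = ∫ η : {η : G // 𝒢.r η = x},
      f ⟨𝒢.mul γ η, by rw [𝒢.r_mul _ _ (hx.trans η.2.symm), hy]⟩ ∂(μ.μ x) := by
  subst hx hy
  have h := (leftHomeo 𝒢 γ).measurableEmbedding.integral_map (μ := μ.μ (𝒢.s γ)) f
  have h' : (μ.μ (𝒢.s γ)).map (leftHomeo 𝒢 γ) = μ.μ (𝒢.r γ) := μ.leftInvariant γ
  rw [h'] at h
  exact h

theorem inv_mul_inv_mul {γ ζ θ : G} (h1 : 𝒢.s γ = 𝒢.r ζ) (h2 : 𝒢.r γ = 𝒢.r θ) :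
    𝒢.mul (𝒢.inv (𝒢.mul γ ζ)) θ = 𝒢.mul (𝒢.inv ζ) (𝒢.mul (𝒢.inv γ) θ) := by
  rw [𝒢.inv_mul_rev h1, 𝒢.mul_assoc _ _ _ (by rw [𝒢.s_inv, 𝒢.r_inv, h1])
    (by rw [𝒢.s_inv, h2])]

/-- The integrand is compatible with the action of `G`. -/
theorem act_integrand (τ υ : ∀ γ, B (𝒢.r γ)) {γ ζ θ : G} {x y : X} (hx : 𝒢.s γ = x)
    (hy : 𝒢.r γ = y) (hζ : 𝒢.r ζ = x) (hθ : 𝒢.r θ = y) (hd : 𝒢.r (𝒢.mul (𝒢.inv γ) θ) = x)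
    (hm : 𝒢.r (𝒢.mul γ ζ) = 𝒢.r θ) (hm' : 𝒢.r (𝒢.mul γ ζ) = y)
    (hm'' : 𝒢.r γ = 𝒢.r (𝒢.mul γ ζ)) :
    𝓑.act γ hx hy (𝓑.integrand τ υ ζ (𝒢.mul (𝒢.inv γ) θ) hζ hd) =
      𝓑.translate τ γ (𝒢.mul γ ζ) hm'' hy * 𝓑.translate υ (𝒢.mul γ ζ) θ hm hm' := by
  subst hx hy
  have h1 : 𝒢.s γ = 𝒢.r ζ := hζ.symm
  have h2 : 𝒢.r γ = 𝒢.r θ := hθ.symm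
  rw [integrand, 𝓑.act_mul]
  congr 1
  · have key : ∀ (ξ : G) (hξ : ξ = ζ) (hr : 𝒢.r ξ = 𝒢.s γ), transport hr (τ ξ) =
        transport hζ (τ ζ) := by
      rintro ξ rfl hr; rfl
    have k := key (𝒢.mul (𝒢.inv γ) (𝒢.mul γ ζ)) (𝒢.inv_mul_mul h1) (𝒢.r_inv_mul hm'')
    rw [← k, translate]
    have gen : ∀ (x : X) (hx' : x = 𝒢.s γ) (b : B x), 𝓑.act γ rfl rfl (transport hx' b) =
        𝓑.act γ hx'.symm rfl b := by
      rintro x rfl b; rfl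
    exact gen _ _ _
  · have gen : ∀ (ξ : G) (hξ : 𝒢.mul (𝒢.inv ζ) (𝒢.mul (𝒢.inv γ) θ) = ξ)
        (hs : 𝒢.s (𝒢.mul γ ζ) = 𝒢.r ξ)
        (hs' : 𝒢.r ζ = 𝒢.r (𝒢.mul (𝒢.inv γ) θ)),
        𝓑.act γ rfl rfl (𝓑.translate υ ζ (𝒢.mul (𝒢.inv γ) θ) hs' hζ) =
          𝓑.act (𝒢.mul γ ζ) hs hm' (υ ξ) := by
      rintro ξ rfl hs hs'
      rw [translate]
      exact (𝓑.act_comp γ ζ _ _ _ _ _ _ _).symm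
    exact gen _ (inv_mul_inv_mul h1 h2).symm _ _

theorem translate_conv [∀ x, CompleteSpace (B x)] (τ υ : ∀ γ, B (𝒢.r γ)) {η γ : G} {y : X}
    (hη : 𝒢.r η = y) (hγ : 𝒢.r γ = y) :
    𝓑.translate (𝓑.conv μ τ υ) η γ (hη.trans hγ.symm) hη =
      ∫ γ' : {γ' : G // 𝒢.r γ' = y}, 𝓑.translate τ η γ' (hη.trans γ'.2.symm) hη *
        𝓑.translate υ γ' γ (γ'.2.trans hγ.symm) γ'.2 ∂(μ.μ y) := by
  rw [integral_leftMul (μ := μ) (γ := η) rfl hη]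
  have hd : 𝒢.r (𝒢.mul (𝒢.inv η) γ) = 𝒢.s η := 𝒢.r_inv_mul (hη.trans hγ.symm)
  have gen : ∀ (x : X) (hx' : x = 𝒢.s η) (b : B x), 𝓑.act η rfl hη (transport hx' b) =
      𝓑.act η hx'.symm hη b := by
    rintro x rfl b; rfl
  rw [translate, ← gen _ hd, transport_conv, ← LinearIsometry.integral_comp_comm]
  refine integral_congr_ae (Eventually.of_forall fun ζ => ?_)
  exact act_integrand τ υ rfl hη ζ.2 hγ hd _ _ _

variable [∀ x, CompleteSpace (B x)] [∀ x, IsScalarTower ℂ (B x) (B x)]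
  [∀ x, SMulCommClass ℂ (B x) (B x)]

theorem continuous_pair {σ τ : ∀ γ, B (𝒢.r γ)} (hσ : 𝓑.IsSection 𝒢.r σ)
    (hτ : 𝓑.IsSection 𝒢.r τ) (y : X) :
    Continuous fun p : {γ : G // 𝒢.r γ = y} × {γ : G // 𝒢.r γ = y} =>
      𝓑.integrand σ τ p.1 p.2 p.1.2 p.2.2 := by
  have hg : Continuous fun p : {γ : G // 𝒢.r γ = y} × {γ : G // 𝒢.r γ = y} =>
      (⟨(p.1.1, p.2.1), p.1.2.trans p.2.2.symm⟩ : 𝒢.Pairs) :=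
    Continuous.subtype_mk ((continuous_subtype_val.comp continuous_fst).prodMk
      (continuous_subtype_val.comp continuous_snd)) _
  have h1 : 𝓑.IsSection (fun p : {γ : G // 𝒢.r γ = y} × {γ : G // 𝒢.r γ = y} => 𝒢.r p.2.1)
      (fun p => 𝓑.integrand σ τ p.1 p.2 (p.1.2.trans p.2.2.symm) rfl) :=
    fun p => (isSection_integrand hσ hτ _).comp hg.continuousAt
  refine (h1.continuous_transport fun p => p.2.2).congr ?_
  rintro ⟨⟨a, ha⟩, ⟨b, rfl⟩⟩
  rfl

theorem continuous_translate {τ : ∀ γ, B (𝒢.r γ)} (hτ : 𝓑.IsSection 𝒢.r τ) {y : X} {γ : G}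
    (hγ : 𝒢.r γ = y) : Continuous fun p : {γ : G // 𝒢.r γ = y} =>
      𝓑.translate τ p γ (p.2.trans hγ.symm) p.2 := by
  subst hγ
  exact isSection_slice (isSection_translate hτ) γ

theorem continuous_translate' {τ : ∀ γ, B (𝒢.r γ)} (hτ : 𝓑.IsSection 𝒢.r τ) {y : X} {η : G}
    (hη : 𝒢.r η = y) : Continuous fun p : {γ : G // 𝒢.r γ = y} =>
      𝓑.translate τ η p (hη.trans p.2.symm) hη := by
  have hg : Continuous fun p : {γ : G // 𝒢.r γ = y} =>
      (⟨(η, p.1), hη.trans p.2.symm⟩ : 𝒢.Pairs) :=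
    Continuous.subtype_mk (continuous_const.prodMk continuous_subtype_val) _
  have h1 : 𝓑.IsSection (fun p : {γ : G // 𝒢.r γ = y} => 𝒢.r p.1)
      (fun p => 𝓑.translate τ η p (hη.trans p.2.symm) (hη.trans p.2.symm)) :=
    fun p => (isSection_translate hτ _).comp hg.continuousAt
  refine (h1.continuous_transport fun p => p.2).congr ?_
  rintro ⟨b, rfl⟩
  rfl

theorem conv_assoc {σ τ υ : ∀ γ, B (𝒢.r γ)} (hσ : 𝓑.IsSection 𝒢.r σ)
    (hτ : 𝓑.IsSection 𝒢.r τ) (hυ : 𝓑.IsSection 𝒢.r υ) {K L : Set G} (hK : IsCompact K)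
    (hL : IsCompact L) (hσ0 : ∀ γ ∉ K, σ γ = 0) (hτ0 : ∀ γ ∉ L, τ γ = 0) :
    𝓑.conv μ (𝓑.conv μ σ τ) υ = 𝓑.conv μ σ (𝓑.conv μ τ υ) := by
  funext γ
  have e1 : 𝓑.conv μ (𝓑.conv μ σ τ) υ γ =
      ∫ γ' : {γ' : G // 𝒢.r γ' = 𝒢.r γ}, ∫ η : {η : G // 𝒢.r η = 𝒢.r γ},
        𝓑.integrand σ τ η γ' η.2 γ'.2 * 𝓑.translate υ γ' γ γ'.2 γ'.2
          ∂(μ.μ (𝒢.r γ)) ∂(μ.μ (𝒢.r γ)) := by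
    rw [conv]
    refine integral_congr_ae (Eventually.of_forall fun γ' => ?_)
    change 𝓑.integrand (𝓑.conv μ σ τ) υ γ' γ γ'.2 rfl = _
    rw [integrand, transport_conv]
    exact (((ContinuousLinearMap.mul ℂ (B (𝒢.r γ))).flip
      (𝓑.translate υ γ' γ γ'.2 γ'.2)).integral_comp_comm
      (integrable_integrand hσ hτ hK hσ0 γ'.1 γ'.2)).symm
  have e2 : 𝓑.conv μ σ (𝓑.conv μ τ υ) γ =
      ∫ η : {η : G // 𝒢.r η = 𝒢.r γ}, ∫ γ' : {γ' : G // 𝒢.r γ' = 𝒢.r γ},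
        𝓑.integrand σ τ η γ' η.2 γ'.2 * 𝓑.translate υ γ' γ γ'.2 γ'.2
          ∂(μ.μ (𝒢.r γ)) ∂(μ.μ (𝒢.r γ)) := by
    rw [conv]
    refine integral_congr_ae (Eventually.of_forall fun η => ?_)
    change 𝓑.integrand σ (𝓑.conv μ τ υ) η γ η.2 rfl = _
    rw [integrand, translate_conv τ υ η.2 rfl]
    have hint : Integrable (fun γ' : {γ' : G // 𝒢.r γ' = 𝒢.r γ} =>
        𝓑.translate τ η γ' (η.2.trans γ'.2.symm) η.2 * 𝓑.translate υ γ' γ γ'.2 γ'.2)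
        (μ.μ (𝒢.r γ)) := by
      refine μ.integrable_fibre ((continuous_translate' hτ η.2).mul (continuous_translate hυ rfl))
        (TopGroupoid.isCompact_mulSet (𝒢 := 𝒢) (isCompact_singleton (x := η.1)) hL) ?_
      intro γ' hγ'
      rw [translate_eq_zero, zero_mul]
      refine hτ0 _ fun hc => hγ' ?_
      exact TopGroupoid.mem_mulSet (η.2.trans γ'.2.symm) rfl hc
    refine ((ContinuousLinearMap.mul ℂ (B (𝒢.r γ))
      (transport η.2 (σ η))).integral_comp_comm hint).symm.trans ?_
    refine integral_congr_ae (Eventually.of_forall fun γ' => ?_)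
    exact (mul_assoc _ _ _).symm
  rw [e1, e2]
  refine integral_integral_swap_of_hasCompactSupport
    (f := fun (γ' η : {γ' : G // 𝒢.r γ' = 𝒢.r γ}) => 𝓑.integrand σ τ η γ' η.2 γ'.2 *
      𝓑.translate υ γ' γ γ'.2 γ'.2) ?_ ?_
  · exact ((continuous_pair hσ hτ (𝒢.r γ)).comp continuous_swap).mul
      ((continuous_translate hυ rfl).comp continuous_fst)
  · refine HasCompactSupport.intro ((TopGroupoid.isCompact_fibre
      (TopGroupoid.isCompact_mulSet (𝒢 := 𝒢) hK hL) (𝒢.r γ)).prod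
      (TopGroupoid.isCompact_fibre hK (𝒢.r γ))) ?_
    rintro ⟨γ', η⟩ hp
    change 𝓑.integrand σ τ η γ' η.2 γ'.2 * 𝓑.translate υ γ' γ γ'.2 γ'.2 = 0
    rw [integrand]
    by_cases h : η.1 ∈ K
    · rw [translate_eq_zero, mul_zero, zero_mul]
      refine hτ0 _ fun hc => hp ⟨?_, h⟩
      exact TopGroupoid.mem_mulSet (η.2.trans γ'.2.symm) h hc
    · rw [hσ0 _ h, transport_zero, zero_mul, zero_mul]

end Assoc

end Convolution

end GBanachAlgebra

/-! ### Monotone and unconditional semi-norms -/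

/-- A monotone semi-norm on `C_c(Y)`. -/
structure MonotoneSeminorm (Y : Type*) [TopologicalSpace Y] extends Seminorm ℂ C_c(Y, ℂ) where
  mono : ∀ φ ψ : C_c(Y, ℂ), (∀ y, ‖φ y‖ ≤ ‖ψ y‖) → toFun φ ≤ toFun ψ

namespace MonotoneSeminorm

variable {Y : Type*} [TopologicalSpace Y] (N : MonotoneSeminorm Y)

/-- The extension of a monotone semi-norm to non-negative functions that are dominated by a
function in `C_c(Y)`. -/
def ext (φ : Y → ℝ) : ℝ :=
  sInf {t | ∃ ψ : C_c(Y, ℂ), (∀ y, φ y ≤ ‖ψ y‖) ∧ t = N.toSeminorm ψ}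

/-- The function `|ψ|`. -/
def absC (ψ : C_c(Y, ℂ)) : C_c(Y, ℂ) where
  toFun y := (‖ψ y‖ : ℂ)
  continuous_toFun := Complex.continuous_ofReal.comp (continuous_norm.comp ψ.continuous)
  hasCompactSupport' :=
    ψ.hasCompactSupport.comp_left (g := fun z : ℂ => (‖z‖ : ℂ)) (by simp)

@[simp] theorem norm_absC (ψ : C_c(Y, ℂ)) (y : Y) : ‖absC ψ y‖ = ‖ψ y‖ := by
  change ‖((‖ψ y‖ : ℝ) : ℂ)‖ = _
  simp

theorem apply_absC (ψ : C_c(Y, ℂ)) : N.toSeminorm (absC ψ) = N.toSeminorm ψ :=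
  le_antisymm (N.mono _ _ fun y => by simp) (N.mono _ _ fun y => by simp)

theorem bddBelow (φ : Y → ℝ) :
    BddBelow {t | ∃ ψ : C_c(Y, ℂ), (∀ y, φ y ≤ ‖ψ y‖) ∧ t = N.toSeminorm ψ} :=
  ⟨0, by rintro _ ⟨ψ, -, rfl⟩; exact apply_nonneg _ _⟩

theorem ext_nonneg (φ : Y → ℝ) : 0 ≤ N.ext φ :=
  Real.sInf_nonneg (by rintro _ ⟨ψ, -, rfl⟩; exact apply_nonneg _ _)

theorem ext_le {φ : Y → ℝ} {ψ : C_c(Y, ℂ)} (h : ∀ y, φ y ≤ ‖ψ y‖) :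
    N.ext φ ≤ N.toSeminorm ψ :=
  csInf_le (N.bddBelow φ) ⟨ψ, h, rfl⟩

theorem exists_lt {φ : Y → ℝ} (h : ∃ ψ : C_c(Y, ℂ), ∀ y, φ y ≤ ‖ψ y‖) {ε : ℝ} (hε : 0 < ε) :
    ∃ ψ : C_c(Y, ℂ), (∀ y, φ y ≤ ‖ψ y‖) ∧ N.toSeminorm ψ < N.ext φ + ε := by
  obtain ⟨ψ, hψ⟩ := h
  obtain ⟨_, ⟨ψ', h1, rfl⟩, h2⟩ := exists_lt_of_csInf_lt
    (s := {t | ∃ ψ : C_c(Y, ℂ), (∀ y, φ y ≤ ‖ψ y‖) ∧ t = N.toSeminorm ψ}) ⟨_, ψ, hψ, rfl⟩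
    (show N.ext φ < N.ext φ + ε by linarith)
  exact ⟨ψ', h1, h2⟩

/-- The extension agrees with the given semi-norm on `C_c(Y)`. -/
theorem ext_apply (ψ : C_c(Y, ℂ)) : N.ext (fun y => ‖ψ y‖) = N.toSeminorm ψ :=
  le_antisymm (N.ext_le fun _ => le_rfl) (le_csInf ⟨_, ψ, fun _ => le_rfl, rfl⟩ (by
    rintro _ ⟨ψ', h, rfl⟩
    exact N.mono _ _ h))

theorem ext_add_le {φ φ' φ'' : Y → ℝ} (h : ∃ ψ : C_c(Y, ℂ), ∀ y, φ y ≤ ‖ψ y‖)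
    (h' : ∃ ψ : C_c(Y, ℂ), ∀ y, φ' y ≤ ‖ψ y‖) (hs : ∀ y, φ'' y ≤ φ y + φ' y) :
    N.ext φ'' ≤ N.ext φ + N.ext φ' := by
  refine le_of_forall_pos_le_add fun ε hε => ?_
  obtain ⟨ψ, h1, h2⟩ := N.exists_lt h (half_pos hε)
  obtain ⟨ψ', h1', h2'⟩ := N.exists_lt h' (half_pos hε)
  have h3 : N.ext φ'' ≤ N.toSeminorm (absC ψ + absC ψ') := by
    refine N.ext_le fun y => (hs y).trans ?_
    have : ‖(absC ψ + absC ψ') y‖ = ‖ψ y‖ + ‖ψ' y‖ := by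
      change ‖((‖ψ y‖ : ℝ) : ℂ) + ((‖ψ' y‖ : ℝ) : ℂ)‖ = _
      rw [← Complex.ofReal_add, Complex.norm_real, Real.norm_of_nonneg (by positivity)]
    rw [this]
    exact add_le_add (h1 y) (h1' y)
  have h4 := map_add_le_add N.toSeminorm (absC ψ) (absC ψ')
  rw [N.apply_absC, N.apply_absC] at h4
  linarith

theorem ext_smul_le {φ φ' : Y → ℝ} (h : ∃ ψ : C_c(Y, ℂ), ∀ y, φ y ≤ ‖ψ y‖) (c : ℂ)
    (hs : ∀ y, φ' y = ‖c‖ * φ y) : N.ext φ' ≤ ‖c‖ * N.ext φ := by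
  refine le_of_forall_pos_le_add fun ε hε => ?_
  obtain ⟨ψ, h1, h2⟩ := N.exists_lt h (show 0 < ε / (‖c‖ + 1) by positivity)
  have h3 : N.ext φ' ≤ N.toSeminorm (c • ψ) := by
    refine N.ext_le fun y => ?_
    rw [hs]
    change _ ≤ ‖c • ψ y‖
    rw [norm_smul]
    exact mul_le_mul_of_nonneg_left (h1 y) (norm_nonneg _)
  rw [map_smul_eq_mul] at h3
  have h4 : ‖c‖ * N.toSeminorm ψ ≤ ‖c‖ * (N.ext φ + ε / (‖c‖ + 1)) :=
    mul_le_mul_of_nonneg_left h2.le (norm_nonneg _)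
  have h5 : ‖c‖ * (ε / (‖c‖ + 1)) ≤ ε := by
    rw [mul_div_assoc', div_le_iff₀ (by positivity)]
    nlinarith [norm_nonneg c]
  linarith

end MonotoneSeminorm

namespace TopGroupoid

section ScalarConv

variable {X G : Type*} [TopologicalSpace X] [TopologicalSpace G] {𝒢 : TopGroupoid X G}
  [MeasurableSpace G] [BorelSpace G] [T2Space X] [T2Space G]
  (μ : 𝒢.HaarSystem)

theorem continuous_scalarIntegrand (f g : C_c(G, ℂ)) :
    Continuous fun q : 𝒢.Pairs => f q.1.1 * g (𝒢.mul (𝒢.inv q.1.1) q.1.2) :=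
  (f.continuous.comp (continuous_fst.comp continuous_subtype_val)).mul
    (g.continuous.comp GBanachAlgebra.continuous_div)

theorem scalarIntegrand_eq_zero (f g : C_c(G, ℂ)) (q : 𝒢.Pairs)
    (hq : ¬(q.1.1 ∈ tsupport f ∧ q.1.2 ∈ 𝒢.mulSet (tsupport f) (tsupport g))) :
    f q.1.1 * g (𝒢.mul (𝒢.inv q.1.1) q.1.2) = 0 := by
  by_cases h : q.1.1 ∈ tsupport f
  · by_cases h' : 𝒢.mul (𝒢.inv q.1.1) q.1.2 ∈ tsupport g
    · exact absurd ⟨h, mem_mulSet q.2 h h'⟩ hq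
    · rw [image_eq_zero_of_notMem_tsupport h', mul_zero]
  · rw [image_eq_zero_of_notMem_tsupport h, zero_mul]

theorem integrable_scalarIntegrand (f g : C_c(G, ℂ)) (γ : G) :
    Integrable (fun γ' : {γ' : G // 𝒢.r γ' = 𝒢.r γ} => f γ' * g (𝒢.mul (𝒢.inv γ'.1) γ))
      (μ.μ (𝒢.r γ)) := by
  have hg : Continuous fun γ' : {γ' : G // 𝒢.r γ' = 𝒢.r γ} =>
      (⟨(γ'.1, γ), γ'.2⟩ : 𝒢.Pairs) :=
    Continuous.subtype_mk (continuous_subtype_val.prodMk continuous_const) _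
  refine μ.integrable_fibre ((continuous_scalarIntegrand f g).comp hg) f.hasCompactSupport
    fun γ' hγ' => ?_
  rw [image_eq_zero_of_notMem_tsupport hγ', zero_mul]

variable [LocallyCompactSpace G]

/-- The convolution on `C_c(G)`: `(f * g)(γ) = ∫ f(γ') g(γ'⁻¹γ) dμ^{r(γ)}(γ')`. -/
def scalarConv (f g : C_c(G, ℂ)) : C_c(G, ℂ) where
  toFun γ := ∫ γ' : {γ' : G // 𝒢.r γ' = 𝒢.r γ}, f γ' * g (𝒢.mul (𝒢.inv γ'.1) γ)
    ∂(μ.μ (𝒢.r γ))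
  continuous_toFun := by
    have h := μ.isSection_integral (F := BanachField.trivialField X)
      (Φ := fun q : 𝒢.Pairs => f q.1.1 * g (𝒢.mul (𝒢.inv q.1.1) q.1.2))
      (BanachField.trivialField_isSection _ (continuous_scalarIntegrand f g))
      f.hasCompactSupport (isCompact_mulSet (𝒢 := 𝒢) f.hasCompactSupport g.hasCompactSupport)
      (scalarIntegrand_eq_zero f g)
    exact BanachField.continuous_of_trivialField_isSection h 𝒢.continuous_r
  hasCompactSupport' := by
    refine HasCompactSupport.intro
      (isCompact_mulSet (𝒢 := 𝒢) f.hasCompactSupport g.hasCompactSupport) fun γ hγ => ?_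
    refine integral_eq_zero_of_ae (Eventually.of_forall fun γ' => ?_)
    exact scalarIntegrand_eq_zero f g ⟨(γ'.1, γ), γ'.2⟩ fun hc => hγ hc.2

end ScalarConv

end TopGroupoid

open TopGroupoid

/-- An unconditional semi-norm on `C_c(G)`: a monotone semi-norm that is submultiplicative for the
convolution product. -/
structure UnconditionalSeminorm {X G : Type*} [TopologicalSpace X] [TopologicalSpace G]
    {𝒢 : TopGroupoid X G} [MeasurableSpace G] [BorelSpace G] [T2Space X] [T2Space G]
    [LocallyCompactSpace G] (μ : 𝒢.HaarSystem) extends MonotoneSeminorm G where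
  conv_le : ∀ f g : C_c(G, ℂ), toFun (scalarConv μ f g) ≤ toFun f * toFun g

/-! ### The algebra of compactly supported sections and its completions -/

namespace GBanachAlgebra

section Completion

variable {X G : Type*} [TopologicalSpace X] [TopologicalSpace G] {𝒢 : TopGroupoid X G}
  {B : X → Type*} [∀ x, NonUnitalNormedRing (B x)] [∀ x, NormedSpace ℂ (B x)]

/-- The space `Γ_c(G, r^*B)` of continuous sections with compact support. -/
def compactSections (𝓑 : GBanachAlgebra 𝒢 B) : Submodule ℂ (∀ γ, B (𝒢.r γ)) where
  carrier := {σ | 𝓑.IsSection 𝒢.r σ ∧ ∃ K : Set G, IsCompact K ∧ ∀ γ ∉ K, σ γ = 0}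
  zero_mem' := ⟨fun _ => BanachField.IsSectionAt.zero, ∅, isCompact_empty, fun _ _ => rfl⟩
  add_mem' := by
    rintro σ τ ⟨hσ, K, hK, h0⟩ ⟨hτ, L, hL, h0'⟩
    refine ⟨fun γ => (hσ γ).add (hτ γ), K ∪ L, hK.union hL, fun γ hγ => ?_⟩
    rw [Pi.add_apply, h0 γ fun h => hγ (Or.inl h), h0' γ fun h => hγ (Or.inr h), add_zero]
  smul_mem' := by
    rintro c σ ⟨hσ, K, hK, h0⟩
    refine ⟨fun γ => BanachField.IsSectionAt.smul (g := fun _ => c) 𝒢.continuous_r.continuousAt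
      continuousAt_const (hσ γ), K, hK, fun γ hγ => ?_⟩
    rw [Pi.smul_apply, h0 γ hγ, smul_zero]

variable [MeasurableSpace G] [BorelSpace G] [T2Space X] [T2Space G] [LocallyCompactSpace G]
  {μ : 𝒢.HaarSystem}

/-- The space `Γ_c(G, r^*B)`, equipped with the convolution product and the semi-norm defined by
the unconditional semi-norm `A`. -/
def ConvAlg (_A : UnconditionalSeminorm μ) (𝓑 : GBanachAlgebra 𝒢 B) : Type _ :=
  𝓑.compactSections

variable (A : UnconditionalSeminorm μ) (𝓑 : GBanachAlgebra 𝒢 B)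

instance : AddCommGroup (ConvAlg A 𝓑) := inferInstanceAs (AddCommGroup 𝓑.compactSections)

instance : Module ℂ (ConvAlg A 𝓑) := inferInstanceAs (Module ℂ 𝓑.compactSections)

theorem exists_dominating (σ : ConvAlg A 𝓑) : ∃ ψ : C_c(G, ℂ), ∀ γ, ‖σ.1 γ‖ ≤ ‖ψ γ‖ := by
  obtain ⟨hσ, K, hK, h0⟩ := σ.2
  obtain ⟨M, hM, hb⟩ := hσ.exists_bound 𝒢.continuous_r hK
  obtain ⟨h, h1, -, hcs, h01⟩ := exists_continuous_one_zero_of_isCompact hK isClosed_empty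
    (disjoint_empty _)
  refine ⟨⟨⟨fun γ => ((M * h γ : ℝ) : ℂ), by fun_prop⟩,
    hcs.comp_left (g := fun t : ℝ => ((M * t : ℝ) : ℂ)) (by simp)⟩, fun γ => ?_⟩
  change _ ≤ ‖((M * h γ : ℝ) : ℂ)‖
  by_cases hγ : γ ∈ K
  · rw [h1 hγ]
    simpa [abs_of_nonneg hM] using hb γ hγ
  · rw [h0 γ hγ, norm_zero]
    exact norm_nonneg _

/-- The semi-norm `σ ↦ ‖γ ↦ ‖σ γ‖‖_A`. -/
def convSeminorm : Seminorm ℂ (ConvAlg A 𝓑) :=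
  Seminorm.ofSMulLE (fun σ => A.ext fun γ => ‖σ.1 γ‖)
    (le_antisymm (by
      have h := A.ext_le (φ := fun γ => ‖(0 : ConvAlg A 𝓑).1 γ‖) (ψ := 0) fun γ => by
        change ‖(0 : B (𝒢.r γ))‖ ≤ _
        simp
      rwa [map_zero] at h) (A.ext_nonneg _))
    (fun σ τ => A.ext_add_le (exists_dominating A 𝓑 σ) (exists_dominating A 𝓑 τ)
      fun γ => norm_add_le (σ.1 γ) (τ.1 γ))
    (fun c σ => A.ext_smul_le (exists_dominating A 𝓑 σ) c fun γ => norm_smul c (σ.1 γ))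

variable [∀ x, CompleteSpace (B x)]

instance : Mul (ConvAlg A 𝓑) where
  mul σ τ := ⟨𝓑.conv μ σ.1 τ.1, by
    obtain ⟨hσ, K, hK, h0⟩ := σ.2
    obtain ⟨hτ, L, hL, h0'⟩ := τ.2
    exact ⟨isSection_conv hσ hτ hK hL h0 h0', 𝒢.mulSet K L, isCompact_mulSet hK hL,
      conv_eq_zero h0 h0'⟩⟩

variable [∀ x, IsScalarTower ℂ (B x) (B x)] [∀ x, SMulCommClass ℂ (B x) (B x)]

instance : NonUnitalRing (ConvAlg A 𝓑) :=
  { (inferInstance : AddCommGroup (ConvAlg A 𝓑)), (inferInstance : Mul (ConvAlg A 𝓑)) with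
    left_distrib := fun σ τ υ => by
      obtain ⟨hσ, K, hK, h0⟩ := σ.2
      exact Subtype.ext (conv_add_right hσ τ.2.1 υ.2.1 hK h0)
    right_distrib := fun σ τ υ => by
      obtain ⟨hσ, K, hK, h0⟩ := σ.2
      obtain ⟨hτ, L, hL, h0'⟩ := τ.2
      exact Subtype.ext (conv_add_left hσ hτ υ.2.1 hK hL h0 h0')
    zero_mul := fun σ => by
      have h := conv_smul_left (μ := μ) (𝓑 := 𝓑) (σ := 0) (τ := σ.1) 0
      rw [zero_smul, zero_smul] at h
      exact Subtype.ext h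
    mul_zero := fun σ => by
      have h := conv_smul_right (μ := μ) (𝓑 := 𝓑) (σ := σ.1) (τ := 0) 0
      rw [zero_smul, zero_smul] at h
      exact Subtype.ext h
    mul_assoc := fun σ τ υ => by
      obtain ⟨hσ, K, hK, h0⟩ := σ.2
      obtain ⟨hτ, L, hL, h0'⟩ := τ.2
      exact Subtype.ext (conv_assoc hσ hτ υ.2.1 hK hL h0 h0') }

theorem norm_conv_le (σ τ : ConvAlg A 𝓑) (f g : C_c(G, ℂ)) (hf : ∀ γ, ‖σ.1 γ‖ ≤ ‖f γ‖)
    (hg : ∀ γ, ‖τ.1 γ‖ ≤ ‖g γ‖) (γ : G) : ‖(σ * τ).1 γ‖ ≤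
      ‖scalarConv μ (MonotoneSeminorm.absC f) (MonotoneSeminorm.absC g) γ‖ := by
  have hi := (integrable_scalarIntegrand μ (MonotoneSeminorm.absC f)
    (MonotoneSeminorm.absC g) γ).norm
  have h1 : ‖(σ * τ).1 γ‖ ≤ ∫ γ' : {γ' : G // 𝒢.r γ' = 𝒢.r γ},
      ‖f γ'‖ * ‖g (𝒢.mul (𝒢.inv γ'.1) γ)‖ ∂(μ.μ (𝒢.r γ)) := by
    refine norm_integral_le_of_norm_le ?_ (Eventually.of_forall fun γ' => ?_)
    · simpa using hi
    · refine (norm_mul_le _ _).trans (mul_le_mul ?_ ?_ (norm_nonneg _) (norm_nonneg _))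
      · rw [norm_transport]
        exact hf _
      · rw [translate, LinearIsometry.norm_map]
        exact hg _
  refine h1.trans (le_of_eq ?_)
  change _ = ‖∫ γ' : {γ' : G // 𝒢.r γ' = 𝒢.r γ},
    ((‖f γ'‖ : ℝ) : ℂ) * ((‖g (𝒢.mul (𝒢.inv γ'.1) γ)‖ : ℝ) : ℂ) ∂(μ.μ (𝒢.r γ))‖
  simp only [← Complex.ofReal_mul]
  rw [integral_complex_ofReal, Complex.norm_real, Real.norm_of_nonneg]
  exact integral_nonneg fun γ' => by positivity

instance : NonUnitalSeminormedRing (ConvAlg A 𝓑) :=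
  { (convSeminorm A 𝓑).toAddGroupSeminorm.toSeminormedAddCommGroup,
    (inferInstance : NonUnitalRing (ConvAlg A 𝓑)) with
    norm_mul_le := fun σ τ => by
      change A.ext _ ≤ A.ext _ * A.ext _
      set a := A.ext fun γ => ‖σ.1 γ‖
      set b := A.ext fun γ => ‖τ.1 γ‖
      have ha : 0 ≤ a := A.ext_nonneg _
      have hb : 0 ≤ b := A.ext_nonneg _
      have key : ∀ ε > 0, A.ext (fun γ => ‖(σ * τ).1 γ‖) ≤ (a + ε) * (b + ε) := by
        intro ε hε
        obtain ⟨f, h1, h2⟩ := A.exists_lt (exists_dominating A 𝓑 σ) hε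
        obtain ⟨g, h3, h4⟩ := A.exists_lt (exists_dominating A 𝓑 τ) hε
        refine (A.ext_le (norm_conv_le A 𝓑 σ τ f g h1 h3)).trans ((A.conv_le _ _).trans ?_)
        refine mul_le_mul ?_ ?_ (apply_nonneg A.toSeminorm _) (by positivity)
        · exact (A.apply_absC f).le.trans h2.le
        · exact (A.apply_absC g).le.trans h4.le
      have hc : Continuous fun ε : ℝ => (a + ε) * (b + ε) := by fun_prop
      have ht : Tendsto (fun ε : ℝ => (a + ε) * (b + ε)) (𝓝[>] 0) (𝓝 ((a + 0) * (b + 0))) :=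
        (hc.tendsto 0).mono_left nhdsWithin_le_nhds
      rw [add_zero, add_zero] at ht
      exact ge_of_tendsto ht (eventually_nhdsWithin_of_forall key) }

instance : NormedSpace ℂ (ConvAlg A 𝓑) where
  norm_smul_le c σ := ((convSeminorm A 𝓑).smul' c σ).le

instance : IsScalarTower ℂ (ConvAlg A 𝓑) (ConvAlg A 𝓑) where
  smul_assoc c _ _ := Subtype.ext (conv_smul_left c)

instance : SMulCommClass ℂ (ConvAlg A 𝓑) (ConvAlg A 𝓑) where
  smul_comm c _ _ := Subtype.ext (conv_smul_right c).symm

theorem convAlg_norm_def (σ : ConvAlg A 𝓑) : ‖σ‖ = A.ext fun γ => ‖σ.1 γ‖ := rfl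

theorem convAlg_mul_def (σ τ : ConvAlg A 𝓑) : (σ * τ).1 = 𝓑.conv μ σ.1 τ.1 := rfl

end Completion

end GBanachAlgebra

section BanachCompletion

open UniformSpace

variable (R : Type*) [NonUnitalSeminormedRing R]

/-- The Hausdorff completion of a semi-normed algebra, as a Banach algebra. -/
def BanachCompletion : Type _ := Completion R

namespace BanachCompletion

instance : NormedAddCommGroup (BanachCompletion R) :=
  inferInstanceAs (NormedAddCommGroup (Completion R))

instance : CompleteSpace (BanachCompletion R) := inferInstanceAs (CompleteSpace (Completion R))

instance [NormedSpace ℂ R] : NormedSpace ℂ (BanachCompletion R) :=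
  inferInstanceAs (NormedSpace ℂ (Completion R))

variable {R}

/-- The canonical map into the completion. -/
def of (a : R) : BanachCompletion R := (a : Completion R)

theorem of_add (a b : R) : of (a + b) = of a + of b := Completion.coe_add a b

theorem of_zero : of (0 : R) = 0 := rfl

theorem of_smul [NormedSpace ℂ R] (c : ℂ) (a : R) : of (c • a) = c • of a :=
  Completion.coe_smul c a

theorem norm_of (a : R) : ‖of a‖ = ‖a‖ := Completion.norm_coe a

theorem continuous_of : Continuous (of : R → BanachCompletion R) := Completion.continuous_coe R

theorem isDenseInducing_of : IsDenseInducing (of : R → BanachCompletion R) :=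
  Completion.isDenseInducing_coe

@[elab_as_elim]
theorem induction_on {p : BanachCompletion R → Prop} (a : BanachCompletion R)
    (hp : IsClosed {a | p a}) (ih : ∀ a, p (of a)) : p a := Completion.induction_on a hp ih

/-- The product on the completion: the continuous extension of the product of `R`. -/
instance : Mul (BanachCompletion R) where
  mul := Function.curry ((isDenseInducing_of.prodMap isDenseInducing_of).extend
    (of ∘ Function.uncurry ((· * ·) : R → R → R)))

theorem of_mul (a b : R) : of (a * b) = of a * of b :=
  ((isDenseInducing_of.prodMap isDenseInducing_of).extend_eq
    (continuous_of.comp (continuous_mul (M := R))) (a, b)).symm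

instance : ContinuousMul (BanachCompletion R) where
  continuous_mul := by
    let t : R →+ BanachCompletion R := ⟨⟨of, of_zero⟩, of_add⟩
    let m := (AddMonoidHom.mul : R →+ R →+ R).compr₂ t
    have h : Continuous fun p : R × R => m p.1 p.2 := continuous_of.comp continuous_mul
    have di : IsDenseInducing t := isDenseInducing_of
    exact (di.extend_Z_bilin di h :)

theorem norm_mul_le_aux (a b : BanachCompletion R) : ‖a * b‖ ≤ ‖a‖ * ‖b‖ := by
  have h1 : ∀ a' : R, ‖of a' * b‖ ≤ ‖of a'‖ * ‖b‖ := fun a' => by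
    refine induction_on b (isClosed_le (continuous_const.mul continuous_id).norm
      (continuous_const.mul continuous_norm)) fun b => ?_
    rw [← of_mul, norm_of, norm_of, norm_of]
    exact norm_mul_le a' b
  exact induction_on a (isClosed_le (continuous_id.mul continuous_const).norm
    (continuous_norm.mul continuous_const)) h1

theorem mul_add_aux (a b c : BanachCompletion R) : a * (b + c) = a * b + a * c := by
  have h2 : ∀ a' b' : R, of a' * (of b' + c) = of a' * of b' + of a' * c := fun a' b' => by
    refine induction_on c (isClosed_eq (continuous_const.mul (continuous_const.add continuous_id))
      (continuous_const.add (continuous_const.mul continuous_id))) fun c => ?_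
    rw [← of_add, ← of_mul, ← of_mul, ← of_mul, ← of_add, mul_add]
  have h1 : ∀ a' : R, of a' * (b + c) = of a' * b + of a' * c := fun a' =>
    induction_on b (isClosed_eq (continuous_const.mul (continuous_id.add continuous_const))
      ((continuous_const.mul continuous_id).add continuous_const)) (h2 a')
  exact induction_on a (isClosed_eq (continuous_id.mul continuous_const)
    ((continuous_id.mul continuous_const).add (continuous_id.mul continuous_const))) h1

theorem add_mul_aux (a b c : BanachCompletion R) : (a + b) * c = a * c + b * c := by
  have h2 : ∀ a' b' : R, (of a' + of b') * c = of a' * c + of b' * c := fun a' b' => by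
    refine induction_on c (isClosed_eq (continuous_const.mul continuous_id)
      ((continuous_const.mul continuous_id).add (continuous_const.mul continuous_id)))
      fun c => ?_
    rw [← of_add, ← of_mul, ← of_mul, ← of_mul, ← of_add, add_mul]
  have h1 : ∀ a' : R, (of a' + b) * c = of a' * c + b * c := fun a' =>
    induction_on b (isClosed_eq ((continuous_const.add continuous_id).mul continuous_const)
      (continuous_const.add (continuous_id.mul continuous_const))) (h2 a')
  exact induction_on a (isClosed_eq ((continuous_id.add continuous_const).mul continuous_const)
    ((continuous_id.mul continuous_const).add continuous_const)) h1

theorem mul_assoc_aux (a b c : BanachCompletion R) : a * b * c = a * (b * c) := by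
  have h2 : ∀ a' b' : R, of a' * of b' * c = of a' * (of b' * c) := fun a' b' => by
    refine induction_on c (isClosed_eq (continuous_const.mul continuous_id)
      (continuous_const.mul (continuous_const.mul continuous_id))) fun c => ?_
    rw [← of_mul, ← of_mul, ← of_mul, ← of_mul, _root_.mul_assoc]
  have h1 : ∀ a' : R, of a' * b * c = of a' * (b * c) := fun a' =>
    induction_on b (isClosed_eq ((continuous_const.mul continuous_id).mul continuous_const)
      (continuous_const.mul (continuous_id.mul continuous_const))) (h2 a')
  exact induction_on a (isClosed_eq ((continuous_id.mul continuous_const).mul continuous_const)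
    (continuous_id.mul continuous_const)) h1

theorem zero_mul_aux (a : BanachCompletion R) : 0 * a = 0 := by
  have h := add_mul_aux 0 0 a
  rwa [add_zero, left_eq_add] at h

theorem mul_zero_aux (a : BanachCompletion R) : a * 0 = 0 := by
  have h := mul_add_aux a 0 0
  rwa [add_zero, left_eq_add] at h

instance : NonUnitalRing (BanachCompletion R) :=
  { (inferInstance : AddCommGroup (BanachCompletion R)),
    (inferInstance : Mul (BanachCompletion R)) with
    left_distrib := mul_add_aux
    right_distrib := add_mul_aux
    zero_mul := zero_mul_aux
    mul_zero := mul_zero_aux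
    mul_assoc := mul_assoc_aux }

theorem smul_mul_aux [NormedSpace ℂ R] [IsScalarTower ℂ R R] (c : ℂ)
    (a b : BanachCompletion R) : (c • a) * b = c • (a * b) := by
  have h1 : ∀ a' : R, (c • of a') * b = c • (of a' * b) := fun a' => by
    refine induction_on b (isClosed_eq (continuous_const.mul continuous_id)
      ((continuous_const.mul continuous_id).const_smul c)) fun b => ?_
    rw [← of_smul, ← of_mul, ← of_mul, ← of_smul, smul_mul_assoc]
  exact induction_on a (isClosed_eq ((continuous_id.const_smul c).mul continuous_const)
    ((continuous_id.mul continuous_const).const_smul c)) h1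

theorem mul_smul_aux [NormedSpace ℂ R] [SMulCommClass ℂ R R] (c : ℂ)
    (a b : BanachCompletion R) : a * (c • b) = c • (a * b) := by
  have h1 : ∀ a' : R, of a' * (c • b) = c • (of a' * b) := fun a' => by
    refine induction_on b (isClosed_eq (continuous_const.mul (continuous_id.const_smul c))
      ((continuous_const.mul continuous_id).const_smul c)) fun b => ?_
    rw [← of_smul, ← of_mul, ← of_mul, ← of_smul, mul_smul_comm]
  exact induction_on a (isClosed_eq (continuous_id.mul continuous_const)
    ((continuous_id.mul continuous_const).const_smul c)) h1

instance : NonUnitalNormedRing (BanachCompletion R) :=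
  { (inferInstance : NormedAddCommGroup (BanachCompletion R)),
    (inferInstance : NonUnitalRing (BanachCompletion R)) with
    norm_mul_le := norm_mul_le_aux }

instance [NormedSpace ℂ R] [IsScalarTower ℂ R R] :
    IsScalarTower ℂ (BanachCompletion R) (BanachCompletion R) where
  smul_assoc c a b := smul_mul_aux c a b

instance [NormedSpace ℂ R] [SMulCommClass ℂ R R] :
    SMulCommClass ℂ (BanachCompletion R) (BanachCompletion R) where
  smul_comm c a b := (mul_smul_aux c a b).symm

variable {S : Type*} [NonUnitalSeminormedRing S] [NormedSpace ℂ R] [NormedSpace ℂ S]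

/-- The underlying map of `map`. -/
def mapFun (f : R →ₙₐ[ℂ] S) (a : BanachCompletion R) : BanachCompletion S := Completion.map f a

theorem continuous_mapFun (f : R →ₙₐ[ℂ] S) : Continuous (mapFun f) := Completion.continuous_map

theorem mapFun_of (f : R →ₙₐ[ℂ] S) (hf : ∀ a, ‖f a‖ ≤ ‖a‖) (a : R) : mapFun f (of a) = of (f a) :=
  Completion.map_coe (AddMonoidHomClass.uniformContinuous_of_bound f 1 fun a => by
    simpa using hf a) a

/-- The homomorphism between completions induced by a norm-decreasing homomorphism. -/
def map (f : R →ₙₐ[ℂ] S) (hf : ∀ a, ‖f a‖ ≤ ‖a‖) :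
    BanachCompletion R →ₙₐ[ℂ] BanachCompletion S where
  toFun := mapFun f
  map_smul' := fun c a => induction_on a
    (isClosed_eq ((continuous_mapFun f).comp (continuous_const_smul c))
      ((continuous_const_smul c).comp (continuous_mapFun f))) fun a => by
    rw [← of_smul, mapFun_of f hf, mapFun_of f hf, map_smul, of_smul]
    rfl
  map_zero' := by
    rw [← of_zero, mapFun_of f hf, map_zero]
    rfl
  map_add' := fun a b => by
    have h1 : ∀ a' : R, mapFun f (of a' + b) = mapFun f (of a') + mapFun f b := fun a' =>
      induction_on b (isClosed_eq
        ((continuous_mapFun f).comp (continuous_const.add continuous_id))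
        (continuous_const.add (continuous_mapFun f))) fun b => by
        rw [← of_add, mapFun_of f hf, mapFun_of f hf, mapFun_of f hf, map_add, of_add]
    exact induction_on a (isClosed_eq
      ((continuous_mapFun f).comp (continuous_id.add continuous_const))
      ((continuous_mapFun f).add continuous_const)) h1
  map_mul' := fun a b => by
    have h1 : ∀ a' : R, mapFun f (of a' * b) = mapFun f (of a') * mapFun f b := fun a' =>
      induction_on b (isClosed_eq
        ((continuous_mapFun f).comp (continuous_const.mul continuous_id))
        (continuous_const.mul (continuous_mapFun f))) fun b => by
        rw [← of_mul, mapFun_of f hf, mapFun_of f hf, mapFun_of f hf, map_mul, of_mul]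
    exact induction_on a (isClosed_eq
      ((continuous_mapFun f).comp (continuous_id.mul continuous_const))
      ((continuous_mapFun f).mul continuous_const)) h1

theorem continuous_map (f : R →ₙₐ[ℂ] S) (hf : ∀ a, ‖f a‖ ≤ ‖a‖) : Continuous (map f hf) :=
  continuous_mapFun f

theorem map_of (f : R →ₙₐ[ℂ] S) (hf : ∀ a, ‖f a‖ ≤ ‖a‖) (a : R) : map f hf (of a) = of (f a) :=
  mapFun_of f hf a

end BanachCompletion

end BanachCompletion

namespace GBanachAlgebra

section CrossedProduct

variable {X G : Type*} [TopologicalSpace X] [TopologicalSpace G] {𝒢 : TopGroupoid X G}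
  {B : X → Type*} [∀ x, NonUnitalNormedRing (B x)] [∀ x, NormedSpace ℂ (B x)]
  [MeasurableSpace G] [BorelSpace G] [T2Space X] [T2Space G] [LocallyCompactSpace G]
  {μ : 𝒢.HaarSystem} [∀ x, CompleteSpace (B x)]
  [∀ x, IsScalarTower ℂ (B x) (B x)] [∀ x, SMulCommClass ℂ (B x) (B x)]

/-- The Banach algebra `A(G, B)`. -/
abbrev CrossedProduct (A : UnconditionalSeminorm μ) (𝓑 : GBanachAlgebra 𝒢 B) : Type _ :=
  BanachCompletion (ConvAlg A 𝓑)

theorem norm_le_of_dominates {A C : UnconditionalSeminorm μ} {𝓑 : GBanachAlgebra 𝒢 B}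
    (h : ∀ f, A.toSeminorm f ≤ C.toSeminorm f) (σ : ConvAlg C 𝓑) :
    A.ext (fun γ => ‖σ.1 γ‖) ≤ C.ext (fun γ => ‖σ.1 γ‖) := by
  refine le_of_forall_pos_le_add fun ε hε => ?_
  obtain ⟨ψ, h1, h2⟩ := C.exists_lt (exists_dominating C 𝓑 σ) hε
  exact (A.ext_le h1).trans ((h ψ).trans h2.le)

/-- The canonical homomorphism `C(G, B) → A(G, B)` when `‖·‖_C` dominates `‖·‖_A`; it extends the
identity of `Γ_c(G, r^*B)`. -/
def comparison {A C : UnconditionalSeminorm μ} (𝓑 : GBanachAlgebra 𝒢 B)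
    (h : ∀ f, A.toSeminorm f ≤ C.toSeminorm f) :
    CrossedProduct C 𝓑 →ₙₐ[ℂ] CrossedProduct A 𝓑 :=
  BanachCompletion.map
    ({ toFun := fun σ => σ
       map_smul' := fun _ _ => rfl
       map_zero' := rfl
       map_add' := fun _ _ => rfl
       map_mul' := fun _ _ => rfl } : ConvAlg C 𝓑 →ₙₐ[ℂ] ConvAlg A 𝓑)
    (norm_le_of_dominates h)

theorem continuous_comparison {A C : UnconditionalSeminorm μ} (𝓑 : GBanachAlgebra 𝒢 B)
    (h : ∀ f, A.toSeminorm f ≤ C.toSeminorm f) : Continuous (comparison 𝓑 h) :=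
  BanachCompletion.continuous_map _ _

end CrossedProduct

end GBanachAlgebra

/-! ### K-theory -/

/-- An idempotent matrix, of any size, over `R`. -/
structure IdemMat (R : Type*) [Ring R] where
  size : ℕ
  mat : Matrix (Fin size) (Fin size) R
  idem : mat * mat = mat

namespace IdemMat

variable {R S : Type*} [Ring R] [Ring S]

/-- Equivalence of idempotents: `e = xy` and `f = yx` for rectangular matrices `x`, `y`. -/
def Equivalent (e f : IdemMat R) : Prop :=
  ∃ (x : Matrix (Fin e.size) (Fin f.size) R) (y : Matrix (Fin f.size) (Fin e.size) R),
    x * y = e.mat ∧ y * x = f.mat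

/-- The block diagonal sum of idempotents. -/
def directSum (e f : IdemMat R) : IdemMat R where
  size := e.size + f.size
  mat := (Matrix.fromBlocks e.mat 0 0 f.mat).submatrix finSumFinEquiv.symm finSumFinEquiv.symm
  idem := by
    rw [Matrix.submatrix_mul_equiv, Matrix.fromBlocks_multiply]
    simp [e.idem, f.idem]

/-- The entrywise image of an idempotent under a ring homomorphism. -/
def map (φ : R →+* S) (e : IdemMat R) : IdemMat S where
  size := e.size
  mat := e.mat.map φ
  idem := by rw [← Matrix.map_mul, e.idem]

theorem map_directSum (φ : R →+* S) (e f : IdemMat R) :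
    (e.directSum f).map φ = (e.map φ).directSum (f.map φ) := by
  have h : ∀ m n : ℕ, (0 : Matrix (Fin m) (Fin n) R).map φ = 0 := fun m n => by
    ext i j
    exact map_zero φ
  have h2 : ((Matrix.fromBlocks e.mat 0 0 f.mat).submatrix finSumFinEquiv.symm
      finSumFinEquiv.symm).map φ = (Matrix.fromBlocks (e.mat.map φ) 0 0
        (f.mat.map φ)).submatrix finSumFinEquiv.symm finSumFinEquiv.symm := by
    rw [← Matrix.submatrix_map, Matrix.fromBlocks_map, h, h]
  have key : ∀ (n : ℕ) (a b : Matrix (Fin n) (Fin n) S) (ha : a * a = a) (hb : b * b = b),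
      a = b → (⟨n, a, ha⟩ : IdemMat S) = ⟨n, b, hb⟩ := by
    rintro n a b ha hb rfl
    rfl
  exact key _ _ _ _ _ h2

theorem Equivalent.map {e f : IdemMat R} (h : e.Equivalent f) (φ : R →+* S) :
    (e.map φ).Equivalent (f.map φ) := by
  obtain ⟨x, y, hx, hy⟩ := h
  refine ⟨x.map φ, y.map φ, ?_, ?_⟩
  · change x.map φ * y.map φ = e.mat.map φ
    rw [← Matrix.map_mul, hx]
  · change y.map φ * x.map φ = f.mat.map φ
    rw [← Matrix.map_mul, hy]

end IdemMat

section KTheory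

/-- The relations `[e] = [f]` for equivalent idempotents and `[e ⊕ f] = [e] + [f]`. -/
def kRelations (R : Type*) [Ring R] : AddSubgroup (FreeAbelianGroup (IdemMat R)) :=
  AddSubgroup.closure
    ({z | ∃ e f : IdemMat R, e.Equivalent f ∧
        z = FreeAbelianGroup.of e - FreeAbelianGroup.of f} ∪
      {z | ∃ e f : IdemMat R, z = FreeAbelianGroup.of (e.directSum f) -
        (FreeAbelianGroup.of e + FreeAbelianGroup.of f)})

/-- `K_0` of a unital ring: the Grothendieck group of idempotent matrices. -/
abbrev K0Unital (R : Type*) [Ring R] : Type _ := FreeAbelianGroup (IdemMat R) ⧸ kRelations R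

/-- The map induced on `K_0` by a unital ring homomorphism. -/
def K0Unital.map {R S : Type*} [Ring R] [Ring S] (φ : R →+* S) : K0Unital R →+ K0Unital S :=
  QuotientAddGroup.map _ _ (FreeAbelianGroup.map (IdemMat.map φ)) (by
    rw [kRelations, AddSubgroup.closure_le]
    rintro z (⟨e, f, h, rfl⟩ | ⟨e, f, rfl⟩)
    · refine AddSubgroup.subset_closure (Or.inl ⟨e.map φ, f.map φ, h.map φ, ?_⟩)
      rw [map_sub, FreeAbelianGroup.map_of_apply, FreeAbelianGroup.map_of_apply]
    · refine AddSubgroup.subset_closure (Or.inr ⟨e.map φ, f.map φ, ?_⟩)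
      rw [map_sub, map_add, FreeAbelianGroup.map_of_apply, FreeAbelianGroup.map_of_apply,
        FreeAbelianGroup.map_of_apply, IdemMat.map_directSum])

theorem K0Unital.map_map {R S T : Type*} [Ring R] [Ring S] [Ring T] (φ : R →+* S)
    (ψ : S →+* T) (z : K0Unital R) :
    K0Unital.map ψ (K0Unital.map φ z) = K0Unital.map (ψ.comp φ) z := by
  obtain ⟨z, rfl⟩ := QuotientAddGroup.mk_surjective z
  change QuotientAddGroup.mk _ = QuotientAddGroup.mk _
  congr 1
  have h : (FreeAbelianGroup.map (IdemMat.map ψ)).comp (FreeAbelianGroup.map (IdemMat.map φ)) =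
      FreeAbelianGroup.map (IdemMat.map (ψ.comp φ)) := by
    refine FreeAbelianGroup.lift_ext _ _ fun e => ?_
    rfl
  exact DFunLike.congr_fun h z

variable (A : Type*) [NonUnitalRing A] [Module ℂ A] [IsScalarTower ℂ A A] [SMulCommClass ℂ A A]

/-- `K_0` of a possibly non-unital complex algebra `A`: the kernel of the map
`K_0(A⁺) → K_0(ℂ)` induced by the augmentation of the unitization `A⁺ = ℂ ⊕ A`. -/
def K0 : AddSubgroup (K0Unital (Unitization ℂ A)) :=
  (K0Unital.map ((Unitization.fstHom ℂ A : Unitization ℂ A →ₐ[ℂ] ℂ) :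
    Unitization ℂ A →+* ℂ)).ker

variable {A} {A' : Type*} [NonUnitalRing A'] [Module ℂ A'] [IsScalarTower ℂ A' A']
  [SMulCommClass ℂ A' A']

/-- The unital homomorphism between unitizations induced by `φ`. -/
def unitizationMap (φ : A →ₙₐ[ℂ] A') : Unitization ℂ A →ₐ[ℂ] Unitization ℂ A' :=
  NonUnitalAlgHom.toAlgHom ((Unitization.inrNonUnitalAlgHom ℂ A').comp φ)

theorem fst_unitizationMap (φ : A →ₙₐ[ℂ] A') (z : Unitization ℂ A) :
    (unitizationMap φ z).fst = z.fst := by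
  induction z with
  | inl_add_inr c a => simp [unitizationMap, Unitization.algebraMap_eq_inl]

/-- The map induced on `K_0` by a homomorphism of complex algebras. -/
def K0.map (φ : A →ₙₐ[ℂ] A') : K0 A →+ K0 A' :=
  ((K0Unital.map (unitizationMap φ : Unitization ℂ A →+* Unitization ℂ A')).comp
    (K0 A).subtype).codRestrict (K0 A') (by
      rintro ⟨z, hz⟩
      change K0Unital.map _ (K0Unital.map _ z) = 0
      rw [K0Unital.map_map]
      have hz' : K0Unital.map ((Unitization.fstHom ℂ A : Unitization ℂ A →ₐ[ℂ] ℂ) :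
        Unitization ℂ A →+* ℂ) z = 0 := hz
      rw [← hz']
      congr 2
      ext z
      exact fst_unitizationMap φ z)

end KTheory

section HigherKTheory

variable (A : Type*) [NonUnitalNormedRing A] [NormedSpace ℂ A] [IsScalarTower ℂ A A]
  [SMulCommClass ℂ A A]

/-- `K_n(A) = K_0(C_0(ℝⁿ, A))`, the `K_0`-group of the `n`-fold suspension of `A`. -/
abbrev K (n : ℕ) : Type _ := K0 C₀(Fin n → ℝ, A)

variable {A} {A' : Type*} [NonUnitalNormedRing A'] [NormedSpace ℂ A'] [IsScalarTower ℂ A' A']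
  [SMulCommClass ℂ A' A']

/-- The `n`-fold suspension of a continuous homomorphism. -/
def suspensionMap (n : ℕ) (φ : A →ₙₐ[ℂ] A') (hφ : Continuous φ) :
    C₀(Fin n → ℝ, A) →ₙₐ[ℂ] C₀(Fin n → ℝ, A') where
  toFun f :=
    { toFun := fun t => φ (f t)
      continuous_toFun := hφ.comp f.continuous
      zero_at_infty' := by
        have h := (hφ.tendsto 0).comp f.zero_at_infty'
        rwa [map_zero] at h }
  map_smul' c f := by ext t; exact map_smul φ c (f t)
  map_zero' := by ext t; exact map_zero φ
  map_add' f g := by ext t; exact map_add φ (f t) (g t)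
  map_mul' f g := by ext t; exact map_mul φ (f t) (g t)

/-- The map induced on `K_n` by a continuous homomorphism of Banach algebras. -/
def K.map (n : ℕ) (φ : A →ₙₐ[ℂ] A') (hφ : Continuous φ) : K A n →+ K A' n :=
  K0.map (suspensionMap n φ hφ)

end HigherKTheory

/-! ### Regular unconditional semi-norms -/

namespace MonotoneSeminorm

variable {X Y : Type*} [TopologicalSpace X] [TopologicalSpace Y] (N : MonotoneSeminorm Y)

/-- Local `C_0(X)`-convexity of the completion of `C_c(Y)` with respect to the action
`(χφ)(y) = χ(p y) φ(y)` of `C_0(X)`: for `χ₁, χ₂ ≥ 0` with `χ₁ + χ₂ ≤ 1` one has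
`‖χ₁ξ₁ + χ₂ξ₂‖ ≤ max ‖ξ₁‖ ‖ξ₂‖`. -/
def LocallyConvex (p : Y → X) : Prop :=
  ∀ χ₁ χ₂ : C₀(X, ℝ), (∀ x, 0 ≤ χ₁ x) → (∀ x, 0 ≤ χ₂ x) → (∀ x, χ₁ x + χ₂ x ≤ 1) →
    ∀ ξ₁ ξ₂ ζ : C_c(Y, ℂ), (∀ y, ζ y = (χ₁ (p y) : ℂ) * ξ₁ y + (χ₂ (p y) : ℂ) * ξ₂ y) →
      N.toSeminorm ζ ≤ max (N.toSeminorm ξ₁) (N.toSeminorm ξ₂)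

/-- The norm of the fibre over `x` of the completion of `C_c(Y)`, regarded as a field over `X` via
`p`: the quotient norm on functions on `p⁻¹(x)`. -/
def fibreNorm (p : Y → X) (x : X) (f : {y : Y // p y = x} → ℂ) : ℝ :=
  sInf {t | ∃ ξ : C_c(Y, ℂ), (∀ y : {y : Y // p y = x}, ξ y.1 = f y) ∧ t = N.toSeminorm ξ}

end MonotoneSeminorm

namespace UnconditionalSeminorm

variable {X G : Type*} [TopologicalSpace X] [TopologicalSpace G] {𝒢 : TopGroupoid X G}
  [MeasurableSpace G] [BorelSpace G] [T2Space X] [T2Space G] [LocallyCompactSpace G]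
  {μ : 𝒢.HaarSystem}

/-- The pair `(L, R)` of monotone completions of `C_c(G)` is one on which `A` acts:
* the bracket `⟨f, g⟩(x) = ∫ f(γ) g(γ⁻¹) dμ^x(γ)` is contractive,
* `A` acts contractively on `L` from the right and on `R` from the left by convolution,
* `L` is locally `C_0(X)`-convex via `r` and `R` is locally `C_0(X)`-convex via `s`,
* the translations `(γf)(γ') = f(γ⁻¹γ')` from `C_c(G^{s γ})` to `C_c(G^{r γ})` and
  `(γf)(γ') = f(γ'γ)` from `C_c(G_{s γ})` to `C_c(G_{r γ})` are isometric for the fibre norms of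
  `L` and `R`. -/
structure ActsOn (A : UnconditionalSeminorm μ) (L R : MonotoneSeminorm G) : Prop where
  bracket_le : ∀ (f g : C_c(G, ℂ)) (x : X),
    ‖∫ γ : {γ : G // 𝒢.r γ = x}, f γ * g (𝒢.inv γ) ∂(μ.μ x)‖ ≤ L.toSeminorm f * R.toSeminorm g
  conv_le_left : ∀ f χ : C_c(G, ℂ),
    L.toSeminorm (scalarConv μ f χ) ≤ L.toSeminorm f * A.toSeminorm χ
  conv_le_right : ∀ χ f : C_c(G, ℂ),
    R.toSeminorm (scalarConv μ χ f) ≤ A.toSeminorm χ * R.toSeminorm f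
  locallyConvex_left : L.LocallyConvex 𝒢.r
  locallyConvex_right : R.LocallyConvex 𝒢.s
  isometric_left : ∀ (γ : G) (f : C_c({η : G // 𝒢.r η = 𝒢.s γ}, ℂ)),
    L.fibreNorm 𝒢.r (𝒢.r γ) (fun γ' => f (𝒢.leftDiv γ γ')) =
      L.fibreNorm 𝒢.r (𝒢.s γ) (fun γ' => f γ')
  isometric_right : ∀ (γ : G) (f : C_c({η : G // 𝒢.s η = 𝒢.s γ}, ℂ)),
    R.fibreNorm 𝒢.s (𝒢.r γ) (fun γ' => f (𝒢.rightMul γ γ')) =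
      R.fibreNorm 𝒢.s (𝒢.s γ) (fun γ' => f γ')

/-- `A` is regular if it acts on some pair of monotone completions of `C_c(G)`. -/
def IsRegular (A : UnconditionalSeminorm μ) : Prop :=
  ∃ L R : MonotoneSeminorm G, A.ActsOn L R

end UnconditionalSeminorm

/-! ### Push-forward along the anchor map and proper `G`-Banach algebras -/

/-- The sections vanishing at infinity. -/
def BanachField.c0Sections {X : Type*} [TopologicalSpace X] {E : X → Type*}
    [∀ x, NormedAddCommGroup (E x)] [∀ x, NormedSpace ℂ (E x)] (F : BanachField E) :
    Set (∀ x, E x) :=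
  {ξ | ξ ∈ F.sections ∧ ∀ ε > 0, ∃ K : Set X, IsCompact K ∧ ∀ x ∉ K, ‖ξ x‖ ≤ ε}

namespace GBanachAlgebra

section Pushforward

variable {X G Z : Type*} [TopologicalSpace X] [TopologicalSpace G] [TopologicalSpace Z]
  {𝒢 : TopGroupoid X G} {S : 𝒢.Space Z}
  {B : X → Type*} [∀ x, NonUnitalNormedRing (B x)] [∀ x, NormedSpace ℂ (B x)]
  {B' : Z → Type*} [∀ z, NonUnitalNormedRing (B' z)] [∀ z, NormedSpace ℂ (B' z)]

/-- An isomorphism of the `G`-Banach algebra `B` with the push-forward `ρ_*B'` of the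
`G ⋉ Z`-Banach algebra `B'`. The fibre of `ρ_*B'` over `x` is the Banach algebra `Γ_0(Z_x, B')` of
sections vanishing at infinity, with the supremum norm, where `Z_x = ρ⁻¹(x)`; its sections vanishing
at infinity are the maps `x ↦ ξ|_{Z_x}` with `ξ ∈ Γ_0(Z, B')`; and `γ ∈ G` acts by
`(γζ)(z) = (γ, z) ζ(γ⁻¹z)`. -/
structure PushforwardIso (𝓑 : GBanachAlgebra 𝒢 B)
    (𝓑' : GBanachAlgebra S.transformationGroupoid B') where
  toFun : ∀ x, B x →ₙₐ[ℂ] (∀ z : {z : Z // S.ρ z = x}, B' z.1)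
  bound : ℝ
  norm_le : ∀ x (b : B x) z, ‖toFun x b z‖ ≤ bound * ‖b‖
  le_norm : ∀ x (b : B x) (M : ℝ), 0 ≤ M → (∀ z, ‖toFun x b z‖ ≤ M) → ‖b‖ ≤ bound * M
  range_eq : ∀ x, Set.range (toFun x) = {ζ | 𝓑'.IsC0Section Subtype.val ζ}
  sections_iff : ∀ b : ∀ x, B x, b ∈ 𝓑.c0Sections ↔
    ∃ ξ ∈ 𝓑'.c0Sections, ∀ x (z : {z : Z // S.ρ z = x}), toFun x (b x) z = ξ z.1
  equivariant : ∀ (γ : G) (b : B (𝒢.s γ)) (z : Z) (hz : S.ρ z = 𝒢.r γ),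
    toFun (𝒢.r γ) (𝓑.act γ rfl rfl b) ⟨z, hz⟩ =
      𝓑'.act (⟨(γ, z), hz.symm⟩ : S.Arrow) rfl rfl
        (toFun (𝒢.s γ) b ⟨S.smul (𝒢.inv γ) z, S.ρ_inv_smul hz.symm⟩)

end Pushforward

/-- A `G`-Banach algebra is proper if it is isomorphic to `ρ_*B'` for some proper locally compact
Hausdorff `G`-space `Z` with anchor map `ρ` and some `G ⋉ Z`-Banach algebra `B'`. -/
def IsProper {X : Type uX} {G : Type uG} [TopologicalSpace X] [TopologicalSpace G]
    {𝒢 : TopGroupoid X G} {B : X → Type uB} [∀ x, NonUnitalNormedRing (B x)]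
    [∀ x, NormedSpace ℂ (B x)] (𝓑 : GBanachAlgebra 𝒢 B) : Prop :=
  ∃ (Z : Type uZ) (_ : TopologicalSpace Z) (_ : T2Space Z) (_ : LocallyCompactSpace Z)
    (S : 𝒢.Space Z) (_ : S.IsProper)
    (B' : Z → Type uB') (_ : ∀ z, NonUnitalNormedRing (B' z)) (_ : ∀ z, NormedSpace ℂ (B' z))
    (_ : ∀ z, CompleteSpace (B' z)) (_ : ∀ z, IsScalarTower ℂ (B' z) (B' z))
    (_ : ∀ z, SMulCommClass ℂ (B' z) (B' z))
    (𝓑' : GBanachAlgebra S.transformationGroupoid B'), Nonempty (PushforwardIso 𝓑 𝓑')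

end GBanachAlgebra

end ProperBanach

end

open ProperBanach

/-! The whole theorem rests on one estimate. Let `A` be regular. The value at γ of σ * χ * τ is a
bracket of σ * χ with a right translate of τ. By (H1), (H4) and (H2) it is bounded by M‖χ‖_A, where
M depends only on σ and τ (`exists_norm_mul_mul_apply_le`). Thus sandwiching an element between two
fixed sections turns the norm of `A` into a supremum norm.

If, in addition, the supports of all products σ * χ * τ lie in one compact set independent of χ, the
supremum norm controls every unconditional semi-norm `C`, and ‖σ * χ * τ‖_C ≤ const · ‖χ‖_A. For
proper `𝒢` such a compact set exists because r(γ) lies in r(supp σ) and s(γ) in s(supp τ). For B ≅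
ρ_* B' with Z proper, one first cuts σ and τ down to compact subsets M, M' of Z. This leaves a dense
set of sections, and a nonzero value at γ then forces an arrow (γ, z) of 𝒢 ⋉ Z with z in M and γ⁻¹z
in the compact set (supp τ)⁻¹M'.

Hence the comparison map φ : C(𝒢, B) → A(𝒢, B) has dense range, and a dense subspace H of its source
satisfies ‖h d k‖ ≤ C_{h,k}‖φ d‖ (`IsHereditary`). This yields an isomorphism in K-theory by
functional calculus. For h in H the identity hⁿ⁺³ = h hⁿ⁺¹ h makes a power series in h converge in
the source as soon as ‖φ h‖ is small, whatever the norm of h. Explicit geometric and Catalan series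
then correct an approximate idempotent to an idempotent and an approximate equivalence to an
equivalence. So idempotents lift along φ, uniquely up to equivalence. These arguments are made in
the unitization, relative to its augmentation (`IsRelativelySpectral`), because the estimate
concerns only elements without scalar part. They pass to matrices, and the hereditary condition
passes to suspensions, which gives every K_n.

The isomorphism Φ is ψ' ∘ ψ⁻¹ for the supremum of the two semi-norms. Every other `C` factors
through this supremum, which gives compatibility, and surjectivity of ψ gives uniqueness.

For proper `𝒢`, the same estimate makes σ * uₙ * τ converge uniformly with supports in a fixed
compact set whenever uₙ converges in A(𝒢, B), so the limit is again a compactly supported section.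
If ν has norm zero, the estimate gives σ * ν * τ = 0 pointwise. -/

namespace ProperBanach

/-! ### Equivalence of idempotents -/

namespace IdemMat

variable {R S : Type*} [Ring R] [Ring S]

theorem Equivalent.symm {e f : IdemMat R} (h : e.Equivalent f) : f.Equivalent e := by
  obtain ⟨x, y, hx, hy⟩ := h
  exact ⟨y, x, hy, hx⟩

theorem Equivalent.trans {e f g : IdemMat R} (h : e.Equivalent f) (h' : f.Equivalent g) :
    e.Equivalent g := by
  obtain ⟨x, y, hx, hy⟩ := h
  obtain ⟨z, w, hz, hw⟩ := h'
  refine ⟨x * z, w * y, ?_, ?_⟩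
  · calc x * z * (w * y) = x * (z * w) * y := by simp only [Matrix.mul_assoc]
      _ = x * y * (x * y) := by rw [hz, ← hy]; simp only [Matrix.mul_assoc]
      _ = e.mat := by rw [hx, e.idem]
  · calc w * y * (x * z) = w * (y * x) * z := by simp only [Matrix.mul_assoc]
      _ = w * z * (w * z) := by rw [hy, ← hz]; simp only [Matrix.mul_assoc]
      _ = g.mat := by rw [hw, g.idem]

theorem Equivalent.directSum {e f e' f' : IdemMat R} (h : e.Equivalent f)
    (h' : e'.Equivalent f') : (e.directSum e').Equivalent (f.directSum f') := by
  obtain ⟨x, y, hx, hy⟩ := h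
  obtain ⟨z, w, hz, hw⟩ := h'
  refine ⟨(Matrix.fromBlocks x 0 0 z).submatrix finSumFinEquiv.symm finSumFinEquiv.symm,
    (Matrix.fromBlocks y 0 0 w).submatrix finSumFinEquiv.symm finSumFinEquiv.symm, ?_, ?_⟩
  · refine (Matrix.submatrix_mul_equiv _ _ _ _ _).trans ?_
    rw [Matrix.fromBlocks_multiply]
    simp [hx, hz, IdemMat.directSum]
  · refine (Matrix.submatrix_mul_equiv _ _ _ _ _).trans ?_
    rw [Matrix.fromBlocks_multiply]
    simp [hy, hw, IdemMat.directSum]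

/-- Idempotents lift along `φ`, uniquely, up to equivalence. -/
structure LiftsIdempotents (φ : R →+* S) : Prop where
  exists_lift : ∀ e : IdemMat S, ∃ e' : IdemMat R, (e'.map φ).Equivalent e
  reflects : ∀ e f : IdemMat R, (e.map φ).Equivalent (f.map φ) → e.Equivalent f

end IdemMat

/-! ### K₀ as a functor, and a criterion for isomorphism -/

section KTheory

variable {R S : Type*} [Ring R] [Ring S]

/-- The class of an idempotent in `K_0`. -/
noncomputable def K0Unital.mk (e : IdemMat R) : K0Unital R :=
  QuotientAddGroup.mk (FreeAbelianGroup.of e)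

theorem K0Unital.mk_eq {e f : IdemMat R} (h : e.Equivalent f) :
    K0Unital.mk e = K0Unital.mk f := by
  refine QuotientAddGroup.eq_iff_sub_mem.2 (AddSubgroup.subset_closure (Or.inl ⟨e, f, h, rfl⟩))

theorem K0Unital.mk_directSum (e f : IdemMat R) :
    K0Unital.mk (e.directSum f) = K0Unital.mk e + K0Unital.mk f :=
  QuotientAddGroup.eq_iff_sub_mem.2 (AddSubgroup.subset_closure (Or.inr ⟨e, f, rfl⟩))

theorem K0Unital.map_mk (φ : R →+* S) (e : IdemMat R) :
    K0Unital.map φ (K0Unital.mk e) = K0Unital.mk (e.map φ) := by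
  change QuotientAddGroup.mk _ = QuotientAddGroup.mk _
  rw [FreeAbelianGroup.map_of_apply]

theorem K0Unital.hom_ext {M : Type*} [AddCommGroup M] {f g : K0Unital R →+ M}
    (h : ∀ e, f (K0Unital.mk e) = g (K0Unital.mk e)) : f = g := by
  refine QuotientAddGroup.addMonoidHom_ext _ ?_
  exact FreeAbelianGroup.lift_ext _ _ h

/-- The inverse sends the class of an idempotent to the class of a chosen lift. The choice need not
respect sums or equivalences on the nose: any two idempotents with equivalent images are already
equivalent, so both kinds of relations survive. -/
theorem K0Unital.map_bijective {φ : R →+* S} (h : IdemMat.LiftsIdempotents φ) :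
    Function.Bijective (K0Unital.map φ) := by
  choose l hl using h.exists_lift
  let Ψ : K0Unital S →+ K0Unital R := QuotientAddGroup.lift (kRelations S)
    (FreeAbelianGroup.lift fun e => K0Unital.mk (l e)) (by
      rw [kRelations, AddSubgroup.closure_le]
      rintro z (⟨e, f, hef, rfl⟩ | ⟨e, f, rfl⟩)
      · change FreeAbelianGroup.lift _ _ = _
        rw [map_sub, FreeAbelianGroup.lift_apply_of, FreeAbelianGroup.lift_apply_of, sub_eq_zero]
        exact K0Unital.mk_eq (h.reflects _ _ (((hl e).trans hef).trans (hl f).symm))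
      · change FreeAbelianGroup.lift _ _ = _
        rw [map_sub, map_add, FreeAbelianGroup.lift_apply_of, FreeAbelianGroup.lift_apply_of,
          FreeAbelianGroup.lift_apply_of, sub_eq_zero, ← K0Unital.mk_directSum]
        refine K0Unital.mk_eq (h.reflects _ _ ((hl _).trans ?_))
        rw [IdemMat.map_directSum]
        exact ((hl e).directSum (hl f)).symm)
  have hΨ : ∀ e, Ψ (K0Unital.mk e) = K0Unital.mk (l e) := fun e =>
    FreeAbelianGroup.lift_apply_of _ _
  have h1 : Ψ.comp (K0Unital.map φ) = AddMonoidHom.id _ := K0Unital.hom_ext fun e => by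
    rw [AddMonoidHom.comp_apply, K0Unital.map_mk, hΨ]
    exact K0Unital.mk_eq (h.reflects _ _ (hl _))
  have h2 : (K0Unital.map φ).comp Ψ = AddMonoidHom.id _ := K0Unital.hom_ext fun e => by
    rw [AddMonoidHom.comp_apply, hΨ, K0Unital.map_mk]
    exact K0Unital.mk_eq (hl e)
  exact Function.bijective_iff_has_inverse.2
    ⟨Ψ, DFunLike.congr_fun h1, DFunLike.congr_fun h2⟩

variable {A A' A'' : Type*} [NonUnitalRing A] [Module ℂ A] [IsScalarTower ℂ A A]
  [SMulCommClass ℂ A A] [NonUnitalRing A'] [Module ℂ A'] [IsScalarTower ℂ A' A']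
  [SMulCommClass ℂ A' A'] [NonUnitalRing A''] [Module ℂ A''] [IsScalarTower ℂ A'' A'']
  [SMulCommClass ℂ A'' A'']

theorem snd_unitizationMap (φ : A →ₙₐ[ℂ] A') (z : Unitization ℂ A) :
    (unitizationMap φ z).snd = φ z.snd := by
  induction z with
  | inl_add_inr c a => simp [unitizationMap, Unitization.algebraMap_eq_inl]

/-- The map of unitizations preserves augmentations, so the bijection between the unital groups
matches the two kernels. -/
theorem K0.map_bijective {φ : A →ₙₐ[ℂ] A'}
    (h : IdemMat.LiftsIdempotents
      (unitizationMap φ : Unitization ℂ A →+* Unitization ℂ A')) :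
    Function.Bijective (K0.map φ) := by
  have hb := K0Unital.map_bijective h
  refine ⟨fun z w hzw => Subtype.ext (hb.1 (congrArg Subtype.val hzw)), ?_⟩
  rintro ⟨z, hz⟩
  obtain ⟨w, rfl⟩ := hb.2 z
  refine ⟨⟨w, ?_⟩, rfl⟩
  have hz' : K0Unital.map ((Unitization.fstHom ℂ A' : Unitization ℂ A' →ₐ[ℂ] ℂ) :
    Unitization ℂ A' →+* ℂ) (K0Unital.map _ w) = 0 := hz
  rw [K0Unital.map_map] at hz'
  change K0Unital.map _ w = 0
  rw [← hz']
  congr 2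
  ext z
  exact (fst_unitizationMap φ z).symm

theorem K0.map_map (φ : A →ₙₐ[ℂ] A') (ψ : A' →ₙₐ[ℂ] A'') (z : K0 A) :
    K0.map ψ (K0.map φ z) = K0.map (ψ.comp φ) z := by
  apply Subtype.ext
  change K0Unital.map _ (K0Unital.map _ z.1) = K0Unital.map _ z.1
  rw [K0Unital.map_map]
  congr 2
  refine RingHom.ext fun z => Unitization.ext ?_ ?_
  · exact (fst_unitizationMap ψ _).trans ((fst_unitizationMap φ z).trans
      (fst_unitizationMap (ψ.comp φ) z).symm)
  · refine (snd_unitizationMap ψ _).trans ((congrArg ψ (snd_unitizationMap φ z)).trans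
      (snd_unitizationMap (ψ.comp φ) z).symm)

end KTheory

/-! ### Relatively spectral homomorphisms -/

/-- A homomorphism `φ : R → S` of normed rings over `Λ` together with a subring `X` of `R` whose
image is dense in `S`, relative to `Λ`, and such that the elements of the kernel `X₀` of `X → Λ`
satisfy `‖h r k‖ ≤ C ‖φ r‖`. -/
structure IsRelativelySpectral {R S Λ : Type*} [NormedRing R] [NormedRing S] [Ring Λ]
    (φ : R →+* S) (p : S →+* Λ) (X : Subring R) : Prop where
  exists_approx : ∀ s, ∀ ε > 0, ∃ x ∈ X, p (φ x) = p s ∧ ‖φ x - s‖ < ε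
  mul_mul_mem : ∀ h ∈ X, ∀ k ∈ X, ∀ r, p (φ h) = 0 → p (φ k) = 0 → p (φ r) = 0 → h * r * k ∈ X
  bound : ∀ h ∈ X, ∀ k ∈ X, p (φ h) = 0 → p (φ k) = 0 →
    ∃ C, ∀ r, p (φ r) = 0 → ‖h * r * k‖ ≤ C * ‖φ r‖

/-- Equivalence of idempotents of a ring. -/
def RingEquivalent {R : Type*} [Mul R] (e f : R) : Prop := ∃ x y, x * y = e ∧ y * x = f

theorem RingEquivalent.symm {R : Type*} [Mul R] {e f : R} (h : RingEquivalent e f) :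
    RingEquivalent f e := by
  obtain ⟨x, y, hx, hy⟩ := h
  exact ⟨y, x, hy, hx⟩

theorem RingEquivalent.trans {R : Type*} [Ring R] {e f g : R} (he : e * e = e) (hg : g * g = g)
    (h : RingEquivalent e f) (h' : RingEquivalent f g) : RingEquivalent e g := by
  obtain ⟨x, y, hx, hy⟩ := h
  obtain ⟨z, w, hz, hw⟩ := h'
  refine ⟨x * z, w * y, ?_, ?_⟩
  · calc x * z * (w * y) = x * (z * w) * y := by simp only [mul_assoc]
      _ = x * y * (x * y) := by rw [hz, ← hy]; simp only [mul_assoc]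
      _ = e := by rw [hx, he]
  · calc w * y * (x * z) = w * (y * x) * z := by simp only [mul_assoc]
      _ = w * z * (w * z) := by rw [hy, ← hz]; simp only [mul_assoc]
      _ = g := by rw [hw, hg]

theorem RingEquivalent.map {R S : Type*} [Ring R] [Ring S] {e f : R} (h : RingEquivalent e f)
    (φ : R →+* S) : RingEquivalent (φ e) (φ f) := by
  obtain ⟨x, y, hx, hy⟩ := h
  exact ⟨φ x, φ y, by rw [← map_mul, hx], by rw [← map_mul, hy]⟩

/-- The element w = ef + (1 - e)(1 - f) equals 1 at f = e, hence is invertible for f near e. It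
intertwines the idempotents, ew = ef = wf, so ew and w⁻¹e implement the equivalence. -/
theorem eventually_ringEquivalent {R : Type*} [NormedRing R] [CompleteSpace R] {e : R}
    (he : e * e = e) : ∀ᶠ f in 𝓝 e, f * f = f → RingEquivalent e f := by
  have hc : Continuous fun f : R => e * f + (1 - e) * (1 - f) := by fun_prop
  have h1 : e * e + (1 - e) * (1 - e) = 1 := by
    rw [mul_sub, sub_mul, sub_mul, he]; simp
  have hU : {w : R | IsUnit w} ∈ 𝓝 (e * e + (1 - e) * (1 - e)) := by
    rw [h1]
    exact Units.isOpen.mem_nhds isUnit_one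
  filter_upwards [hc.continuousAt.eventually hU] with f hf hff
  obtain ⟨w, hw⟩ := hf
  have hew : e * w = e * f := by
    rw [hw, mul_add, ← mul_assoc, ← mul_assoc, he, mul_sub e, he]; simp
  have hwf : (w : R) * f = e * f := by
    rw [hw, add_mul, mul_assoc, mul_assoc, hff, sub_mul 1 f f, hff]; simp
  refine ⟨e * w, ↑w⁻¹ * e, ?_, ?_⟩
  · rw [mul_assoc, Units.mul_inv_cancel_left, he]
  · rw [mul_assoc, ← mul_assoc e e, he, hew, ← hwf, Units.inv_mul_cancel_left]

namespace IsRelativelySpectral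

variable {R S Λ : Type*} [NormedRing R] [NormedRing S] [Ring Λ] [CompleteSpace R]
  {φ : R →+* S} {p : S →+* Λ} {X : Subring R}

/-- Only φ h is small, not h itself. Writing hⁿ⁺³ = h · hⁿ⁺¹ · h transfers the decay of φ(h)ⁿ⁺¹ to
the norm of `R`. With ratio 1/8 against coefficients of growth 4ⁿ, the terms decay like 2⁻ⁿ. Both
series used below, geometric in -4y and Catalan, have such coefficients. -/
theorem summable_smul_pow (H : IsRelativelySpectral φ p X) {h : R} (hX : h ∈ X)
    (h0 : p (φ h) = 0) (hq : ‖φ h‖ ≤ 1 / 8) {c : ℕ → ℕ} {M : ℕ} (hc : ∀ n, c n ≤ M * 4 ^ n) :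
    Summable fun n => ‖c n • h ^ n‖ := by
  obtain ⟨C, hC⟩ := H.bound h hX h hX h0 h0
  rw [← summable_nat_add_iff 3]
  -- The middle power is kept positive so that `p ∘ φ` kills it and so that its norm is
  -- submultiplicative; the norm of 1 need not be 1.
  have hC0 : ∀ n : ℕ, ‖h ^ (n + 3)‖ ≤ |C| * (1 / 8) ^ (n + 1) := fun n => by
    have h1 : h ^ (n + 3) = h * h ^ (n + 1) * h := by
      rw [← pow_succ', ← pow_succ]
    rw [h1]
    refine (hC _ ?_).trans ?_
    · rw [map_pow, map_pow, h0, zero_pow (Nat.succ_ne_zero n)]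
    · rw [map_pow]
      have h2 : ‖φ h ^ (n + 1)‖ ≤ (1 / 8) ^ (n + 1) :=
        (norm_pow_le' _ n.succ_pos).trans (pow_le_pow_left₀ (norm_nonneg _) hq _)
      exact mul_le_mul (le_abs_self C) h2 (norm_nonneg _) (abs_nonneg C)
  refine Summable.of_nonneg_of_le (fun _ => norm_nonneg _) (fun n => ?_)
    ((summable_geometric_of_lt_one (by norm_num) (by norm_num : (1 / 2 : ℝ) < 1)).mul_left
      (8 * M * |C|))
  calc ‖c (n + 3) • h ^ (n + 3)‖ ≤ c (n + 3) * ‖h ^ (n + 3)‖ := norm_nsmul_le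
    _ ≤ (M * 4 ^ (n + 3)) * (|C| * (1 / 8) ^ (n + 1)) := by
        refine mul_le_mul (by exact_mod_cast hc (n + 3)) (hC0 n) (norm_nonneg _) (by positivity)
    _ = 8 * M * |C| * (1 / 2) ^ n := by
        have : (1 / 2 : ℝ) ^ n = 4 ^ n * (1 / 8) ^ n := by rw [← mul_pow]; norm_num
        rw [this]; ring

/-- The subring `X` need not be closed, so convergence alone would not suffice. The tail from degree
3 on has the form h · r · h with r in the kernel of `p ∘ φ`, and such products lie in `X` for every
r in `R`. -/
theorem tsum_mem (H : IsRelativelySpectral φ p X) {h : R} (hX : h ∈ X)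
    (h0 : p (φ h) = 0) (hq : ‖φ h‖ ≤ 1 / 8) {c : ℕ → ℕ} (hc : ∀ n, c n ≤ 4 ^ n) :
    ∑' n, c n • h ^ n ∈ X := by
  have hs := (H.summable_smul_pow hX h0 hq (M := 1) fun n => by simpa using hc n).of_norm
  have hs3 : Summable fun n => c (n + 3) • h ^ n :=
    (H.summable_smul_pow hX h0 hq (M := 64) fun n => by
      have := hc (n + 3); rw [pow_add] at this; omega).of_norm
  rw [← hs.sum_add_tsum_nat_add 3]
  refine X.add_mem (X.sum_mem fun n _ => X.nsmul_mem (X.pow_mem hX n) _) ?_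
  have e : ∑' n, c (n + 3) • h ^ (n + 3) = h * (h * ∑' n, c (n + 3) • h ^ n) * h := by
    rw [← hs3.tsum_mul_left, ← (hs3.mul_left h).tsum_mul_left,
      ← ((hs3.mul_left h).mul_left h).tsum_mul_right]
    refine tsum_congr fun n => ?_
    rw [mul_smul_comm, mul_smul_comm, smul_mul_assoc, ← pow_succ', ← pow_succ', ← pow_succ]
  rw [e]
  refine H.mul_mul_mem h hX h hX _ h0 h0 ?_
  rw [map_mul, map_mul, h0, zero_mul]

/-- The estimate is made in `S`, where φ h is small. It therefore does not involve the constant from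
`bound`, which depends on h and is not controlled when h varies. The norm of 1 enters through the
term of degree 0. -/
theorem norm_tsum_le (H : IsRelativelySpectral φ p X) (hφ : Continuous φ) {h : R} (hX : h ∈ X)
    (h0 : p (φ h) = 0) (hq : ‖φ h‖ ≤ 1 / 8) {c : ℕ → ℕ} (hc : ∀ n, c n ≤ 4 ^ n) :
    ‖φ (∑' n, c n • h ^ n)‖ ≤ (‖(1 : S)‖ + 1) * 2 := by
  have hs := (H.summable_smul_pow hX h0 hq (M := 1) fun n => by simpa using hc n).of_norm
  have h1 : HasSum (fun n => φ (c n • h ^ n)) (φ (∑' n, c n • h ^ n)) :=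
    hs.hasSum.map φ hφ
  rw [← h1.tsum_eq]
  refine tsum_of_norm_bounded (hasSum_geometric_two.mul_left (‖(1 : S)‖ + 1)) fun n => ?_
  have h2 : ‖φ h ^ n‖ ≤ (‖(1 : S)‖ + 1) * (1 / 8) ^ n := by
    rcases n.eq_zero_or_pos with rfl | hn
    · simp
    · refine (norm_pow_le' _ hn).trans ((pow_le_pow_left₀ (norm_nonneg _) hq _).trans ?_)
      exact le_mul_of_one_le_left (by positivity) (by linarith [norm_nonneg (1 : S)])
  rw [map_nsmul, map_pow]
  calc ‖c n • φ h ^ n‖ ≤ c n * ‖φ h ^ n‖ := norm_nsmul_le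
    _ ≤ 4 ^ n * ((‖(1 : S)‖ + 1) * (1 / 8) ^ n) :=
        mul_le_mul (by exact_mod_cast hc n) h2 (norm_nonneg _) (by positivity)
    _ = (‖(1 : S)‖ + 1) * (1 / 2) ^ n := by
        have : (1 / 2 : ℝ) ^ n = 4 ^ n * (1 / 8) ^ n := by rw [← mul_pow]; norm_num
        rw [this]; ring

/-- The geometric series. -/
theorem isUnit_one_sub (H : IsRelativelySpectral φ p X) {h : R} (hX : h ∈ X)
    (h0 : p (φ h) = 0) (hq : ‖φ h‖ ≤ 1 / 8) : IsUnit (1 - h) := by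
  have hs : Summable fun n => h ^ n := by
    simpa using (H.summable_smul_pow hX h0 hq (c := fun _ => 1) (M := 1) fun n => by
      simpa using Nat.one_le_pow _ _ (by norm_num)).of_norm
  exact ⟨⟨1 - h, ∑' n, h ^ n, hs.one_sub_mul_tsum_pow, hs.tsum_pow_mul_one_sub⟩, rfl⟩

/-- The generating series W of the Catalan numbers satisfies W = 1 + vW², so w = vW solves w - w² =
v. The Catalan numbers are at most 4ⁿ, which is the growth allowed above. As a power series in v, w
commutes with everything that commutes with v. -/
theorem exists_sub_sq_eq (H : IsRelativelySpectral φ p X) (hφ : Continuous φ) {v : R}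
    (hX : v ∈ X) (h0 : p (φ v) = 0) (hq : ‖φ v‖ ≤ 1 / 8) :
    ∃ w ∈ X, w - w * w = v ∧ p (φ w) = 0 ∧ ‖φ w‖ ≤ ‖φ v‖ * ((‖(1 : S)‖ + 1) * 2) ∧
      ∀ z, Commute z v → Commute z w := by
  have hc : ∀ n, catalan n ≤ 4 ^ n := fun n => by
    rw [catalan_eq_centralBinom_div]
    exact (Nat.div_le_self _ _).trans (Nat.centralBinom_le_four_pow n)
  have hn := H.summable_smul_pow hX h0 hq (M := 1) fun n => by simpa using hc n
  have hs := hn.of_norm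
  set W := ∑' n, catalan n • v ^ n with hW
  have hW1 : W = 1 + v * (W * W) := by
    have e1 : W * W = ∑' n, ∑ ij ∈ Finset.HasAntidiagonal.antidiagonal n,
        (catalan ij.1 • v ^ ij.1) * (catalan ij.2 • v ^ ij.2) :=
      tsum_mul_tsum_eq_tsum_sum_antidiagonal_of_summable_norm hn hn
    have e2 : ∀ n, ∑ ij ∈ Finset.HasAntidiagonal.antidiagonal n,
        (catalan ij.1 • v ^ ij.1) * (catalan ij.2 • v ^ ij.2) = catalan (n + 1) • v ^ n := by
      intro n
      rw [catalan_succ', Finset.sum_smul]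
      refine Finset.sum_congr rfl fun ij hij => ?_
      rw [smul_mul_smul_comm, ← pow_add, Finset.HasAntidiagonal.mem_antidiagonal.1 hij]
    have hs1 : Summable fun n => catalan (n + 1) • v ^ n :=
      (H.summable_smul_pow hX h0 hq (M := 4) fun n => by
        have := hc (n + 1); rw [pow_succ] at this; omega).of_norm
    rw [e1, tsum_congr e2, ← hs1.tsum_mul_left, hW, hs.tsum_eq_zero_add]
    simp only [catalan_zero, pow_zero, one_smul, mul_smul_comm, pow_succ']
  have hcomm : ∀ z, Commute z v → Commute z W := fun z hz =>
    Commute.tsum_right _ fun n => (hz.pow_right n).smul_right _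
  have hvW : Commute W v := (hcomm v (Commute.refl v)).symm
  refine ⟨v * W, X.mul_mem hX (H.tsum_mem hX h0 hq hc), ?_, ?_, ?_, ?_⟩
  · have : v * W * (v * W) = v * (v * (W * W)) := by
      rw [mul_assoc, ← mul_assoc W, hvW.eq, mul_assoc v W W]
    rw [this]
    nth_rewrite 1 [hW1]
    rw [mul_add, mul_one, add_sub_cancel_right]
  · rw [map_mul, map_mul, h0, zero_mul]
  · rw [map_mul]
    exact (norm_mul_le _ _).trans
      (mul_le_mul_of_nonneg_left (H.norm_tsum_le hφ hX h0 hq hc) (norm_nonneg _))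
  · exact fun z hz => hz.mul_right (hcomm z hz)

/-- Start from x in `X` with φ x near e and with the exact image of e in `Λ`; then y = x² - x is
small in `S` and has no component in `Λ`. Put f = x + (1 - 2x)w with w commuting with x. Since (1 -
2x)² = 1 + 4y, one has f² - f = y - (1 + 4y)(w - w²), so f is idempotent once w - w² = y(1 + 4y)⁻¹.
-/
theorem exists_idempotent (H : IsRelativelySpectral φ p X) (hφ : Continuous φ) {e : S}
    (he : e * e = e) {ε : ℝ} (hε : 0 < ε) :
    ∃ f ∈ X, f * f = f ∧ ‖φ f - e‖ < ε := by
  set K := (‖(1 : S)‖ + 1) * 2 with hK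
  have hK2 : 2 ≤ K := by have := norm_nonneg (1 : S); linarith
  have hc1 : Continuous fun s : S => 4 * ‖s * s - s‖ * K := by fun_prop
  have hc2 : Continuous fun s : S =>
      ‖s - e‖ + ‖1 - s - s‖ * (‖s * s - s‖ * K * K) := by fun_prop
  -- The constant `K` bounds the images of both series. The first inequality brings y and y(1 +
  -- 4y)⁻¹ below the radius 1/8; the second is the final error, with one factor `K` for the inverse
  -- of 1 + 4y and one for the Catalan series.
  have ev : ∀ᶠ s in 𝓝 e, 4 * ‖s * s - s‖ * K < 1 / 8 ∧
      ‖s - e‖ + ‖1 - s - s‖ * (‖s * s - s‖ * K * K) < ε := by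
    refine (hc1.continuousAt.eventually (gt_mem_nhds ?_)).and
      (hc2.continuousAt.eventually (gt_mem_nhds ?_))
    · simp [he]
    · simpa [he] using hε
  obtain ⟨δ, hδ, hev⟩ := Metric.eventually_nhds_iff.1 ev
  obtain ⟨x, hx, hpx, hxe⟩ := H.exists_approx e δ hδ
  obtain ⟨hq1, hq2⟩ := hev (by rwa [dist_eq_norm])
  set y := x * x - x with hy
  have hyX : y ∈ X := X.sub_mem (X.mul_mem hx hx) hx
  have hφy : φ y = φ x * φ x - φ x := by rw [hy, map_sub, map_mul]
  have hy0 : p (φ y) = 0 := by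
    rw [hφy, map_sub, map_mul, hpx, ← map_mul, he, sub_self]
  rw [← hφy] at hq1 hq2
  have hyn : ‖φ y‖ ≤ 1 / 8 := by nlinarith [norm_nonneg (φ y)]
  have hny : -y ∈ X := X.neg_mem hyX
  have hny0 : p (φ (-y)) = 0 := by rw [map_neg, map_neg, hy0, neg_zero]
  have hnyn : ‖φ (-y)‖ ≤ 1 / 8 := by rwa [map_neg, norm_neg]
  -- the inverse of `1 + 4 y`
  set g := ∑' n, (4 ^ n : ℕ) • (-y) ^ n with hg
  have hgX : g ∈ X := H.tsum_mem hny hny0 hnyn fun _ => le_rfl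
  have hgn : ‖φ g‖ ≤ K := H.norm_tsum_le hφ hny hny0 hnyn fun _ => le_rfl
  have hgs := (H.summable_smul_pow hny hny0 hnyn (c := fun n => 4 ^ n) (M := 1)
    fun n => by simp).of_norm
  have hgc : ∀ z, Commute z y → Commute z g := fun z hz =>
    Commute.tsum_right _ fun n => (hz.neg_right.pow_right n).smul_right _
  have hg1 : g + 4 * (y * g) = 1 := by
    have h1 : ∀ n, (4 ^ n : ℕ) • (-y) ^ n = (-(4 * y)) ^ n := fun n => by
      rw [nsmul_eq_mul, Nat.cast_pow, ← (Nat.cast_commute 4 (-y)).mul_pow]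
      simp
    have hgs' : Summable fun n => (-(4 * y)) ^ n := hgs.congr h1
    have := hgs'.one_sub_mul_tsum_pow
    rw [← tsum_congr h1, ← hg, sub_neg_eq_add, add_mul, one_mul, mul_assoc] at this
    exact this
  obtain ⟨w, hwX, hw, hw0, hwn, hwc⟩ := H.exists_sub_sq_eq hφ (v := y * g)
    (X.mul_mem hyX hgX) (by rw [map_mul, map_mul, hy0, zero_mul]) (by
      rw [map_mul]
      refine (norm_mul_le _ _).trans ?_
      nlinarith [norm_nonneg (φ y), norm_nonneg (φ g)])
  have hxy : Commute x y := by
    rw [hy]; exact (((Commute.refl x).mul_right (Commute.refl x)).sub_right (Commute.refl x))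
  have hxw : Commute x w := hwc x (hxy.mul_right (hgc x hxy))
  refine ⟨x + (1 - x - x) * w, X.add_mem hx (X.mul_mem (X.sub_mem (X.sub_mem X.one_mem hx) hx)
    hwX), ?_, ?_⟩
  -- This is the equation to which f² = f reduces; the remaining lines are the noncommutative
  -- expansion, using that w commutes with x.
  · have e1 : y = (1 + 4 * y) * (w - w * w) := by
      rw [hw]
      have : (1 + 4 * y) * (y * g) = y * (g + 4 * (y * g)) := by noncomm_ring
      rw [this, hg1, mul_one]
    have e2 : w * (1 - x - x) = (1 - x - x) * w :=
      (((Commute.one_left w).sub_left hxw).sub_left hxw).eq.symm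
    have e3 : (x + (1 - x - x) * w) * (x + (1 - x - x) * w) =
        x * x + x * (1 - x - x) * w + (1 - x - x) * (w * x) +
          (1 - x - x) * (w * (1 - x - x)) * w := by noncomm_ring
    rw [e2, hxw.symm.eq] at e3
    rw [e3, ← sub_eq_zero]
    rw [← sub_eq_zero, hy] at e1
    rw [← e1]
    noncomm_ring
  · have : φ (x + (1 - x - x) * w) - e = (φ x - e) + (1 - φ x - φ x) * φ w := by
      rw [map_add, map_mul, map_sub, map_sub, map_one]; abel
    rw [this]
    refine lt_of_le_of_lt ((norm_add_le _ _).trans (add_le_add le_rfl ((norm_mul_le _ _).trans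
      (mul_le_mul_of_nonneg_left ?_ (norm_nonneg _))))) hq2
    refine hwn.trans (mul_le_mul_of_nonneg_right ?_ (by linarith))
    rw [map_mul]
    exact (norm_mul_le _ _).trans (mul_le_mul_of_nonneg_left hgn (norm_nonneg _))

/-- Replace the matrices of the equivalence in `S` by elements s, t of `X`, and put P = esf, Q =
fte. Then e - PQ and f - QP lie in `X`, are killed by `p ∘ φ` and are small in `S`, so a = 1 - (e -
PQ) and b = 1 - (f - QP) are invertible in `R`. Since PQ = ea and QP = fb, the pair P, Qa⁻¹ is an
equivalence. -/
theorem ringEquivalent_of_map (H : IsRelativelySpectral φ p X) {e f : R}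
    (he : e * e = e) (hf : f * f = f) (heX : e ∈ X) (hfX : f ∈ X)
    (h : RingEquivalent (φ e) (φ f)) : RingEquivalent e f := by
  obtain ⟨x, y, hxy, hyx⟩ := h
  have he' : φ e * φ e = φ e := by rw [← map_mul, he]
  have hf' : φ f * φ f = φ f := by rw [← map_mul, hf]
  -- These identities say that the defects e - esfte and f - ftesf vanish when s, t are replaced by
  -- x, y. Since s and t have the same images in `Λ` as x and y, the defects also have image zero in
  -- `Λ`.
  have id1 : φ e * x * φ f * y * φ e = φ e := by
    have : φ e * x * φ f * y * φ e = φ e * (x * y) * (x * y) * φ e := by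
      rw [← hyx]; simp only [mul_assoc]
    rw [this, hxy, he', he', he']
  have id2 : φ f * y * φ e * x * φ f = φ f := by
    have : φ f * y * φ e * x * φ f = φ f * (y * x) * (y * x) * φ f := by
      rw [← hxy]; simp only [mul_assoc]
    rw [this, hyx, hf', hf', hf']
  have hc1 : Continuous fun q : S × S => ‖φ e - φ e * q.1 * φ f * q.2 * φ e‖ := by fun_prop
  have hc2 : Continuous fun q : S × S => ‖φ f - φ f * q.2 * φ e * q.1 * φ f‖ := by fun_prop
  have ev : ∀ᶠ q in 𝓝 (x, y), ‖φ e - φ e * q.1 * φ f * q.2 * φ e‖ < 1 / 8 ∧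
      ‖φ f - φ f * q.2 * φ e * q.1 * φ f‖ < 1 / 8 := by
    refine (hc1.continuousAt.eventually (gt_mem_nhds ?_)).and
      (hc2.continuousAt.eventually (gt_mem_nhds ?_))
    · change ‖φ e - φ e * x * φ f * y * φ e‖ < 1 / 8
      rw [id1]; simp
    · change ‖φ f - φ f * y * φ e * x * φ f‖ < 1 / 8
      rw [id2]; simp
  obtain ⟨δ, hδ, hev⟩ := Metric.eventually_nhds_iff.1 ev
  obtain ⟨s, hs, hps, hsx⟩ := H.exists_approx x δ hδ
  obtain ⟨t, ht, hpt, hty⟩ := H.exists_approx y δ hδ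
  obtain ⟨h1, h2⟩ := hev (y := (φ s, φ t)) (by
    rw [Prod.dist_eq, max_lt_iff, dist_eq_norm, dist_eq_norm]; exact ⟨hsx, hty⟩)
  obtain ⟨a, ha⟩ := H.isUnit_one_sub (h := e - e * s * f * t * e)
    (X.sub_mem heX (X.mul_mem (X.mul_mem (X.mul_mem (X.mul_mem heX hs) hfX) ht) heX))
    (by simp only [map_sub, map_mul, hps, hpt, sub_eq_zero]; simp only [← map_mul, id1])
    (by simpa only [map_sub, map_mul] using h1.le)
  obtain ⟨b, hb⟩ := H.isUnit_one_sub (h := f - f * t * e * s * f)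
    (X.sub_mem hfX (X.mul_mem (X.mul_mem (X.mul_mem (X.mul_mem hfX ht) heX) hs) hfX))
    (by simp only [map_sub, map_mul, hps, hpt, sub_eq_zero]; simp only [← map_mul, id2])
    (by simpa only [map_sub, map_mul] using h2.le)
  set P := e * s * f with hP
  set Q := f * t * e with hQ
  have hPe : e * P = P := by simp only [hP, ← mul_assoc, he]
  have hfQ : f * Q = Q := by simp only [hQ, ← mul_assoc, hf]
  have hPf : P * f = P := by simp only [hP, mul_assoc, hf]
  have hQe : Q * e = Q := by simp only [hQ, mul_assoc, he]
  have hPte : P * t * e = P * Q := by rw [hQ, ← mul_assoc, ← mul_assoc, hPf]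
  have hQsf : Q * s * f = Q * P := by rw [hP, ← mul_assoc, ← mul_assoc, hQe]
  rw [hPte] at ha
  rw [hQsf] at hb
  have hePQ : P * Q = e * a := by
    rw [ha, mul_sub, mul_sub, mul_one, he, ← mul_assoc e P Q, hPe, sub_sub_cancel]
  have hae : (a : R) * e = e * a := by
    rw [← hePQ, ha, sub_mul, sub_mul, he, one_mul, sub_sub_cancel, mul_assoc, hQe]
  have hQP : Q * P = f * b := by
    rw [hb, mul_sub, mul_sub, mul_one, hf, ← mul_assoc f Q P, hfQ, sub_sub_cancel]
  have hae' : (↑a⁻¹ : R) * e = e * ↑a⁻¹ := by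
    rw [Units.inv_mul_eq_iff_eq_mul, ← mul_assoc, hae, Units.mul_inv_cancel_right]
  refine ⟨P, Q * ↑a⁻¹, ?_, ?_⟩
  · rw [← mul_assoc, hePQ, Units.mul_inv_cancel_right]
  -- The other product is checked after multiplication by fb = QP, where PQ = ea absorbs a⁻¹; then b
  -- is cancelled.
  · have k1 : Q * ↑a⁻¹ * P * (f * b) = f * b := by
      rw [← hQP]
      calc Q * ↑a⁻¹ * P * (Q * P) = Q * ↑a⁻¹ * (P * Q) * P := by simp only [mul_assoc]
        _ = Q * (↑a⁻¹ * e) * (a * P) := by rw [hePQ]; simp only [mul_assoc]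
        _ = Q * P := by
          rw [hae', mul_assoc, mul_assoc e, Units.inv_mul_cancel_left, hPe]
    have k2 : Q * ↑a⁻¹ * P * f = f := by
      rw [← mul_assoc] at k1
      exact b.isUnit.mul_right_cancel k1
    rwa [mul_assoc, hPf] at k2

/-- Idempotents outside `X` are first moved into `X` inside `R`: the approximation result for the
identity of `R` supplies idempotents of `X` arbitrarily near, and near idempotents are equivalent.
-/
theorem ringEquivalent_of_map' [CompleteSpace S] (H : IsRelativelySpectral φ p X)
    (H' : IsRelativelySpectral (RingHom.id R) (p.comp φ) X) {e f : R}
    (he : e * e = e) (hf : f * f = f) (h : RingEquivalent (φ e) (φ f)) :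
    RingEquivalent e f := by
  obtain ⟨δ, hδ, h1⟩ := Metric.eventually_nhds_iff.1 (eventually_ringEquivalent he)
  obtain ⟨δ', hδ', h2⟩ := Metric.eventually_nhds_iff.1 (eventually_ringEquivalent hf)
  obtain ⟨e', heX, he', hee⟩ := H'.exists_idempotent continuous_id he hδ
  obtain ⟨f', hfX, hf', hff⟩ := H'.exists_idempotent continuous_id hf hδ'
  have h1 := h1 (y := e') (by rwa [dist_eq_norm]) he'
  have h2 := h2 (y := f') (by rwa [dist_eq_norm]) hf'
  have m : ∀ {a : R}, a * a = a → φ a * φ a = φ a := fun h => by rw [← map_mul, h]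
  have h3 : RingEquivalent e' f' := H.ringEquivalent_of_map he' hf' heX hfX
    (((h1.map φ).symm.trans (m he') (m hf) h).trans (m he') (m hf') (h2.map φ))
  exact (h1.trans he hf' h3).trans he hf h2.symm

theorem exists_lift [CompleteSpace S] (H : IsRelativelySpectral φ p X) (hφ : Continuous φ) {e : S}
    (he : e * e = e) : ∃ f : R, f * f = f ∧ RingEquivalent (φ f) e := by
  obtain ⟨δ, hδ, h1⟩ := Metric.eventually_nhds_iff.1 (eventually_ringEquivalent he)
  obtain ⟨f, -, hf, hfe⟩ := H.exists_idempotent hφ he hδ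
  exact ⟨f, hf, (h1 (by rwa [dist_eq_norm]) (by rw [← map_mul, hf])).symm⟩

end IsRelativelySpectral

/-! ### Matrices over relatively spectral homomorphisms -/

section Matrix

attribute [local instance] Matrix.linftyOpNormedRing

variable {ι : Type*} [Fintype ι] [DecidableEq ι] {R S Λ : Type*} [NormedRing R] [NormedRing S]
  [Ring Λ]

theorem norm_entry_le (M : Matrix ι ι R) (i j : ι) : ‖M i j‖ ≤ ‖M‖ := by
  rw [← coe_nnnorm, ← coe_nnnorm, NNReal.coe_le_coe, Matrix.linfty_opNNNorm_def]
  exact (Finset.single_le_sum (f := fun j => ‖M i j‖₊) (fun _ _ => zero_le) (Finset.mem_univ j)).trans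
    (Finset.le_sup (f := fun i => ∑ j, ‖M i j‖₊) (Finset.mem_univ i))

theorem norm_le_sum_entries (M : Matrix ι ι R) : ‖M‖ ≤ ∑ i, ∑ j, ‖M i j‖ := by
  have h : ‖M‖₊ ≤ ∑ i, ∑ j, ‖M i j‖₊ := by
    rw [Matrix.linfty_opNNNorm_def]
    exact Finset.sup_le fun i hi =>
      Finset.single_le_sum (f := fun i => ∑ j, ‖M i j‖₊) (fun _ _ => zero_le) hi
  simpa using NNReal.coe_le_coe.2 h

theorem continuous_mapMatrix {φ : R →+* S} (hφ : Continuous φ) :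
    Continuous (φ.mapMatrix : Matrix ι ι R →+* Matrix ι ι S) := by
  have h : Continuous fun M : ι → ι → R => fun i j => φ (M i j) := by fun_prop
  exact h

theorem completeSpace_matrix [CompleteSpace R] : @CompleteSpace (Matrix ι ι R)
    (Matrix.linftyOpNormedRing (n := ι) (α := R)).toMetricSpace.toUniformSpace :=
  inferInstanceAs (CompleteSpace (ι → ι → R))

/-- Each entry of h r k is a finite sum of products of single entries, so the conditions hold
entrywise and the constants add up. -/
theorem IsRelativelySpectral.mapMatrix {φ : R →+* S} {p : S →+* Λ} {X : Subring R}
    (H : IsRelativelySpectral φ p X) :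
    IsRelativelySpectral (φ.mapMatrix : Matrix ι ι R →+* Matrix ι ι S)
      (p.mapMatrix : Matrix ι ι S →+* Matrix ι ι Λ) X.matrix where
  exists_approx s ε hε := by
    choose x hx hpx hxs using fun i j : ι => H.exists_approx (s i j)
      (ε / (Fintype.card ι * Fintype.card ι + 1)) (by positivity)
    refine ⟨Matrix.of x, hx, Matrix.ext hpx, lt_of_le_of_lt (norm_le_sum_entries _) ?_⟩
    calc _ ≤ ∑ _i : ι, ∑ _j : ι, ε / (Fintype.card ι * Fintype.card ι + 1) :=
          Finset.sum_le_sum fun i _ => Finset.sum_le_sum fun j _ => (hxs i j).le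
      _ = (Fintype.card ι * Fintype.card ι) * (ε / (Fintype.card ι * Fintype.card ι + 1)) := by
          simp [mul_assoc]
      _ < ε := by
          rw [mul_div_assoc', div_lt_iff₀ (by positivity)]
          nlinarith
  mul_mul_mem h hX k kX r h0 k0 r0 i j := by
    simp only [Matrix.mul_apply, Finset.sum_mul]
    exact X.sum_mem fun b _ => X.sum_mem fun a _ => H.mul_mul_mem _ (hX i a) _ (kX b j) _
      (congrFun (congrFun h0 i) a) (congrFun (congrFun k0 b) j) (congrFun (congrFun r0 a) b)
  bound h hX k kX h0 k0 := by
    choose C hC using fun i a b j : ι => H.bound (h i a) (hX i a) (k b j) (kX b j)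
      (congrFun (congrFun h0 i) a) (congrFun (congrFun k0 b) j)
    refine ⟨∑ i, ∑ j, ∑ b, ∑ a, |C i a b j|, fun r r0 => (norm_le_sum_entries _).trans ?_⟩
    simp only [Finset.sum_mul]
    refine Finset.sum_le_sum fun i _ => Finset.sum_le_sum fun j _ => ?_
    simp only [Matrix.mul_apply, Finset.sum_mul]
    refine (norm_sum_le _ _).trans (Finset.sum_le_sum fun b _ => (norm_sum_le _ _).trans
      (Finset.sum_le_sum fun a _ => ?_))
    refine (hC i a b j (r a b) (congrFun (congrFun r0 a) b)).trans ?_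
    exact mul_le_mul (le_abs_self _) (norm_entry_le (φ.mapMatrix r) a b) (norm_nonneg _)
      (abs_nonneg _)

/-- Equivalence through rectangular matrices is reduced to equivalence inside one matrix ring: e and
f are placed in complementary corners of a block matrix, where x and y become the off-diagonal
blocks. -/
theorem IdemMat.liftsIdempotents_of_isRelativelySpectral [CompleteSpace R] [CompleteSpace S]
    {φ : R →+* S} (hφ : Continuous φ) {p : S →+* Λ} {X : Subring R}
    (H : IsRelativelySpectral φ p X)
    (H' : IsRelativelySpectral (RingHom.id R) (p.comp φ) X) : IdemMat.LiftsIdempotents φ where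
  exists_lift e := by
    have := completeSpace_matrix (ι := Fin e.size) (R := R)
    have := completeSpace_matrix (ι := Fin e.size) (R := S)
    obtain ⟨f, hf, x, y, hx, hy⟩ :=
      (H.mapMatrix (ι := Fin e.size)).exists_lift (continuous_mapMatrix hφ) e.idem
    exact ⟨⟨e.size, f, hf⟩, x, y, hx, hy⟩
  reflects e f h := by
    obtain ⟨x, y, hx, hy⟩ := h
    change Matrix (Fin e.size) (Fin f.size) S at x
    change Matrix (Fin f.size) (Fin e.size) S at y
    change x * y = e.mat.map φ at hx
    change y * x = f.mat.map φ at hy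
    have := completeSpace_matrix (ι := Fin e.size ⊕ Fin f.size) (R := R)
    have := completeSpace_matrix (ι := Fin e.size ⊕ Fin f.size) (R := S)
    have H1 := H.mapMatrix (ι := Fin e.size ⊕ Fin f.size)
    have H2 := H'.mapMatrix (ι := Fin e.size ⊕ Fin f.size)
    let E : Matrix (Fin e.size ⊕ Fin f.size) (Fin e.size ⊕ Fin f.size) R :=
      Matrix.fromBlocks e.mat 0 0 0
    let F : Matrix (Fin e.size ⊕ Fin f.size) (Fin e.size ⊕ Fin f.size) R :=
      Matrix.fromBlocks 0 0 0 f.mat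
    have hE : E * E = E := by simp [E, Matrix.fromBlocks_multiply, e.idem]
    have hF : F * F = F := by simp [F, Matrix.fromBlocks_multiply, f.idem]
    have hm : ∀ m n : ℕ, (0 : Matrix (Fin m) (Fin n) R).map φ = 0 := fun m n => by
      ext i j
      exact map_zero φ
    obtain ⟨P, Q, hPQ, hQP⟩ : RingEquivalent E F := by
      refine H1.ringEquivalent_of_map' H2 hE hF
        ⟨Matrix.fromBlocks 0 x 0 0, Matrix.fromBlocks 0 0 y 0, ?_, ?_⟩
      · simp [E, Matrix.fromBlocks_multiply, Matrix.fromBlocks_map, hx, hm]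
      · simp [F, Matrix.fromBlocks_multiply, Matrix.fromBlocks_map, hy, hm]
    -- The lifted equivalence need not be off-diagonal. Compressing it by the idempotents makes it
    -- so without changing the products, and the rectangular matrices are read off from the blocks.
    have k1 : E * P * F * (F * Q * E) = E := by
      calc E * P * F * (F * Q * E) = E * P * (F * F) * Q * E := by simp only [mul_assoc]
        _ = E * (P * Q) * (P * Q) * E := by rw [hF, ← hQP]; simp only [mul_assoc]
        _ = E := by rw [hPQ, hE, hE, hE]
    have k2 : F * Q * E * (E * P * F) = F := by
      calc F * Q * E * (E * P * F) = F * Q * (E * E) * P * F := by simp only [mul_assoc]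
        _ = F * (Q * P) * (Q * P) * F := by rw [hE, ← hPQ]; simp only [mul_assoc]
        _ = F := by rw [hQP, hF, hF, hF]
    have k3 : E * P * F = Matrix.fromBlocks 0 (e.mat * P.toBlocks₁₂ * f.mat) 0 0 := by
      conv_lhs => rw [← Matrix.fromBlocks_toBlocks P]
      simp [E, F, Matrix.fromBlocks_multiply]
    have k4 : F * Q * E = Matrix.fromBlocks 0 0 (f.mat * Q.toBlocks₂₁ * e.mat) 0 := by
      conv_lhs => rw [← Matrix.fromBlocks_toBlocks Q]
      simp [E, F, Matrix.fromBlocks_multiply]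
    rw [k3, k4, Matrix.fromBlocks_multiply] at k1 k2
    refine ⟨e.mat * P.toBlocks₁₂ * f.mat, f.mat * Q.toBlocks₂₁ * e.mat, ?_, ?_⟩
    · simpa [E] using congrArg Matrix.toBlocks₁₁ k1
    · simpa [F] using congrArg Matrix.toBlocks₂₂ k2

end Matrix

/-! ### Hereditary subspaces -/

section Hereditary

variable {D A : Type*} [NonUnitalNormedRing D] [NormedSpace ℂ D] [IsScalarTower ℂ D D]
  [SMulCommClass ℂ D D] [NonUnitalNormedRing A] [NormedSpace ℂ A] [IsScalarTower ℂ A A]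
  [SMulCommClass ℂ A A]

/-- A dense subspace `H` of `D` with `H H ⊆ H` and `H D H ⊆ H`, such that `d ↦ h d k` is bounded
for the semi-norm `‖φ d‖`, for all `h, k ∈ H`. -/
structure IsHereditary (φ : D →ₙₐ[ℂ] A) (H : Submodule ℂ D) : Prop where
  dense : Dense (H : Set D)
  mul_mem : ∀ h ∈ H, ∀ k ∈ H, h * k ∈ H
  mul_mul_mem : ∀ h ∈ H, ∀ k ∈ H, ∀ d, h * d * k ∈ H
  bound : ∀ h ∈ H, ∀ k ∈ H, ∃ C, ∀ d, ‖h * d * k‖ ≤ C * ‖φ d‖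

/-- A subset with dense span on which the bounds hold generates a hereditary subspace. -/
theorem exists_isHereditary {φ : D →ₙₐ[ℂ] A} {T : Set D}
    (hT : Dense (Submodule.span ℂ T : Set D))
    (hb : ∀ h ∈ T, ∀ k ∈ T, ∃ C, ∀ d, ‖h * d * k‖ ≤ C * ‖φ d‖) :
    ∃ H : Submodule ℂ D, T ⊆ H ∧ IsHereditary φ H := by
  -- `Q` collects the left factors admissible against `T`, and `P` the right factors admissible
  -- against all of `Q`. Both are linear subspaces, `Q` is a left ideal and `P` a right ideal, so P
  -- ∩ Q absorbs every product h d k and satisfies the bounds by construction of `P`.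
  let Q : Submodule ℂ D :=
    { carrier := {q | ∀ k ∈ T, ∃ C, ∀ d, ‖q * d * k‖ ≤ C * ‖φ d‖}
      zero_mem' := fun k _ => ⟨0, fun d => by simp⟩
      add_mem' := fun {q q'} hq hq' k hk => by
        obtain ⟨C, hC⟩ := hq k hk
        obtain ⟨C', hC'⟩ := hq' k hk
        refine ⟨C + C', fun d => ?_⟩
        rw [add_mul, add_mul, add_mul]
        exact (norm_add_le _ _).trans (add_le_add (hC d) (hC' d))
      smul_mem' := fun c q hq k hk => by
        obtain ⟨C, hC⟩ := hq k hk
        refine ⟨‖c‖ * C, fun d => ?_⟩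
        rw [smul_mul_assoc, smul_mul_assoc, norm_smul, mul_assoc ‖c‖]
        exact mul_le_mul_of_nonneg_left (hC d) (norm_nonneg c) }
  let P : Submodule ℂ D :=
    { carrier := {p | ∀ q ∈ Q, ∃ C, ∀ d, ‖q * d * p‖ ≤ C * ‖φ d‖}
      zero_mem' := fun k _ => ⟨0, fun d => by simp⟩
      add_mem' := fun {p p'} hp hp' k hk => by
        obtain ⟨C, hC⟩ := hp k hk
        obtain ⟨C', hC'⟩ := hp' k hk
        refine ⟨C + C', fun d => ?_⟩
        rw [mul_add, add_mul]
        exact (norm_add_le _ _).trans (add_le_add (hC d) (hC' d))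
      smul_mem' := fun c p hp k hk => by
        obtain ⟨C, hC⟩ := hp k hk
        refine ⟨‖c‖ * C, fun d => ?_⟩
        rw [mul_smul_comm, norm_smul, mul_assoc ‖c‖]
        exact mul_le_mul_of_nonneg_left (hC d) (norm_nonneg c) }
  have hQ : ∀ a, ∀ q ∈ Q, a * q ∈ Q := fun a q hq k hk => by
    obtain ⟨C, hC⟩ := hq k hk
    refine ⟨‖a‖ * C, fun d => ?_⟩
    rw [mul_assoc a, mul_assoc a, mul_assoc ‖a‖]
    exact (norm_mul_le _ _).trans (mul_le_mul_of_nonneg_left (hC d) (norm_nonneg a))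
  have hP : ∀ a, ∀ p ∈ P, p * a ∈ P := fun a p hp k hk => by
    obtain ⟨C, hC⟩ := hp k hk
    refine ⟨‖a‖ * C, fun d => ?_⟩
    rw [← mul_assoc, mul_assoc ‖a‖, mul_comm ‖a‖]
    exact (norm_mul_le _ _).trans (mul_le_mul_of_nonneg_right (hC d) (norm_nonneg a))
  have hTH : T ⊆ (P ⊓ Q : Submodule ℂ D) := fun h hh => ⟨fun q hq => hq h hh, hb h hh⟩
  refine ⟨P ⊓ Q, hTH, hT.mono (Submodule.span_le.2 hTH), ?_, ?_, ?_⟩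
  · exact fun h hh k hk => ⟨hP k h hh.1, hQ h k hk.2⟩
  · exact fun h hh k hk d => ⟨hP k _ (hP d h hh.1), hQ _ k hk.2⟩
  · exact fun h hh k hk => hk.1 h hh.2

open WithLp

/-- The map of unitizations, with the `ℓ¹`-norm, induced by `φ`. -/
noncomputable def l1UnitizationMap (φ : D →ₙₐ[ℂ] A) :
    WithLp 1 (Unitization ℂ D) →+* WithLp 1 (Unitization ℂ A) :=
  (((unitizationAlgEquiv (𝕜 := ℂ) (A := A) ℂ).symm.toAlgHom.comp (unitizationMap φ)).comp
    (unitizationAlgEquiv (𝕜 := ℂ) (A := D) ℂ).toAlgHom).toRingHom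

theorem ofLp_l1UnitizationMap (φ : D →ₙₐ[ℂ] A) (z : WithLp 1 (Unitization ℂ D)) :
    ofLp (l1UnitizationMap φ z) = unitizationMap φ (ofLp z) := rfl

/-- The augmentation of the unitization. -/
noncomputable def l1Fst (A : Type*) [NonUnitalNormedRing A] [NormedSpace ℂ A]
    [IsScalarTower ℂ A A] [SMulCommClass ℂ A A] : WithLp 1 (Unitization ℂ A) →+* ℂ :=
  ((Unitization.fstHom ℂ A).comp
    (unitizationAlgEquiv (𝕜 := ℂ) (A := A) ℂ).toAlgHom).toRingHom

theorem l1Fst_apply (z : WithLp 1 (Unitization ℂ A)) : l1Fst A z = (ofLp z).fst := rfl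

theorem continuous_l1UnitizationMap {φ : D →ₙₐ[ℂ] A} (hφ : Continuous φ) :
    Continuous (l1UnitizationMap φ) := by
  refine continuous_of_continuousAt_zero (l1UnitizationMap φ) ?_
  rw [ContinuousAt, map_zero, Metric.tendsto_nhds_nhds]
  intro ε hε
  obtain ⟨δ, hδ, h⟩ := Metric.tendsto_nhds_nhds.1
    (map_zero φ ▸ hφ.tendsto 0 : Tendsto φ (𝓝 0) (𝓝 0)) (ε / 2) (by positivity)
  refine ⟨min δ (ε / 2), by positivity, fun {z} hz => ?_⟩
  rw [dist_zero_right, unitization_norm_def, lt_min_iff] at hz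
  rw [dist_zero_right, unitization_norm_def, ofLp_l1UnitizationMap, fst_unitizationMap,
    snd_unitizationMap]
  have h1 : ‖φ (ofLp z).snd‖ < ε / 2 := by
    simpa using h (x := (ofLp z).snd) (by
      rw [dist_zero_right]
      linarith [norm_nonneg (ofLp z).fst, hz.1])
  linarith [norm_nonneg (ofLp z).snd, hz.2]

theorem l1_snd_mul_mul {h r k : WithLp 1 (Unitization ℂ D)} (h0 : (ofLp h).fst = 0)
    (r0 : (ofLp r).fst = 0) (k0 : (ofLp k).fst = 0) :
    (ofLp (h * r * k)).fst = 0 ∧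
      (ofLp (h * r * k)).snd = (ofLp h).snd * (ofLp r).snd * (ofLp k).snd := by
  simp [h0, r0, k0]

/-- The elements of the unitization with component in a given hereditary subspace. -/
def IsHereditary.subring {φ : D →ₙₐ[ℂ] A} {H : Submodule ℂ D} (hH : IsHereditary φ H) :
    Subring (WithLp 1 (Unitization ℂ D)) where
  carrier := {z | (ofLp z).snd ∈ H}
  zero_mem' := H.zero_mem
  one_mem' := H.zero_mem
  add_mem' := fun ha hb => H.add_mem ha hb
  neg_mem' := fun ha => H.neg_mem ha
  mul_mem' := fun {a b} ha hb => by
    change (ofLp (a * b)).snd ∈ H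
    rw [unitization_mul, Unitization.snd_mul]
    exact H.add_mem (H.add_mem (H.smul_mem _ hb) (H.smul_mem _ ha)) (hH.mul_mem _ ha _ hb)

/-- The scalar component can be matched exactly and only the component in `A` has to be
approximated. On elements without scalar part the ℓ¹-norm is the norm of the algebra, and products
stay free of scalars, so the hereditary conditions carry over verbatim. -/
theorem IsHereditary.isRelativelySpectral {φ : D →ₙₐ[ℂ] A} (hφ : Continuous φ)
    (hd : DenseRange φ) {H : Submodule ℂ D} (hH : IsHereditary φ H) :
    IsRelativelySpectral (l1UnitizationMap φ) (l1Fst A) hH.subring where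
  exists_approx s ε hε := by
    have hdd := hd.dense_image hφ hH.dense
    obtain ⟨_, hlt, h, hh, rfl⟩ := Metric.dense_iff.1 hdd (ofLp s).snd ε hε
    refine ⟨toLp 1 (Unitization.inl (ofLp s).fst + (h : Unitization ℂ D)), ?_, ?_, ?_⟩
    · change (Unitization.inl (ofLp s).fst + (h : Unitization ℂ D)).snd ∈ H
      simpa using hh
    · rw [l1Fst_apply, l1Fst_apply, ofLp_l1UnitizationMap, fst_unitizationMap]
      simp
    · rw [unitization_norm_def, WithLp.ofLp_sub, ofLp_l1UnitizationMap]
      change ‖(unitizationMap φ _).fst - _‖ + ‖(unitizationMap φ _).snd - _‖ < ε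
      rw [fst_unitizationMap, snd_unitizationMap]
      rw [Metric.mem_ball, dist_eq_norm] at hlt
      simpa using hlt
  mul_mul_mem h hh k hk r h0 k0 r0 := by
    rw [l1Fst_apply, ofLp_l1UnitizationMap, fst_unitizationMap] at h0 k0 r0
    change (ofLp (h * r * k)).snd ∈ H
    rw [(l1_snd_mul_mul h0 r0 k0).2]
    exact hH.mul_mul_mem _ hh _ hk _
  bound h hh k hk h0 k0 := by
    obtain ⟨C, hC⟩ := hH.bound _ hh _ hk
    refine ⟨C, fun r r0 => ?_⟩
    rw [l1Fst_apply, ofLp_l1UnitizationMap, fst_unitizationMap] at h0 k0 r0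
    rw [unitization_norm_def, unitization_norm_def, (l1_snd_mul_mul h0 r0 k0).2,
      (l1_snd_mul_mul h0 r0 k0).1, ofLp_l1UnitizationMap, fst_unitizationMap, snd_unitizationMap,
      r0, norm_zero, zero_add, zero_add]
    exact hC _

/-- For the identity the sandwich bound is trivial with constant ‖h‖‖k‖. This version allows
arbitrary idempotents over the unitization of `D` to be moved into the subring. -/
theorem IsHereditary.isRelativelySpectral_id {φ : D →ₙₐ[ℂ] A} {H : Submodule ℂ D} (hH : IsHereditary φ H) :
    IsRelativelySpectral (RingHom.id _) ((l1Fst A).comp (l1UnitizationMap φ)) hH.subring := by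
  have hid : IsHereditary (NonUnitalAlgHom.id ℂ D) H :=
    { hH with
      bound := fun h _ k _ => ⟨‖h‖ * ‖k‖, fun d => by
        refine (norm_mul_le _ _).trans ?_
        rw [mul_right_comm]
        exact mul_le_mul_of_nonneg_right (norm_mul_le _ _) (norm_nonneg k)⟩ }
  have h := hid.isRelativelySpectral continuous_id denseRange_id
  have e1 : l1UnitizationMap (NonUnitalAlgHom.id ℂ D) = RingHom.id _ := by
    refine RingHom.ext fun z => WithLp.ofLp_injective 1 (Unitization.ext ?_ ?_)
    · exact fst_unitizationMap (NonUnitalAlgHom.id ℂ D) _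
    · exact snd_unitizationMap (NonUnitalAlgHom.id ℂ D) _
  have e2 : (l1Fst A).comp (l1UnitizationMap φ) = l1Fst D :=
    RingHom.ext fun z => fst_unitizationMap φ _
  rw [e1] at h
  rw [e2]
  exact h

theorem IsHereditary.K0_map_bijective [CompleteSpace D] [CompleteSpace A] {φ : D →ₙₐ[ℂ] A}
    (hφ : Continuous φ) (hd : DenseRange φ) {H : Submodule ℂ D} (hH : IsHereditary φ H) :
    Function.Bijective (K0.map φ) := by
  have hL := IdemMat.liftsIdempotents_of_isRelativelySpectral (continuous_l1UnitizationMap hφ)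
    (hH.isRelativelySpectral hφ hd) (hH.isRelativelySpectral_id)
  -- The ℓ¹-unitization is the usual unitization with a complete norm; these isomorphisms carry
  -- idempotents and equivalences between the two.
  let a := (unitizationAlgEquiv (𝕜 := ℂ) (A := A) ℂ).symm.toAlgHom.toRingHom
  let b := (unitizationAlgEquiv (𝕜 := ℂ) (A := A) ℂ).toAlgHom.toRingHom
  let a' := (unitizationAlgEquiv (𝕜 := ℂ) (A := D) ℂ).symm.toAlgHom.toRingHom
  let b' := (unitizationAlgEquiv (𝕜 := ℂ) (A := D) ℂ).toAlgHom.toRingHom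
  refine K0.map_bijective ⟨fun e => ?_, fun e f h => ?_⟩
  · obtain ⟨f, hf⟩ := hL.exists_lift (e.map a)
    exact ⟨f.map b', hf.map b⟩
  · exact (hL.reflects (e.map a') (f.map a') (h.map a)).map b'

end Hereditary

/-! ### Suspensions -/

section Suspension

variable {Y : Type*} [TopologicalSpace Y]

theorem zeroAtInfty_norm_le {D : Type*} [NormedAddCommGroup D] {F : C₀(Y, D)} {C : ℝ}
    (hC : 0 ≤ C) (h : ∀ t, ‖F t‖ ≤ C) : ‖F‖ ≤ C := by
  rw [← ZeroAtInftyContinuousMap.norm_toBCF_eq_norm]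
  exact (BoundedContinuousFunction.norm_le hC).2 h

theorem zeroAtInfty_norm_apply_le {D : Type*} [NormedAddCommGroup D] (F : C₀(Y, D)) (t : Y) :
    ‖F t‖ ≤ ‖F‖ := by
  rw [← ZeroAtInftyContinuousMap.norm_toBCF_eq_norm]
  exact F.toBCF.norm_coe_le_norm t

/-- The functions `t ↦ f(t) h` with `f ∈ C_c(Y)` and `h ∈ T`. -/
def elementaryTensors (Y : Type*) [TopologicalSpace Y] {D : Type*} [NormedAddCommGroup D]
    [NormedSpace ℂ D] (T : Set D) : Set C₀(Y, D) :=
  {F | ∃ f : C(Y, ℝ), HasCompactSupport f ∧ ∃ h ∈ T, ∀ t, F t = (f t : ℂ) • h}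

/-- Cover a compact set, outside of which F is small, by finitely many open sets on which F is
nearly constant, and glue elements of `T` by a subordinate partition of unity. -/
theorem dense_span_elementaryTensors [LocallyCompactSpace Y] [T2Space Y] {D : Type*}
    [NormedAddCommGroup D] [NormedSpace ℂ D] {T : Set D} (hT : Dense T) :
    Dense (Submodule.span ℂ (elementaryTensors Y T) : Set C₀(Y, D)) := by
  rw [Metric.dense_iff]
  intro F ε hε
  have h0 := Metric.tendsto_nhds.1 F.zero_at_infty' (ε / 2) (by positivity)
  obtain ⟨K, hK, hKF⟩ := Filter.mem_cocompact.1 h0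
  have hKF : ∀ t ∉ K, ‖F t‖ ≤ ε / 2 := fun t ht => by
    have h : dist (F t) 0 < ε / 2 := hKF ht
    rw [dist_zero_right] at h
    exact h.le
  choose h hhT hh using fun t : Y => hT.exists_dist_lt (F t) (show 0 < ε / 2 by positivity)
  have hUo : ∀ t, IsOpen {s | dist (F s) (h t) < ε / 2} := fun t =>
    isOpen_lt (F.continuous.dist continuous_const) continuous_const
  obtain ⟨t, ht⟩ := hK.elim_finite_subcover (fun t => {s | dist (F s) (h t) < ε / 2}) hUo
    fun s _ => mem_iUnion.2 ⟨s, hh s⟩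
  obtain ⟨f, hfs, hfc⟩ := PartitionOfUnity.exists_isSubordinate_of_locallyFinite_t2space hK
    (fun i : t => {s | dist (F s) (h i.1) < ε / 2}) (fun i => hUo i.1) (locallyFinite_of_finite _)
    (by intro s hs; obtain ⟨i, hi, hsi⟩ := mem_iUnion₂.1 (ht hs)
        exact mem_iUnion.2 ⟨⟨i, hi⟩, hsi⟩)
  let P : t → C₀(Y, D) := fun i =>
    { toFun := fun s => (f i s : ℂ) • h i.1
      continuous_toFun := by fun_prop
      zero_at_infty' := by
        have hc : HasCompactSupport fun s => (f i s : ℂ) • h i.1 :=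
          (hfc i).comp_left (g := fun r : ℝ => (r : ℂ) • h i.1) (by simp)
        exact hc.is_zero_at_infty }
  refine ⟨∑ i, P i, ?_, Submodule.sum_mem _ fun i _ => Submodule.subset_span
    ⟨f i, hfc i, h i.1, hhT _, fun _ => rfl⟩⟩
  rw [Metric.mem_ball, dist_eq_norm, ← norm_neg, neg_sub]
  refine lt_of_le_of_lt (zeroAtInfty_norm_le (C := ε / 2) (by positivity) fun s => ?_)
    (by linarith)
  have hS1 : ∑ i, f i s ≤ 1 := by
    have := f.sum_le_one s
    rwa [finsum_eq_sum_of_fintype] at this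
  have hS : s ∈ K → ∑ i, f i s = 1 := fun hs => by
    have := f.sum_eq_one hs
    rwa [finsum_eq_sum_of_fintype] at this
  -- The error is a convex combination: the weight missing from the partition multiplies a value of
  -- F off the compact set, and each remaining weight multiplies a difference less than ε/2.
  have e : (F - ∑ i, P i) s = (1 - ∑ i, f i s) • F s + ∑ i, f i s • (F s - h i.1) := by
    have : (∑ i, P i) s = ∑ i, f i s • h i.1 := by
      rw [show (∑ i, P i) s = ∑ i, P i s from
        map_sum (⟨⟨fun G => G s, rfl⟩, fun _ _ => rfl⟩ : C₀(Y, D) →+ D) P Finset.univ]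
      exact Finset.sum_congr rfl fun i _ => Complex.coe_smul _ _
    rw [ZeroAtInftyContinuousMap.sub_apply, this]
    simp only [smul_sub, Finset.sum_sub_distrib, ← Finset.sum_smul, sub_smul, one_smul]
    abel
  rw [e]
  have e1 : ‖(1 - ∑ i, f i s) • F s‖ ≤ (1 - ∑ i, f i s) * (ε / 2) := by
    rw [norm_smul, Real.norm_of_nonneg (by linarith)]
    by_cases hs : s ∈ K
    · rw [hS hs]; simp
    · exact mul_le_mul_of_nonneg_left (hKF s hs) (by linarith)
  have e2 : ‖∑ i, f i s • (F s - h i.1)‖ ≤ (∑ i, f i s) * (ε / 2) := by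
    rw [Finset.sum_mul]
    refine (norm_sum_le _ _).trans (Finset.sum_le_sum fun i _ => ?_)
    rw [norm_smul, Real.norm_of_nonneg (f.nonneg i s)]
    by_cases hz : f i s = 0
    · rw [hz, zero_mul, zero_mul]
    · refine mul_le_mul_of_nonneg_left ?_ (f.nonneg i s)
      rw [← dist_eq_norm]
      exact le_of_lt (hfs i (subset_tsupport _ (Function.mem_support.2 hz)))
  refine (norm_add_le _ _).trans ((add_le_add e1 e2).trans (le_of_eq ?_))
  ring

variable {D A : Type*} [NonUnitalNormedRing D] [NormedSpace ℂ D] [IsScalarTower ℂ D D]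
  [SMulCommClass ℂ D D] [NonUnitalNormedRing A] [NormedSpace ℂ A] [IsScalarTower ℂ A A]
  [SMulCommClass ℂ A A]

theorem continuous_suspensionMap (n : ℕ) {φ : D →ₙₐ[ℂ] A} (hφ : Continuous φ) :
    Continuous (suspensionMap n φ hφ) := by
  refine continuous_of_continuousAt_zero (suspensionMap n φ hφ) ?_
  rw [ContinuousAt, map_zero, Metric.tendsto_nhds_nhds]
  intro ε hε
  obtain ⟨δ, hδ, h⟩ := Metric.tendsto_nhds_nhds.1
    (map_zero φ ▸ hφ.tendsto 0 : Tendsto φ (𝓝 0) (𝓝 0)) (ε / 2) (by positivity)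
  refine ⟨δ, hδ, fun {F} hF => ?_⟩
  rw [dist_zero_right] at hF ⊢
  refine lt_of_le_of_lt (zeroAtInfty_norm_le (C := ε / 2) (by positivity) fun t => ?_)
    (by linarith)
  have := h (x := F t) (by
    rw [dist_zero_right]
    exact (zeroAtInfty_norm_apply_le F t).trans_lt hF)
  rw [dist_zero_right] at this
  exact this.le

theorem denseRange_suspensionMap (n : ℕ) {φ : D →ₙₐ[ℂ] A} (hφ : Continuous φ)
    (hd : DenseRange φ) : DenseRange (suspensionMap n φ hφ) := by
  have h := dense_span_elementaryTensors (Y := Fin n → ℝ) hd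
  refine h.mono ?_
  let L : C₀(Fin n → ℝ, D) →ₗ[ℂ] C₀(Fin n → ℝ, A) :=
    { toFun := suspensionMap n φ hφ
      map_add' := map_add _
      map_smul' := map_smul _ }
  change _ ⊆ (LinearMap.range L : Set C₀(Fin n → ℝ, A))
  refine Submodule.span_le.2 ?_
  rintro F ⟨f, hf, _, ⟨d, rfl⟩, hF⟩
  refine ⟨
    { toFun := fun s => (f s : ℂ) • d
      continuous_toFun := by fun_prop
      zero_at_infty' := (hf.comp_left (g := fun r : ℝ => (r : ℂ) • d)
        (by simp)).is_zero_at_infty }, ?_⟩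
  refine DFunLike.ext _ _ fun t => ?_
  rw [hF]
  exact map_smul φ (f t : ℂ) d

/-- For elementary tensors the sandwich estimate holds pointwise in t, up to the suprema of the two
scalar functions. The passage from these generators to a subspace is `exists_isHereditary`. -/
theorem IsHereditary.exists_suspension (n : ℕ) {φ : D →ₙₐ[ℂ] A} (hφ : Continuous φ)
    {H : Submodule ℂ D} (hH : IsHereditary φ H) :
    ∃ H' : Submodule ℂ C₀(Fin n → ℝ, D), IsHereditary (suspensionMap n φ hφ) H' := by
  obtain ⟨H', -, h⟩ := exists_isHereditary (φ := suspensionMap n φ hφ)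
    (dense_span_elementaryTensors (Y := Fin n → ℝ) hH.dense) (by
      rintro F ⟨f, hf, h, hh, hF⟩ F' ⟨f', hf', h', hh', hF'⟩
      obtain ⟨C, hC⟩ := hH.bound h hh h' hh'
      obtain ⟨M, hM⟩ := hf.exists_bound_of_continuous f.continuous
      obtain ⟨M', hM'⟩ := hf'.exists_bound_of_continuous f'.continuous
      refine ⟨|M| * |M'| * |C|, fun G => zeroAtInfty_norm_le (by positivity) fun t => ?_⟩
      change ‖F t * G t * F' t‖ ≤ _
      rw [hF, hF', smul_mul_assoc, mul_smul_comm, smul_mul_assoc, norm_smul, norm_smul,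
        Complex.norm_real, Complex.norm_real]
      have h1 : ‖h * G t * h'‖ ≤ |C| * ‖suspensionMap n φ hφ G‖ :=
        (hC _).trans (mul_le_mul (le_abs_self C)
          (zeroAtInfty_norm_apply_le (suspensionMap n φ hφ G) t) (norm_nonneg _) (abs_nonneg C))
      calc ‖f' t‖ * (‖f t‖ * ‖h * G t * h'‖)
          ≤ |M'| * (|M| * (|C| * ‖suspensionMap n φ hφ G‖)) := by
            have a1 := (hM t).trans (le_abs_self M)
            have a2 := (hM' t).trans (le_abs_self M')
            gcongr
        _ = _ := by ring)
  exact ⟨H', h⟩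

theorem IsHereditary.K_map_bijective [CompleteSpace D] [CompleteSpace A] (n : ℕ)
    {φ : D →ₙₐ[ℂ] A} (hφ : Continuous φ) (hd : DenseRange φ) {H : Submodule ℂ D}
    (hH : IsHereditary φ H) : Function.Bijective (K.map n φ hφ) := by
  obtain ⟨H', h⟩ := hH.exists_suspension n hφ
  exact h.K0_map_bijective (continuous_suspensionMap n hφ) (denseRange_suspensionMap n hφ hd)

theorem K.map_map (n : ℕ) {E : Type*} [NonUnitalNormedRing E] [NormedSpace ℂ E]
    [IsScalarTower ℂ E E] [SMulCommClass ℂ E E] {φ : D →ₙₐ[ℂ] A} (hφ : Continuous φ)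
    {ψ : A →ₙₐ[ℂ] E} (hψ : Continuous ψ) {χ : D →ₙₐ[ℂ] E} (hχ : Continuous χ)
    (h : ∀ d, ψ (φ d) = χ d) (z : K D n) : K.map n ψ hψ (K.map n φ hφ z) = K.map n χ hχ z := by
  obtain rfl : ψ.comp φ = χ := NonUnitalAlgHom.ext h
  exact K0.map_map _ _ z

end Suspension

/-- The Tietze extension theorem for compactly supported functions on closed subspaces of locally
compact Hausdorff spaces. -/
theorem exists_compactlySupported_extension {Y : Type*} [TopologicalSpace Y] [T2Space Y]
    [LocallyCompactSpace Y] {P : Y → Prop} (hP : IsClosed {y | P y}) (f : C_c({y : Y // P y}, ℂ)) :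
    ∃ g : C_c(Y, ℂ), ∀ y : {y : Y // P y}, g y.1 = f y := by
  -- Tietze's theorem is applied inside a compact neighbourhood `N`; multiplication by a bump
  -- function equal to 1 on the support of f and supported inside `N` allows extension by zero. Off
  -- the support of f, the extension on `N` takes the value 0 at points satisfying `P`, so the bump
  -- function does no harm there.
  have hK : IsCompact (Subtype.val '' tsupport f) :=
    f.hasCompactSupport.isCompact.image continuous_subtype_val
  obtain ⟨L, hL, hKL⟩ := exists_compact_superset hK
  obtain ⟨N, hN, hLN⟩ := exists_compact_superset hL
  obtain ⟨h, h1, h0, -, -⟩ := exists_continuous_one_zero_of_isCompact hK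
    isOpen_interior.isClosed_compl (disjoint_compl_right_iff_subset.2 hKL)
  have hsupp : tsupport h ⊆ L := by
    refine closure_minimal (fun y hy => ?_) hL.isClosed
    by_contra hc
    exact hy (h0 fun hi => hc (interior_subset hi))
  have : CompactSpace N := isCompact_iff_compactSpace.1 hN
  have hs : IsClosed {y : N | P y.1} := hP.preimage continuous_subtype_val
  let f' : C({y : N | P y.1}, ℂ) :=
    ⟨fun y => f ⟨y.1.1, y.2⟩, f.continuous.comp (Continuous.subtype_mk
      (continuous_subtype_val.comp continuous_subtype_val) _)⟩
  obtain ⟨g, hg⟩ := f'.exists_restrict_eq hs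
  classical
  let e : Y → ℂ := fun y => if hy : y ∈ N then g ⟨y, hy⟩ else 0
  have he : ContinuousOn e N := by
    rw [continuousOn_iff_continuous_domRestrict]
    refine g.continuous.congr fun y => ?_
    simp [e]
  have hts : tsupport (fun y => (h y : ℂ) * e y) ⊆ tsupport h :=
    closure_mono fun y hy hc => hy (by
      change (h y : ℂ) * e y = 0
      rw [hc, Complex.ofReal_zero, zero_mul])
  refine ⟨⟨⟨fun y => (h y : ℂ) * e y, ?_⟩, hL.of_isClosed_subset (isClosed_tsupport _)
    (hts.trans hsupp)⟩, fun y => ?_⟩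
  · refine continuous_of_tsupport fun y hy => ?_
    have hyN : N ∈ 𝓝 y := mem_interior_iff_mem_nhds.1 (hLN (hsupp (hts hy)))
    exact (Complex.continuous_ofReal.comp h.continuous).continuousAt.mul (he.continuousAt hyN)
  · change (h y.1 : ℂ) * e y.1 = f y
    by_cases hy : y ∈ tsupport f
    · have hyK : y.1 ∈ Subtype.val '' tsupport f := ⟨y, hy, rfl⟩
      have hyN : y.1 ∈ N := interior_subset (hLN (interior_subset (hKL hyK)))
      have hgy : g ⟨y.1, hyN⟩ = f y := DFunLike.congr_fun hg ⟨⟨y.1, hyN⟩, y.2⟩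
      rw [h1 hyK]
      simp [e, hyN, hgy]
    · have hfy := image_eq_zero_of_notMem_tsupport hy
      rw [hfy]
      by_cases hyL : y.1 ∈ N
      · have hgy : g ⟨y.1, hyL⟩ = f y := DFunLike.congr_fun hg ⟨⟨y.1, hyL⟩, y.2⟩
        simp [e, hyL, hgy, hfy]
      · simp [e, hyL]

/-! ### Pointwise estimates from regularity, and proper groupoids -/

section Estimates

variable {X G : Type*} [TopologicalSpace X] [TopologicalSpace G] {𝒢 : TopGroupoid X G}
  [MeasurableSpace G] [BorelSpace G] [T2Space X] [T2Space G] [LocallyCompactSpace G]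
  {μ : 𝒢.HaarSystem}

open TopGroupoid

namespace UnconditionalSeminorm

variable {A : UnconditionalSeminorm μ} {L R : MonotoneSeminorm G}

/-- The integral of f(η)g(η⁻¹γ) is the bracket of f, at r(γ), with any g' that extends the translate
η ↦ g(ηγ) from the fibre over r(γ). Taking the infimum over such g' replaces the norm of g' by the
fibre norm of the translate. By (H4) this is the fibre norm of g over s(γ), hence at most the norm
of g. -/
theorem ActsOn.norm_scalarConv_apply_le (hA : A.ActsOn L R) (f g : C_c(G, ℂ)) (γ : G) :
    ‖scalarConv μ f g γ‖ ≤ L.toSeminorm f * R.toSeminorm g := by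
  have hcl : ∀ x, IsClosed {η : G | 𝒢.s η = x} := fun x =>
    isClosed_singleton.preimage 𝒢.continuous_s
  have hgc : HasCompactSupport fun η : {η : G // 𝒢.s η = 𝒢.s γ} => g η.1 :=
    g.hasCompactSupport.comp_isClosedEmbedding (hcl _).isClosedEmbedding_subtypeVal
  let gs : C_c({η : G // 𝒢.s η = 𝒢.s γ}, ℂ) :=
    ⟨⟨fun η => g η.1, g.continuous.comp continuous_subtype_val⟩, hgc⟩
  have hiso := hA.isometric_right γ gs
  have hle : R.fibreNorm 𝒢.s (𝒢.s γ) (fun η => gs η) ≤ R.toSeminorm g :=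
    csInf_le ⟨0, by rintro _ ⟨ψ, -, rfl⟩; exact apply_nonneg _ _⟩ ⟨g, fun _ => rfl, rfl⟩
  have hr : Continuous fun η : {η : G // 𝒢.s η = 𝒢.r γ} => 𝒢.mul η.1 γ :=
    𝒢.continuousOn_mul.comp_continuous
      (f := fun η : {η : G // 𝒢.s η = 𝒢.r γ} => (η.1, γ))
      (continuous_subtype_val.prodMk continuous_const) fun η => η.2
  -- the translated function has compact support on the fibre
  have hcomp : HasCompactSupport fun η : {η : G // 𝒢.s η = 𝒢.r γ} => g (𝒢.mul η.1 γ) := by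
    refine HasCompactSupport.intro ((hcl _).isClosedEmbedding_subtypeVal.isCompact_preimage
      (isCompact_mulSet (𝒢 := 𝒢) g.hasCompactSupport (isCompact_singleton (x := 𝒢.inv γ))))
      fun η hη => ?_
    by_contra hc
    refine hη ⟨(𝒢.mul η.1 γ, 𝒢.inv γ), ⟨⟨subset_tsupport _ hc, rfl⟩, ?_⟩, ?_⟩
    · change 𝒢.s (𝒢.mul η.1 γ) = 𝒢.r (𝒢.inv γ)
      rw [𝒢.s_mul _ _ η.2, 𝒢.r_inv]
    · change 𝒢.mul (𝒢.mul η.1 γ) (𝒢.inv γ) = η.1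
      rw [𝒢.mul_assoc _ _ _ η.2 (𝒢.r_inv γ).symm, 𝒢.mul_inv]
      have hu := 𝒢.mul_unit η.1
      rwa [η.2] at hu
  -- At least one extension must exist: the fibre norm is a real infimum, which would be 0 over the
  -- empty set.
  obtain ⟨g₀, hg₀⟩ := exists_compactlySupported_extension (hcl (𝒢.r γ))
    ⟨⟨fun η => g (𝒢.mul η.1 γ), g.continuous.comp hr⟩, hcomp⟩
  have key : ∀ g' : C_c(G, ℂ), (∀ η : {η : G // 𝒢.s η = 𝒢.r γ}, g' η.1 = g (𝒢.mul η.1 γ)) →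
      ‖scalarConv μ f g γ‖ ≤ L.toSeminorm f * R.toSeminorm g' := by
    intro g' hg'
    refine le_trans (le_of_eq ?_) (hA.bracket_le f g' (𝒢.r γ))
    congr 1
    refine integral_congr_ae (Eventually.of_forall fun η => ?_)
    change f η.1 * g (𝒢.mul (𝒢.inv η.1) γ) = f η.1 * g' (𝒢.inv η.1)
    rw [hg' ⟨𝒢.inv η.1, by rw [𝒢.s_inv, η.2]⟩]
  have hfib : ‖scalarConv μ f g γ‖ ≤ L.toSeminorm f * R.fibreNorm 𝒢.s (𝒢.r γ)
      (fun γ' => gs (𝒢.rightMul γ γ')) := by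
    rw [MonotoneSeminorm.fibreNorm, ← smul_eq_mul, ← Real.sInf_smul_of_nonneg (apply_nonneg _ _)]
    refine le_csInf ⟨_, Set.smul_mem_smul_set ⟨g₀, hg₀, rfl⟩⟩ ?_
    rintro _ ⟨_, ⟨g', hg', rfl⟩, rfl⟩
    exact key g' hg'
  rw [hiso] at hfib
  exact hfib.trans (mul_le_mul_of_nonneg_left hle (apply_nonneg _ _))

end UnconditionalSeminorm

namespace GBanachAlgebra

variable {B : X → Type*} [∀ x, NonUnitalNormedRing (B x)] [∀ x, NormedSpace ℂ (B x)]
  [∀ x, CompleteSpace (B x)] [∀ x, IsScalarTower ℂ (B x) (B x)]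
  [∀ x, SMulCommClass ℂ (B x) (B x)] {A C : UnconditionalSeminorm μ} {𝓑 : GBanachAlgebra 𝒢 B}

open MonotoneSeminorm

/-- Products `σ * χ * τ` are bounded pointwise by the norm of `χ`. -/
theorem norm_mul_mul_apply_le {L R : MonotoneSeminorm G} (hA : A.ActsOn L R)
    (σ χ τ : ConvAlg A 𝓑) {f g : C_c(G, ℂ)} (hf : ∀ γ, ‖σ.1 γ‖ ≤ ‖f γ‖)
    (hg : ∀ γ, ‖τ.1 γ‖ ≤ ‖g γ‖) (γ : G) :
    ‖(σ * χ * τ).1 γ‖ ≤ L.toSeminorm f * ‖χ‖ * R.toSeminorm g := by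
  -- The norm of χ is an infimum over dominating scalar functions, hence the ε. Once a dominating c
  -- is fixed, |σ * χ * τ| is at most |f| * |c| * |g|; the pointwise bound applies to the last
  -- convolution and (H2) to the first.
  have key : ∀ ε > 0, ‖(σ * χ * τ).1 γ‖ ≤ L.toSeminorm f * (‖χ‖ + ε) * R.toSeminorm g := by
    intro ε hε
    obtain ⟨c, hc, hc'⟩ := A.exists_lt (exists_dominating A 𝓑 χ) hε
    have h1 := norm_conv_le A 𝓑 σ χ f c hf hc
    have h2 := norm_conv_le A 𝓑 (σ * χ) τ _ g h1 hg γ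
    refine h2.trans ((hA.norm_scalarConv_apply_le _ _ γ).trans ?_)
    rw [L.apply_absC, R.apply_absC]
    refine mul_le_mul_of_nonneg_right ((hA.conv_le_left _ _).trans ?_) (apply_nonneg _ _)
    rw [L.apply_absC]
    refine mul_le_mul_of_nonneg_left ?_ (apply_nonneg _ _)
    rw [A.apply_absC]
    exact hc'.le
  have hc : Continuous fun ε : ℝ => L.toSeminorm f * (‖χ‖ + ε) * R.toSeminorm g := by fun_prop
  have ht : Tendsto (fun ε : ℝ => L.toSeminorm f * (‖χ‖ + ε) * R.toSeminorm g) (𝓝[>] 0)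
      (𝓝 (L.toSeminorm f * (‖χ‖ + 0) * R.toSeminorm g)) :=
    (hc.tendsto 0).mono_left nhdsWithin_le_nhds
  rw [add_zero] at ht
  exact ge_of_tendsto ht (eventually_nhdsWithin_of_forall key)

/-- The constant is ‖f‖_< ‖g‖_> for scalar functions f, g dominating σ and τ, so it is uniform in χ
and γ. -/
theorem exists_norm_mul_mul_apply_le (hA : A.IsRegular) (σ τ : ConvAlg A 𝓑) :
    ∃ M : ℝ, 0 ≤ M ∧ ∀ (χ : ConvAlg A 𝓑) (γ : G), ‖(σ * χ * τ).1 γ‖ ≤ M * ‖χ‖ := by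
  obtain ⟨L, R, hLR⟩ := hA
  obtain ⟨f, hf⟩ := exists_dominating A 𝓑 σ
  obtain ⟨g, hg⟩ := exists_dominating A 𝓑 τ
  refine ⟨L.toSeminorm f * R.toSeminorm g, mul_nonneg (apply_nonneg _ _) (apply_nonneg _ _),
    fun χ γ => (norm_mul_mul_apply_le hLR σ χ τ hf hg γ).trans (le_of_eq (by ring))⟩

/-- On sections with support in a fixed compact set the supremum norm dominates. -/
theorem exists_norm_le_of_support (C : UnconditionalSeminorm μ) (𝓑 : GBanachAlgebra 𝒢 B)
    {K : Set G} (hK : IsCompact K) :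
    ∃ M : ℝ, 0 ≤ M ∧ ∀ (σ : ConvAlg C 𝓑) (t : ℝ), 0 ≤ t → (∀ γ ∉ K, σ.1 γ = 0) →
      (∀ γ, ‖σ.1 γ‖ ≤ t) → ‖σ‖ ≤ t * M := by
  obtain ⟨h, h1, -, hcs, h01⟩ := exists_continuous_one_zero_of_isCompact hK isClosed_empty
    (disjoint_empty _)
  let ψ : C_c(G, ℂ) := ⟨⟨fun γ => (h γ : ℂ), by fun_prop⟩,
    hcs.comp_left (g := fun t : ℝ => (t : ℂ)) (by simp)⟩
  refine ⟨C.toSeminorm ψ, apply_nonneg _ _, fun σ t ht h0 hb => ?_⟩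
  have h2 : C.ext (fun γ => ‖σ.1 γ‖) ≤ C.toSeminorm ((t : ℂ) • ψ) := by
    refine C.ext_le fun γ => ?_
    change _ ≤ ‖(t : ℂ) • (h γ : ℂ)‖
    by_cases hγ : γ ∈ K
    · rw [h1 hγ]
      simpa [abs_of_nonneg ht] using hb γ
    · rw [h0 γ hγ, norm_zero]
      exact norm_nonneg _
  rw [map_smul_eq_mul, Complex.norm_real, Real.norm_of_nonneg ht] at h2
  exact h2

theorem comparison_of (h : ∀ f, A.toSeminorm f ≤ C.toSeminorm f) (σ : ConvAlg C 𝓑) :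
    𝓑.comparison h (BanachCompletion.of σ) = BanachCompletion.of (show ConvAlg A 𝓑 from σ) :=
  BanachCompletion.map_of _ _ _

theorem denseRange_comparison (h : ∀ f, A.toSeminorm f ≤ C.toSeminorm f) :
    DenseRange (𝓑.comparison h) := by
  refine Dense.mono ?_ (BanachCompletion.isDenseInducing_of (R := ConvAlg A 𝓑)).dense
  rintro _ ⟨σ, rfl⟩
  exact ⟨BanachCompletion.of (show ConvAlg C 𝓑 from σ), comparison_of h _⟩

theorem comparison_comparison {A' : UnconditionalSeminorm μ}
    (h : ∀ f, A.toSeminorm f ≤ C.toSeminorm f)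
    (h' : ∀ f, A'.toSeminorm f ≤ A.toSeminorm f) (h'' : ∀ f, A'.toSeminorm f ≤ C.toSeminorm f)
    (c : CrossedProduct C 𝓑) :
    𝓑.comparison h' (𝓑.comparison h c) = 𝓑.comparison h'' c := by
  refine BanachCompletion.induction_on c (isClosed_eq
    ((continuous_comparison 𝓑 h').comp (continuous_comparison 𝓑 h))
    (continuous_comparison 𝓑 h'')) fun σ => ?_
  rw [comparison_of, comparison_of, comparison_of]

/-- If the products `σ * χ * τ` with fixed `σ`, `τ` in a dense set have their support in a fixed
compact set, then `comparison` is an isomorphism in K-theory. -/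
theorem K_map_comparison_bijective (hA : A.IsRegular)
    (h : ∀ f, A.toSeminorm f ≤ C.toSeminorm f) {T : Set (ConvAlg C 𝓑)} (hT : Dense T)
    (hsupp : ∀ σ ∈ T, ∀ τ ∈ T, ∃ K : Set G, IsCompact K ∧
      ∀ (χ : ConvAlg C 𝓑), ∀ γ ∉ K, (σ * χ * τ).1 γ = 0) (n : ℕ) :
    Function.Bijective (K.map n (𝓑.comparison h) (𝓑.continuous_comparison h)) := by
  have hd : Dense (BanachCompletion.of '' T) :=
    BanachCompletion.isDenseInducing_of.dense.dense_image BanachCompletion.continuous_of hT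
  obtain ⟨H, -, hH⟩ := exists_isHereditary (φ := 𝓑.comparison h)
    (hd.mono Submodule.subset_span) (by
      rintro _ ⟨σ, hσ, rfl⟩ _ ⟨τ, hτ, rfl⟩
      obtain ⟨K, hK, hK0⟩ := hsupp σ hσ τ hτ
      obtain ⟨M, hM, hMb⟩ := exists_norm_mul_mul_apply_le (𝓑 := 𝓑) hA σ τ
      obtain ⟨N, hN, hNb⟩ := exists_norm_le_of_support C 𝓑 hK
      -- By density and continuity it suffices to take d = χ, a compactly supported section. Both
      -- algebras consist of the same sections, so χ can be read with either norm: its norm in `A`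
      -- bounds the supremum of σ * χ * τ, and the fixed compact support turns that into a bound in
      -- `C`.
      refine ⟨M * N, fun d => BanachCompletion.induction_on d (isClosed_le
        ((continuous_const.mul continuous_id).mul continuous_const).norm
        (continuous_const.mul (continuous_comparison 𝓑 h).norm)) fun χ => ?_⟩
      rw [comparison_of, ← BanachCompletion.of_mul, ← BanachCompletion.of_mul,
        BanachCompletion.norm_of, BanachCompletion.norm_of]
      refine (hNb (σ * χ * τ) (M * ‖(show ConvAlg A 𝓑 from χ)‖)
        (mul_nonneg hM (norm_nonneg _)) (hK0 χ) (hMb χ)).trans (le_of_eq (by ring)))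
  exact hH.K_map_bijective n _ (denseRange_comparison h)

/-- For proper groupoids, `σ * χ * τ` has its support in a compact set that does not depend on
`χ`. -/
theorem exists_support_of_isProper (hG : 𝒢.IsProper) (σ τ : ConvAlg C 𝓑) :
    ∃ K : Set G, IsCompact K ∧ ∀ (χ : ConvAlg C 𝓑), ∀ γ ∉ K, (σ * χ * τ).1 γ = 0 := by
  obtain ⟨-, K, hK, h0⟩ := σ.2
  obtain ⟨-, L, hL, h0'⟩ := τ.2
  -- The compact set consists of all arrows with range in r(supp σ) and source in s(supp τ).
  refine ⟨_, hG _ ((hK.image 𝒢.continuous_r).prod (hL.image 𝒢.continuous_s)), fun χ γ hγ => ?_⟩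
  -- No support bound for χ is available uniformly, so σ * χ is only known to vanish off the
  -- products of `K` with arbitrary arrows.
  refine conv_eq_zero (σ := (σ * χ).1) (K := 𝒢.mulSet K univ)
    (conv_eq_zero h0 fun γ hγ => (hγ (mem_univ γ)).elim) h0' γ fun hc => hγ ?_
  obtain ⟨⟨_, η⟩, ⟨⟨⟨⟨ζ, θ⟩, ⟨⟨hζ, -⟩, hc1⟩, rfl⟩, hη⟩, hc2⟩, rfl⟩ := hc
  refine ⟨⟨ζ, hζ, ?_⟩, ⟨η, hη, ?_⟩⟩
  · change 𝒢.r ζ = 𝒢.r (𝒢.mul (𝒢.mul ζ θ) η)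
    rw [𝒢.r_mul _ _ hc2, 𝒢.r_mul _ _ hc1]
  · exact (𝒢.s_mul _ _ hc2).symm

/-- For proper groupoids the compactly supported sections form a hereditary subalgebra. -/
theorem exists_of_mul_mul_eq (hA : A.IsRegular) (hG : 𝒢.IsProper) (σ τ : ConvAlg A 𝓑)
    (a : CrossedProduct A 𝓑) : ∃ υ : ConvAlg A 𝓑,
      BanachCompletion.of σ * a * BanachCompletion.of τ = BanachCompletion.of υ := by
  obtain ⟨K, hK, hK0⟩ := exists_support_of_isProper hG σ τ
  obtain ⟨M, hM, hMb⟩ := exists_norm_mul_mul_apply_le hA σ τ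
  obtain ⟨N, hN, hNb⟩ := exists_norm_le_of_support A 𝓑 hK
  obtain ⟨u, hu⟩ : ∃ u : ℕ → ConvAlg A 𝓑,
      Tendsto (fun n => BanachCompletion.of (u n)) atTop (𝓝 a) := by
    have hd := (BanachCompletion.isDenseInducing_of (R := ConvAlg A 𝓑)).dense
    obtain ⟨v, hv, hva⟩ := mem_closure_iff_seq_limit.1 (hd a)
    choose u hu using hv
    exact ⟨u, by simpa only [hu] using hva⟩
  -- The canonical map preserves semi-norms, so the approximants are already Cauchy before
  -- completion.
  have hcu : CauchySeq u := by
    have := hu.cauchySeq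
    rw [Metric.cauchySeq_iff] at this ⊢
    intro ε hε
    obtain ⟨n₀, h⟩ := this ε hε
    refine ⟨n₀, fun m hm n hn => ?_⟩
    have := h m hm n hn
    rw [dist_eq_norm] at this ⊢
    have e : BanachCompletion.of (u m) - BanachCompletion.of (u n) =
        BanachCompletion.of (u m - u n) := by
      rw [sub_eq_iff_eq_add, ← BanachCompletion.of_add, sub_add_cancel]
    rwa [e, BanachCompletion.norm_of] at this
  have hsub : ∀ m n γ, ‖(σ * u m * τ).1 γ - (σ * u n * τ).1 γ‖ ≤ M * ‖u m - u n‖ := by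
    intro m n γ
    have := hMb (u m - u n) γ
    rwa [mul_sub, sub_mul] at this
  have hpt : ∀ γ, CauchySeq fun n => (σ * u n * τ).1 γ := by
    intro γ
    rw [Metric.cauchySeq_iff] at hcu ⊢
    intro ε hε
    obtain ⟨n₀, h⟩ := hcu (ε / (M + 1)) (by positivity)
    refine ⟨n₀, fun m hm n hn => ?_⟩
    rw [dist_eq_norm]
    refine (hsub m n γ).trans_lt ?_
    have := h m hm n hn
    rw [dist_eq_norm, lt_div_iff₀ (by positivity)] at this
    nlinarith [norm_nonneg (u m - u n)]
  choose υ hυ using fun γ => cauchySeq_tendsto_of_complete (hpt γ)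
  -- The pointwise bound is uniform in γ, so the pointwise limit is a uniform limit. This makes it
  -- continuous as a section, and it retains the common support `K`.
  have hunif : ∀ ε > 0, ∃ n₀, ∀ n ≥ n₀, ∀ γ, ‖(σ * u n * τ).1 γ - υ γ‖ ≤ ε := by
    intro ε hε
    obtain ⟨n₀, h⟩ := Metric.cauchySeq_iff.1 hcu (ε / (M + 1)) (by positivity)
    refine ⟨n₀, fun n hn γ => ?_⟩
    refine le_of_tendsto ((tendsto_const_nhds.sub (hυ γ)).norm)
      ((eventually_ge_atTop n₀).mono fun m hm => (hsub n m γ).trans ?_)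
    have := h n hn m hm
    rw [dist_eq_norm, lt_div_iff₀ (by positivity)] at this
    nlinarith [norm_nonneg (u n - u m)]
  have hυ0 : ∀ γ ∉ K, υ γ = 0 := fun γ hγ => by
    refine tendsto_nhds_unique (hυ γ) ?_
    simp only [hK0 _ γ hγ]
    exact tendsto_const_nhds
  have hsec : 𝓑.IsSection 𝒢.r υ := fun γ => BanachField.IsSectionAt.approx fun ε hε => by
    obtain ⟨n₀, h⟩ := hunif ε hε
    refine ⟨(σ * u n₀ * τ).1, (σ * u n₀ * τ).2.1 γ, Eventually.of_forall fun γ' => ?_⟩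
    rw [← norm_neg, neg_sub]
    exact h n₀ le_rfl γ'
  let U : ConvAlg A 𝓑 := ⟨υ, hsec, K, hK, hυ0⟩
  -- The sequence has two limits in the completion: one by continuity of the product, the other
  -- because uniform convergence with supports in `K` implies convergence in the norm of `A`.
  refine ⟨U, tendsto_nhds_unique
    (f := fun n => BanachCompletion.of (σ * u n * τ)) (l := atTop) ?_ ?_⟩
  · simp only [BanachCompletion.of_mul]
    exact (tendsto_const_nhds.mul hu).mul tendsto_const_nhds
  · refine (BanachCompletion.continuous_of.tendsto U).comp ?_
    rw [Metric.tendsto_atTop]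
    intro ε hε
    obtain ⟨n₀, h⟩ := hunif (ε / (N + 1)) (by positivity)
    refine ⟨n₀, fun n hn => ?_⟩
    rw [dist_eq_norm]
    refine lt_of_le_of_lt (hNb (σ * u n * τ - U) (ε / (N + 1)) (by positivity) (fun γ hγ => ?_)
      (fun γ => h n hn γ)) ?_
    · change (σ * u n * τ).1 γ - υ γ = 0
      rw [hK0 _ γ hγ, hυ0 γ hγ, sub_zero]
    · rw [div_mul_eq_mul_div, div_lt_iff₀ (by positivity)]
      nlinarith

/-- Elements of the kernel have semi-norm zero, so the sandwich estimate forces every value of the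
product to vanish. -/
theorem mul_mul_eq_zero_of_of_eq_zero (hA : A.IsRegular) (σ ν τ : ConvAlg A 𝓑)
    (hν : BanachCompletion.of ν = 0) : σ * ν * τ = 0 := by
  obtain ⟨M, -, hMb⟩ := exists_norm_mul_mul_apply_le hA σ τ
  have h0 : ‖ν‖ = 0 := by rw [← BanachCompletion.norm_of, hν, norm_zero]
  refine Subtype.ext (funext fun γ => ?_)
  have := hMb ν γ
  rw [h0, mul_zero] at this
  exact norm_le_zero_iff.1 this

end GBanachAlgebra

end Estimates

/-! ### Continuous functions acting on sections of Banach fields -/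

namespace BanachField

variable {X : Type*} [TopologicalSpace X] {E : X → Type*}
  [∀ x, NormedAddCommGroup (E x)] [∀ x, NormedSpace ℂ (E x)] {F : BanachField E}

/-- A product with a continuous function is locally close to a scalar multiple of the section, so
local closedness of the space of sections applies. -/
theorem smul_mem_sections {ξ : ∀ x, E x} (hξ : ξ ∈ F.sections) {c : X → ℂ} (hc : Continuous c) :
    (fun x => c x • ξ x) ∈ F.sections :=
  F.locallyClosed _ fun x => IsSectionAt.smul (p := fun x : X => x) continuousAt_id
    hc.continuousAt (isSectionAt_of_mem hξ (fun x => x) x)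

theorem smul_mem_c0Sections {ξ : ∀ x, E x} (hξ : ξ ∈ F.c0Sections) {c : X → ℂ}
    (hc : Continuous c) (h1 : ∀ x, ‖c x‖ ≤ 1) : (fun x => c x • ξ x) ∈ F.c0Sections := by
  refine ⟨smul_mem_sections hξ.1 hc, fun ε hε => ?_⟩
  obtain ⟨K, hK, h⟩ := hξ.2 ε hε
  refine ⟨K, hK, fun x hx => ?_⟩
  rw [norm_smul]
  exact (mul_le_of_le_one_left (norm_nonneg _) (h1 x)).trans (h x hx)

/-- Sections can be approximated locally by sections vanishing at infinity. -/
theorem IsSectionAt.exists_c0 [T2Space X] [LocallyCompactSpace X] {Y : Type*} [TopologicalSpace Y]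
    {p : Y → X} {σ : ∀ y, E (p y)} {y : Y} (h : F.IsSectionAt p σ y) (hp : ContinuousAt p y)
    {ε : ℝ} (hε : 0 < ε) : ∃ b ∈ F.c0Sections, ∀ᶠ y' in 𝓝 y, ‖σ y' - b (p y')‖ ≤ ε := by
  obtain ⟨b, hb, h1⟩ := h ε hε
  obtain ⟨N, hN, hyN⟩ := exists_compact_mem_nhds (p y)
  obtain ⟨c, hc1, -, hcs, -⟩ := exists_continuous_one_zero_of_isCompact hN isClosed_empty
    (disjoint_empty _)
  refine ⟨fun x => (c x : ℂ) • b x, ⟨smul_mem_sections hb (by fun_prop), fun ε hε =>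
    ⟨tsupport c, hcs, fun x hx => ?_⟩⟩, ?_⟩
  · change ‖(c x : ℂ) • b x‖ ≤ ε
    rw [image_eq_zero_of_notMem_tsupport hx]
    simpa using hε.le
  · filter_upwards [h1, hp.eventually hyN] with y' h1 h2
    rw [hc1 h2]
    simpa using h1

end BanachField

/-! ### Proper algebras: cutting down by functions on Z -/

namespace GBanachAlgebra

namespace PushforwardIso

section Cut

variable {X G Z : Type*} [TopologicalSpace X] [TopologicalSpace G] [TopologicalSpace Z]
  {𝒢 : TopGroupoid X G} {S : 𝒢.Space Z}
  {B : X → Type*} [∀ x, NonUnitalNormedRing (B x)] [∀ x, NormedSpace ℂ (B x)]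
  {B' : Z → Type*} [∀ z, NonUnitalNormedRing (B' z)] [∀ z, NormedSpace ℂ (B' z)]
  {𝓑 : GBanachAlgebra 𝒢 B} {𝓑' : GBanachAlgebra S.transformationGroupoid B'}
  (I : PushforwardIso 𝓑 𝓑')

/-- The sign of the constant in `PushforwardIso` is not prescribed; its absolute value is used so
that estimates can be chained. -/
theorem norm_apply_le {x : X} (b : B x) (z : {z : Z // S.ρ z = x}) :
    ‖I.toFun x b z‖ ≤ |I.bound| * ‖b‖ :=
  (I.norm_le x b z).trans (mul_le_mul_of_nonneg_right (le_abs_self _) (norm_nonneg _))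

theorem norm_le_of_apply {x : X} (b : B x) {M : ℝ} (hM : 0 ≤ M)
    (h : ∀ z, ‖I.toFun x b z‖ ≤ M) : ‖b‖ ≤ |I.bound| * M :=
  (I.le_norm x b M hM h).trans (mul_le_mul_of_nonneg_right (le_abs_self _) hM)

/-- Elements of a fibre are determined by their values on Z; this makes the properties of `cut`
pointwise verifications. -/
theorem eq_of_apply {x : X} {a b : B x} (h : ∀ z, I.toFun x a z = I.toFun x b z) : a = b := by
  have h1 := I.norm_le_of_apply (a - b) le_rfl fun z => by
    rw [map_sub, Pi.sub_apply, h z, sub_self, norm_zero]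
  rw [mul_zero] at h1
  exact sub_eq_zero.1 (norm_le_zero_iff.1 h1)

/-- Evaluation at a point of `Z`. -/
def eval {x : X} (z : {z : Z // S.ρ z = x}) : B x →L[ℂ] B' z.1 :=
  LinearMap.mkContinuous
    { toFun := fun b => I.toFun x b z
      map_add' := fun a b => by rw [map_add, Pi.add_apply]
      map_smul' := fun c b => by rw [map_smul, Pi.smul_apply]; rfl } |I.bound|
    fun b => I.norm_apply_le b z

theorem eval_apply {x : X} (z : {z : Z // S.ρ z = x}) (b : B x) :
    I.eval z b = I.toFun x b z := rfl

/-- The fibre over x is identified with all sections vanishing at infinity on ρ⁻¹(x), and these are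
stable under multiplication by continuous functions bounded by 1. -/
theorem exists_cut (c : C(Z, ℝ)) (hc : ∀ z, ‖(c z : ℂ)‖ ≤ 1) {x : X} (b : B x) :
    ∃ b' : B x, ∀ z, I.toFun x b' z = (c z.1 : ℂ) • I.toFun x b z := by
  have hb : I.toFun x b ∈ Set.range (I.toFun x) := ⟨b, rfl⟩
  rw [I.range_eq] at hb
  have h : (fun z : {z : Z // S.ρ z = x} => (c z.1 : ℂ) • I.toFun x b z) ∈
      Set.range (I.toFun x) := by
    rw [I.range_eq]
    refine ⟨fun z => BanachField.IsSectionAt.smul (g := fun z : {z : Z // S.ρ z = x} =>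
      (c z.1 : ℂ)) continuous_subtype_val.continuousAt (by fun_prop) (hb.1 z), fun ε hε => ?_⟩
    obtain ⟨K, hK, hK'⟩ := hb.2 ε hε
    refine ⟨K, hK, fun z hz => ?_⟩
    rw [norm_smul]
    exact (mul_le_of_le_one_left (norm_nonneg _) (hc z)).trans (hK' z hz)
  obtain ⟨b', hb'⟩ := h
  exact ⟨b', fun z => congrFun hb' z⟩

variable (c : C(Z, ℝ)) (hc : ∀ z, ‖(c z : ℂ)‖ ≤ 1)

/-- Multiplication by a function on `Z`. -/
noncomputable def cut {x : X} (b : B x) : B x := (I.exists_cut c hc b).choose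

theorem toFun_cut {x : X} (b : B x) (z : {z : Z // S.ρ z = x}) :
    I.toFun x (I.cut c hc b) z = (c z.1 : ℂ) • I.toFun x b z :=
  (I.exists_cut c hc b).choose_spec z

theorem cut_sub {x : X} (a b : B x) :
    I.cut c hc (a - b) = I.cut c hc a - I.cut c hc b :=
  I.eq_of_apply fun z => by
    rw [toFun_cut, map_sub, map_sub, Pi.sub_apply, Pi.sub_apply, toFun_cut, toFun_cut, smul_sub]

theorem cut_zero {x : X} : I.cut c hc (0 : B x) = 0 := by
  rw [← sub_self (0 : B x), cut_sub, sub_self, sub_self]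

theorem norm_cut_le {x : X} (b : B x) : ‖I.cut c hc b‖ ≤ |I.bound| * (|I.bound| * ‖b‖) :=
  I.norm_le_of_apply _ (by positivity) fun z => by
    rw [toFun_cut, norm_smul]
    exact (mul_le_of_le_one_left (norm_nonneg _) (hc z.1)).trans (I.norm_apply_le b z)

theorem cut_mem_c0Sections {b : ∀ x, B x} (hb : b ∈ 𝓑.c0Sections) :
    (fun x => I.cut c hc (b x)) ∈ 𝓑.c0Sections := by
  obtain ⟨ξ, hξ, h⟩ := (I.sections_iff b).1 hb
  refine (I.sections_iff _).2 ⟨_, BanachField.smul_mem_c0Sections hξ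
    (c := fun z => (c z : ℂ)) (by fun_prop) hc, fun x z => ?_⟩
  rw [toFun_cut, h]

/-- The description of sections of the push-forward concerns only those vanishing at infinity. A
general section is therefore first approximated locally by such sections, and continuity of `cut`
transfers the approximation. -/
theorem isSectionAt_cut [T2Space X] [LocallyCompactSpace X] {Y : Type*} [TopologicalSpace Y]
    {p : Y → X} {σ : ∀ y, B (p y)} {y : Y} (h : 𝓑.IsSectionAt p σ y) (hp : ContinuousAt p y) :
    𝓑.IsSectionAt p (fun y => I.cut c hc (σ y)) y := by
  intro ε hε
  obtain ⟨b, hb, h1⟩ := h.exists_c0 hp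
    (show 0 < ε / (|I.bound| * |I.bound| + 1) by positivity)
  refine ⟨_, (I.cut_mem_c0Sections c hc hb).1, ?_⟩
  filter_upwards [h1] with y' h1
  rw [← cut_sub]
  refine (I.norm_cut_le c hc _).trans ?_
  rw [le_div_iff₀ (by positivity)] at h1
  nlinarith [norm_nonneg (σ y' - b (p y'))]

/-- A section with compact support is small outside of a compact subset of `Z`. -/
theorem exists_compact_norm_le [T2Space X] [LocallyCompactSpace X] {Y : Type*}
    [TopologicalSpace Y] {p : Y → X} (hp : Continuous p) {σ : ∀ y, B (p y)}
    (h : 𝓑.IsSection p σ) {K : Set Y} (hK : IsCompact K) {ε : ℝ} (hε : 0 < ε) :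
    ∃ M : Set Z, IsCompact M ∧ ∀ y ∈ K, ∀ z : {z : Z // S.ρ z = p y}, z.1 ∉ M →
      ‖I.toFun (p y) (σ y) z‖ ≤ ε := by
  refine hK.induction_on (p := fun s => ∃ M : Set Z, IsCompact M ∧ ∀ y ∈ s,
    ∀ z : {z : Z // S.ρ z = p y}, z.1 ∉ M → ‖I.toFun (p y) (σ y) z‖ ≤ ε) ?_ ?_ ?_ ?_
  · exact ⟨∅, isCompact_empty, by simp⟩
  · rintro s t hst ⟨M, hM, h⟩
    exact ⟨M, hM, fun y hy => h y (hst hy)⟩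
  · rintro s t ⟨M, hM, h⟩ ⟨N, hN, h'⟩
    refine ⟨M ∪ N, hM.union hN, ?_⟩
    rintro y (hy | hy) z hz
    · exact h y hy z fun hc => hz (Or.inl hc)
    · exact h' y hy z fun hc => hz (Or.inr hc)
  · intro y _
    -- Half of ε is reserved for the approximation error after evaluation, which costs a factor
    -- |bound|, and half for the values of ξ outside `M`.
    obtain ⟨b, hb, h1⟩ := (h y).exists_c0 hp.continuousAt
      (show 0 < ε / (2 * (|I.bound| + 1)) by positivity)
    obtain ⟨ξ, hξ, hbξ⟩ := (I.sections_iff b).1 hb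
    obtain ⟨M, hM, hM'⟩ := hξ.2 (ε / 2) (by positivity)
    refine ⟨_, mem_nhdsWithin_of_mem_nhds h1, M, hM, fun y' hy' z hz => ?_⟩
    have e : I.toFun (p y') (σ y') z =
        I.toFun (p y') (σ y' - b (p y')) z + I.toFun (p y') (b (p y')) z := by
      rw [map_sub, Pi.sub_apply, sub_add_cancel]
    rw [e]
    have a1 := I.norm_apply_le (σ y' - b (p y')) z
    have a2 : ‖I.toFun (p y') (b (p y')) z‖ ≤ ε / 2 := by
      rw [hbξ]
      exact hM' _ hz
    have a3 : ‖σ y' - b (p y')‖ ≤ ε / (2 * (|I.bound| + 1)) := hy'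
    rw [le_div_iff₀ (by positivity)] at a3
    have := norm_nonneg (σ y' - b (p y'))
    refine (norm_add_le _ _).trans ?_
    nlinarith

/-- By equivariance the value of γb at z is the image of the value of b at γ⁻¹z. The endpoints of γ
are left free so that the result applies to transported elements. -/
theorem toFun_act_eq_zero {γ : G} {x y : X} (hs : 𝒢.s γ = x) (hr : 𝒢.r γ = y) (b : B x)
    (z : {z : Z // S.ρ z = y}) (hz : S.ρ (S.smul (𝒢.inv γ) z.1) = x)
    (h : I.toFun x b ⟨S.smul (𝒢.inv γ) z.1, hz⟩ = 0) :
    I.toFun y (𝓑.act γ hs hr b) z = 0 := by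
  subst hs hr
  obtain ⟨z, hz'⟩ := z
  rw [I.equivariant γ b z hz']
  exact (congrArg _ h).trans (map_zero _)

end Cut

/-! ### Proper algebras: sections with compact support in Z -/

section Support

variable {X G Z : Type*} [TopologicalSpace X] [TopologicalSpace G] [TopologicalSpace Z]
  {𝒢 : TopGroupoid X G} {S : 𝒢.Space Z}
  {B : X → Type*} [∀ x, NonUnitalNormedRing (B x)] [∀ x, NormedSpace ℂ (B x)]
  {B' : Z → Type*} [∀ z, NonUnitalNormedRing (B' z)] [∀ z, NormedSpace ℂ (B' z)]
  {𝓑 : GBanachAlgebra 𝒢 B} {𝓑' : GBanachAlgebra S.transformationGroupoid B'}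
  (I : PushforwardIso 𝓑 𝓑')
  [MeasurableSpace G] [BorelSpace G] [T2Space X] [T2Space G] [LocallyCompactSpace G]
  {μ : 𝒢.HaarSystem} (C : UnconditionalSeminorm μ)
  [∀ x, CompleteSpace (B x)] [∀ x, IsScalarTower ℂ (B x) (B x)]
  [∀ x, SMulCommClass ℂ (B x) (B x)]

/-- The compactly supported sections with values supported in a fixed compact subset of `Z`. -/
def supportedSections : Set (ConvAlg C 𝓑) :=
  {σ | ∃ M : Set Z, IsCompact M ∧
    ∀ γ (z : {z : Z // S.ρ z = 𝒢.r γ}), z.1 ∉ M → I.toFun (𝒢.r γ) (σ.1 γ) z = 0}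

/-- Over the compact support of σ, the values of σ are uniformly small outside a compact subset of
Z. Multiplying by a bump function equal to 1 on that subset changes σ little in supremum norm
without enlarging its support in 𝒢, hence little in the norm of `C`. -/
theorem dense_supportedSections [T2Space Z] [LocallyCompactSpace Z] [LocallyCompactSpace X] :
    Dense (I.supportedSections C) := by
  rw [Metric.dense_iff]
  intro σ ε hε
  obtain ⟨hσ, K, hK, h0⟩ := σ.2
  obtain ⟨N, hN, hNb⟩ := exists_norm_le_of_support C 𝓑 hK
  -- Evaluation on Z is norm-equivalent up to |bound|, and `N` compares the supremum norm with that
  -- of `C`; the total error |bound| δ N must stay below ε.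
  set δ : ℝ := ε / (|I.bound| * N + 1) with hδ'
  have hδ : 0 < δ := by positivity
  obtain ⟨M, hM, hMσ⟩ := I.exists_compact_norm_le 𝒢.continuous_r hσ hK hδ
  obtain ⟨c, hc1, -, hcs, hc01⟩ := exists_continuous_one_zero_of_isCompact hM isClosed_empty
    (disjoint_empty _)
  have hc : ∀ z, ‖(c z : ℂ)‖ ≤ 1 := fun z => by
    rw [Complex.norm_real, Real.norm_of_nonneg (hc01 z).1]
    exact (hc01 z).2
  let τ : ConvAlg C 𝓑 := ⟨fun γ => I.cut c hc (σ.1 γ),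
    fun γ => I.isSectionAt_cut c hc (hσ γ) 𝒢.continuous_r.continuousAt, K, hK, fun γ hγ => by
      change I.cut c hc (σ.1 γ) = 0
      rw [h0 γ hγ, cut_zero]⟩
  have hτ : ∀ γ, τ.1 γ = I.cut c hc (σ.1 γ) := fun _ => rfl
  have hτσ : ‖τ - σ‖ ≤ |I.bound| * δ * N := by
    refine hNb (τ - σ) _ (by positivity) (fun γ hγ => ?_) fun γ => ?_
    · change τ.1 γ - σ.1 γ = 0
      rw [hτ, h0 γ hγ, cut_zero, sub_zero]
    · refine I.norm_le_of_apply _ hδ.le fun z => ?_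
      change ‖I.toFun _ (τ.1 γ - σ.1 γ) z‖ ≤ δ
      rw [hτ, map_sub, Pi.sub_apply, toFun_cut]
      by_cases hz : z.1 ∈ M
      · rw [hc1 hz]
        simpa using hδ.le
      · have e : (c z.1 : ℂ) • I.toFun (𝒢.r γ) (σ.1 γ) z - I.toFun (𝒢.r γ) (σ.1 γ) z =
            ((c z.1 - 1 : ℝ) : ℂ) • I.toFun (𝒢.r γ) (σ.1 γ) z := by
          rw [Complex.ofReal_sub, sub_smul, Complex.ofReal_one, one_smul]
        rw [e, norm_smul, Complex.norm_real]
        have h1 : ‖c z.1 - 1‖ ≤ 1 := by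
          rw [Real.norm_eq_abs, abs_le]
          have := hc01 z.1
          exact ⟨by linarith [this.1], by linarith [this.2]⟩
        refine (mul_le_of_le_one_left (norm_nonneg _) h1).trans ?_
        by_cases hγ : γ ∈ K
        · exact hMσ γ hγ z hz
        · rw [h0 γ hγ, map_zero, Pi.zero_apply, norm_zero]
          exact hδ.le
  refine ⟨τ, ?_, tsupport c, hcs, fun γ z hz => ?_⟩
  · rw [Metric.mem_ball, dist_eq_norm]
    refine lt_of_le_of_lt hτσ ?_
    rw [hδ', mul_div_assoc', div_mul_eq_mul_div, div_lt_iff₀ (by positivity)]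
    nlinarith
  · rw [hτ, toFun_cut, image_eq_zero_of_notMem_tsupport hz, Complex.ofReal_zero, zero_smul]

variable [∀ z, CompleteSpace (B' z)]

variable {C} in
/-- The value of a product at a point of `Z` vanishes if that of the integrand does. -/
theorem toFun_mul_eq_zero (σ τ : ConvAlg C 𝓑) (γ : G) (z : {z : Z // S.ρ z = 𝒢.r γ})
    (h : ∀ γ' (hγ' : 𝒢.r γ' = 𝒢.r γ),
      I.toFun (𝒢.r γ) (𝓑.integrand σ.1 τ.1 γ' γ hγ' rfl) z = 0) :
    I.toFun (𝒢.r γ) ((σ * τ).1 γ) z = 0 := by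
  obtain ⟨hσ, K, hK, h0⟩ := σ.2
  have hi := integrable_integrand (μ := μ) hσ τ.2.1 hK h0 γ rfl
  rw [← eval_apply]
  change I.eval z (∫ γ' : {γ' : G // 𝒢.r γ' = 𝒢.r γ}, _ ∂(μ.μ (𝒢.r γ))) = 0
  -- Evaluation at z is continuous and linear, so it may be taken under the integral.
  rw [← ContinuousLinearMap.integral_comp_comm _ hi]
  exact integral_eq_zero_of_ae (Eventually.of_forall fun γ' => h γ'.1 γ'.2)

variable {C} in
-- Suppose the product is nonzero at γ and z. The factor σ on the left forces z into M. For some γ'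
-- the factor τ forces γ'⁻¹γ into supp τ and γ'⁻¹z into M', so γ⁻¹z = (γ'⁻¹γ)⁻¹(γ'⁻¹z) lies in the
-- compact set (supp τ)⁻¹M'. Neither condition involves χ. Properness of 𝒢 ⋉ Z makes the set of such
-- arrows (γ, z) compact, and γ lies in its projection to 𝒢.
theorem exists_support_of_isProper (hS : S.IsProper) {σ τ : ConvAlg C 𝓑}
    (hσ : σ ∈ I.supportedSections C) (hτ : τ ∈ I.supportedSections C) :
    ∃ K : Set G, IsCompact K ∧ ∀ (χ : ConvAlg C 𝓑), ∀ γ ∉ K, (σ * χ * τ).1 γ = 0 := by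
  obtain ⟨M, hM, hσM⟩ := hσ
  obtain ⟨M', hM', hτM⟩ := hτ
  obtain ⟨-, L, hL, hτL⟩ := τ.2
  -- the set of all `η⁻¹ z` with `η ∈ L`, `z ∈ M'`
  let N : Set Z := (fun q : G × Z => S.smul (𝒢.inv q.1) q.2) ''
    (L ×ˢ M' ∩ {q | 𝒢.r q.1 = S.ρ q.2})
  have hN : IsCompact N := by
    refine ((hL.prod hM').inter_right (isClosed_eq (𝒢.continuous_r.comp continuous_fst)
      (S.continuous_ρ.comp continuous_snd))).image_of_continuousOn ?_
    refine S.continuousOn_smul.comp (f := fun q : G × Z => (𝒢.inv q.1, q.2))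
      ((𝒢.continuous_inv.comp continuous_fst).prodMk continuous_snd).continuousOn ?_
    rintro q ⟨-, hq⟩
    change 𝒢.s (𝒢.inv q.1) = S.ρ q.2
    rw [𝒢.s_inv]
    exact hq
  refine ⟨_, (hS _ (hM.prod hN)).image (continuous_fst.comp continuous_subtype_val),
    fun χ γ hγ => I.eq_of_apply fun z => ?_⟩
  rw [map_zero, Pi.zero_apply]
  by_cases hz : z.1 ∈ M
  · refine I.toFun_mul_eq_zero _ _ γ z fun γ' hγ' => ?_
    rw [integrand, map_mul, Pi.mul_apply]
    have hzρ : S.ρ (S.smul (𝒢.inv γ') z.1) = 𝒢.r (𝒢.mul (𝒢.inv γ') γ) := by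
      rw [S.ρ_inv_smul (hγ'.trans z.2.symm), 𝒢.r_inv_mul hγ']
    rw [translate, I.toFun_act_eq_zero _ _ _ z hzρ, mul_zero]
    by_contra hne
    have h1 : S.smul (𝒢.inv γ') z.1 ∈ M' := by
      by_contra hc
      exact hne (hτM _ _ hc)
    have h2 : 𝒢.mul (𝒢.inv γ') γ ∈ L := by
      by_contra hc
      exact hne (by rw [hτL _ hc, map_zero, Pi.zero_apply])
    -- The unknown arrow γ' cancels in (γ'⁻¹γ)⁻¹(γ'⁻¹z) = γ⁻¹z, which exhibits the source of (γ, z)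
    -- as a point of `N`.
    refine hγ ⟨⟨(γ, z.1), z.2.symm⟩, ⟨hz, ⟨(𝒢.mul (𝒢.inv γ') γ, S.smul (𝒢.inv γ') z.1),
      ⟨⟨h2, h1⟩, hzρ.symm⟩, ?_⟩⟩, rfl⟩
    change S.smul (𝒢.inv (𝒢.mul (𝒢.inv γ') γ)) (S.smul (𝒢.inv γ') z.1) =
      S.smul (𝒢.inv γ) z.1
    have h3 : 𝒢.s (𝒢.inv γ') = 𝒢.r γ := by rw [𝒢.s_inv, hγ']
    rw [← S.mul_smul _ _ _ (by rw [𝒢.s_inv, 𝒢.r_mul _ _ h3])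
      (by rw [𝒢.s_inv, hγ', z.2]), ← 𝒢.eq_of_inv_mul (γ := 𝒢.mul (𝒢.inv γ') γ)
        (η := 𝒢.inv γ) (by rw [𝒢.s_mul _ _ h3, 𝒢.r_inv])]
    rw [𝒢.mul_assoc _ _ _ h3 (𝒢.r_inv γ).symm, 𝒢.mul_inv, ← h3, 𝒢.mul_unit]
  · refine I.toFun_mul_eq_zero _ _ γ z fun γ' hγ' => ?_
    rw [integrand, map_mul, Pi.mul_apply]
    suffices h : I.toFun (𝒢.r γ) (transport hγ' ((σ * χ).1 γ')) z = 0 by rw [h, zero_mul]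
    -- The base point is generalised so that the transport between equal fibres can be eliminated;
    -- the same device is repeated for σ.
    have key : ∀ (x : X) (hx : 𝒢.r γ' = x) (z : {z : Z // S.ρ z = x}), z.1 ∉ M →
        I.toFun x (transport hx ((σ * χ).1 γ')) z = 0 := by
      rintro x rfl z hz
      refine I.toFun_mul_eq_zero _ _ γ' z fun γ'' hγ'' => ?_
      rw [integrand, map_mul, Pi.mul_apply]
      have key' : ∀ (x : X) (hx : 𝒢.r γ'' = x) (z : {z : Z // S.ρ z = x}), z.1 ∉ M →
          I.toFun x (transport hx (σ.1 γ'')) z = 0 := by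
        rintro x rfl z hz
        exact hσM γ'' z hz
      rw [key' _ hγ'' z hz, zero_mul]
    exact key _ hγ' z hz

end Support

end PushforwardIso

end GBanachAlgebra

/-! ### The supremum of two unconditional semi-norms -/

section Sup

variable {X : Type*} {G : Type*} [TopologicalSpace X] [TopologicalSpace G] {𝒢 : TopGroupoid X G}
  [MeasurableSpace G] [BorelSpace G] [T2Space X] [T2Space G] [LocallyCompactSpace G]
  {μ : 𝒢.HaarSystem}

/-- The supremum of two unconditional semi-norms. -/
noncomputable def UnconditionalSeminorm.sup (A A' : UnconditionalSeminorm μ) : UnconditionalSeminorm μ where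
  toSeminorm := A.toSeminorm ⊔ A'.toSeminorm
  mono φ ψ h := max_le_max (A.mono φ ψ h) (A'.mono φ ψ h)
  conv_le f g := by
    have h1 := A.conv_le f g
    have h2 := A'.conv_le f g
    change max (A.toSeminorm _) (A'.toSeminorm _) ≤
      max (A.toSeminorm f) (A'.toSeminorm f) * max (A.toSeminorm g) (A'.toSeminorm g)
    refine max_le (h1.trans ?_) (h2.trans ?_)
    · exact mul_le_mul (le_max_left _ _) (le_max_left _ _) (apply_nonneg A.toSeminorm _)
        (le_max_of_le_left (apply_nonneg A.toSeminorm _))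
    · exact mul_le_mul (le_max_right _ _) (le_max_right _ _) (apply_nonneg A'.toSeminorm _)
        (le_max_of_le_left (apply_nonneg A.toSeminorm _))

end Sup

/-- For proper `B` or proper `G` the comparison maps are isomorphisms in K-theory. -/
theorem GBanachAlgebra.K_map_comparison_bijective_of_isProper {X : Type uX} {G : Type uG}
    [TopologicalSpace X] [TopologicalSpace G]
    [T2Space X] [LocallyCompactSpace X] [T2Space G] [LocallyCompactSpace G]
    [MeasurableSpace G] [BorelSpace G] {𝒢 : TopGroupoid X G} {μ : 𝒢.HaarSystem}
    {B : X → Type uB} [∀ x, NonUnitalNormedRing (B x)] [∀ x, NormedSpace ℂ (B x)]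
    [∀ x, CompleteSpace (B x)] [∀ x, IsScalarTower ℂ (B x) (B x)]
    [∀ x, SMulCommClass ℂ (B x) (B x)] {𝓑 : GBanachAlgebra 𝒢 B}
    (hp : GBanachAlgebra.IsProper.{uX, uG, uB, uZ, uB'} 𝓑 ∨ 𝒢.IsProper)
    {A C : UnconditionalSeminorm μ} (hA : A.IsRegular)
    (h : ∀ f, A.toSeminorm f ≤ C.toSeminorm f) (n : ℕ) :
    Function.Bijective (K.map n (𝓑.comparison h) (𝓑.continuous_comparison h)) := by
  rcases hp with ⟨Z, _, _, _, S, hS, B', _, _, _, _, _, 𝓑', ⟨I⟩⟩ | hG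
  · exact K_map_comparison_bijective hA h (I.dense_supportedSections C)
      (fun σ hσ τ hτ => I.exists_support_of_isProper hS hσ hτ) n
  · exact K_map_comparison_bijective hA h dense_univ
      (fun σ _ τ _ => exists_support_of_isProper hG σ τ) n

end ProperBanach

theorem mainTheorem10 {X : Type uX} {G : Type uG} [TopologicalSpace X] [TopologicalSpace G]
    [T2Space X] [LocallyCompactSpace X] [T2Space G] [LocallyCompactSpace G]
    [MeasurableSpace G] [BorelSpace G] (𝒢 : TopGroupoid X G) (μ : 𝒢.HaarSystem)
    (B : X → Type uB) [∀ x, NonUnitalNormedRing (B x)] [∀ x, NormedSpace ℂ (B x)]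
    [∀ x, CompleteSpace (B x)] [∀ x, IsScalarTower ℂ (B x) (B x)]
    [∀ x, SMulCommClass ℂ (B x) (B x)] (𝓑 : GBanachAlgebra 𝒢 B) (hB : 𝓑.Nondegenerate)
    (A A' : UnconditionalSeminorm μ) (hA : A.IsRegular) (hA' : A'.IsRegular) :
    ((GBanachAlgebra.IsProper.{uX, uG, uB, uZ, uB'} 𝓑 ∨ 𝒢.IsProper) →
      (∀ (C : UnconditionalSeminorm μ) (h : ∀ f, A.toSeminorm f ≤ C.toSeminorm f)
        (h' : ∀ f, A'.toSeminorm f ≤ C.toSeminorm f) (n : ℕ),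
        Function.Bijective (K.map n (𝓑.comparison h) (𝓑.continuous_comparison h)) ∧
        Function.Bijective (K.map n (𝓑.comparison h') (𝓑.continuous_comparison h'))) ∧
      ∀ n : ℕ, ∃! Φ : K (GBanachAlgebra.CrossedProduct A 𝓑) n ≃+
          K (GBanachAlgebra.CrossedProduct A' 𝓑) n,
        ∀ (C : UnconditionalSeminorm μ) (h : ∀ f, A.toSeminorm f ≤ C.toSeminorm f)
          (h' : ∀ f, A'.toSeminorm f ≤ C.toSeminorm f)
          (c : K (GBanachAlgebra.CrossedProduct C 𝓑) n),
          Φ (K.map n (𝓑.comparison h) (𝓑.continuous_comparison h) c) =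
            K.map n (𝓑.comparison h') (𝓑.continuous_comparison h') c) ∧
    (𝒢.IsProper →
      (∀ (σ τ : GBanachAlgebra.ConvAlg A 𝓑) (a : GBanachAlgebra.CrossedProduct A 𝓑),
        ∃ υ : GBanachAlgebra.ConvAlg A 𝓑,
          BanachCompletion.of σ * a * BanachCompletion.of τ = BanachCompletion.of υ) ∧
      (∀ σ ν τ : GBanachAlgebra.ConvAlg A 𝓑, BanachCompletion.of ν = 0 → σ * ν * τ = 0) ∧
      (∀ ν₁ ν₂ ν₃ : GBanachAlgebra.ConvAlg A 𝓑, BanachCompletion.of ν₁ = 0 →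
        BanachCompletion.of ν₂ = 0 → BanachCompletion.of ν₃ = 0 → ν₁ * ν₂ * ν₃ = 0)) := by
  refine ⟨fun hp => ⟨fun C h h' n =>
    ⟨GBanachAlgebra.K_map_comparison_bijective_of_isProper hp hA h n,
      GBanachAlgebra.K_map_comparison_bijective_of_isProper hp hA' h' n⟩, fun n => ?_⟩,
    fun hG => ⟨fun σ τ a => GBanachAlgebra.exists_of_mul_mul_eq hA hG σ τ a,
      fun σ ν τ hν => GBanachAlgebra.mul_mul_eq_zero_of_of_eq_zero hA σ ν τ hν,
      fun ν₁ ν₂ ν₃ _ h₂ _ => GBanachAlgebra.mul_mul_eq_zero_of_of_eq_zero hA ν₁ ν₂ ν₃ h₂⟩⟩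
  -- The supremum is the least unconditional semi-norm dominating both, and it need not be regular:
  -- regularity is required only of the targets of the comparison maps.
  have h : ∀ f, A.toSeminorm f ≤ (A.sup A').toSeminorm f := fun f => le_max_left _ _
  have h' : ∀ f, A'.toSeminorm f ≤ (A.sup A').toSeminorm f := fun f => le_max_right _ _
  have hb := GBanachAlgebra.K_map_comparison_bijective_of_isProper hp hA h n
  have hb' := GBanachAlgebra.K_map_comparison_bijective_of_isProper hp hA' h' n
  let e := AddEquiv.ofBijective (K.map n (𝓑.comparison h) (𝓑.continuous_comparison h)) hb
  let e' := AddEquiv.ofBijective (K.map n (𝓑.comparison h') (𝓑.continuous_comparison h')) hb'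
  have he : ∀ c, (e.symm.trans e') (K.map n (𝓑.comparison h) (𝓑.continuous_comparison h) c) =
      K.map n (𝓑.comparison h') (𝓑.continuous_comparison h') c := fun c =>
    congrArg e' (e.symm_apply_apply c)
  refine ⟨e.symm.trans e', fun C hC hC' c => ?_, fun Φ hΦ => ?_⟩
  -- Any other dominating semi-norm dominates the supremum, so both of its comparison maps factor
  -- through that of the supremum.
  · have hCs : ∀ f, (A.sup A').toSeminorm f ≤ C.toSeminorm f := fun f => max_le (hC f) (hC' f)
    rw [← K.map_map n (𝓑.continuous_comparison hCs) (𝓑.continuous_comparison h)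
      (𝓑.continuous_comparison hC) (GBanachAlgebra.comparison_comparison hCs h hC), he,
      K.map_map n (𝓑.continuous_comparison hCs) (𝓑.continuous_comparison h')
      (𝓑.continuous_comparison hC') (GBanachAlgebra.comparison_comparison hCs h' hC')]
  -- Every class comes from the completion for the supremum, where the required identity prescribes
  -- the value.
  · refine AddEquiv.ext fun k => ?_
    obtain ⟨c, rfl⟩ := hb.2 k
    rw [he, hΦ _ h h']
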